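/- Let $\bar M$ be a compact smooth three-dimensional manifold with boundary $\partial M$ and interior $M$, let $\rho\colon\bar M\to[0,\infty)$ be a smooth defining function of $\partial M$, and let $g=\rho^{-2}\bar g$, where $\bar g$ is a smooth Riemannian metric on $\bar M$ with $|d\rho|_{\bar g}=1$ along $\partial M$ (so $(M,g)$ is asymptotically hyperbolic and smoothly conformally compact). Let $E$ be a tensor bundle, i.e. the bundle of those tensors of a fixed covariant rank $q$ and contravariant rank $p$ whose components in $\bar g$-orthonormal frames lie in a fixed $O(3)$-invariant subspace, and let $r=q-p$ be its weight. All sections are allowed to be complex-valued. Let $\mathcal P$ be a linear second-order elliptic operator on sections of $E$ over $M$ that is formally self-adjoint in $L^2(M,g)$ and geometric: in every coordinate chart the components of $\mathcal Pu$ are given by one and the same expression, linear in the components of $u$ and their partial derivatives, whose coefficients are universal polynomials in the components of $g$, their partial derivatives and $(\det g_{ij})^{-1/2}$, the coefficient of a $j$-th derivative of $u$ involving at most $2-j$ derivatives of the metric. For $s\in\mathbb C$ and a smooth section $\bar u$ of $E$ over $\bar M$ let $I_s(\mathcal P)\bar u=\rho^{-s}\mathcal P(\rho^s\bar u)|_{\rho=0}$.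 The characteristic exponents of $\mathcal P$ are the $s\in\mathbb C$ for which $I_s(\mathcal P)$ has a nontrivial kernel on $E\otimes\mathbb C$ at some point of $\partial M$; let $\mu$ be the maximum of their real parts. Let $C^k_t(M)$ be the space of $C^k$ tensor fields on $M$ whose derivatives up to order $k$ are $O(\rho^t)$, measured in $g$; equivalently, on compact subsets of charts of $\bar M$, the $j$-th coordinate derivatives ($j\le k$) of the components are $O(\rho^{t-r-j})$. Put $\mathcal B_\delta(M)=\bigcap_{k\ge 0,\,t<\delta}C^k_t(M)$. A smooth section $u$ of $E$ over $M$ is polyhomogeneous if there are $s_i\in\mathbb C$ with $\operatorname{Re}s_i$ non-decreasing and tending to $+\infty$, $p_i\in\mathbb N_0$, and smooth sections $\bar u_{im}$ of $E|_{\partial M}$ ($0\le m\le p_i$), extended smoothly to $\bar M$, such that for every $k\in\mathbb N_0$ there is $N_k$ with $$u-\sum_{i=0}^{N_k}\sum_{m=0}^{p_i}\rho^{s_i-r}(\log\rho)^m\,\bar u_{im}\in\mathcal B_k(M).$$ Let $\mathcal B^{\mathrm{phg}}_\delta(M)$ be the set of polyhomogeneous sections that lie in $\mathcal B_\delta(M)$.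 Suppose that $u$ is a polyhomogeneous section of $E$ such that 1. $\mathcal Pu$ extends to a section in $C^\infty(\bar M)$, and 2. there exists $\delta>\mu$ with $u\in C^\infty(\bar M)+\mathcal B^{\mathrm{phg}}_{\delta+r}(M)$. Then $u$ extends to a section in $C^\infty(\bar M)$. -/

import Mathlib

open scoped Manifold ContDiff Topology

noncomputable section

namespace AsympHyp

/-! ### Tensors and their types -/

/-- Complexified mixed tensors on a real vector space `V`: multilinear in `q` vectors and in `p`
covectors, with complex values. Real tensors are the real-valued ones. -/
abbrev CTensor (q p : ℕ) (V : Type*) [AddCommGroup V] [Module ℝ V] : Type _ :=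
  MultilinearMap ℝ (fun _ : Fin q => V)
    (MultilinearMap ℝ (fun _ : Fin p => Module.Dual ℝ V) ℂ)

/-- Index of a tensor component in dimension three: lower indices, then upper indices. -/
abbrev Idx (q p : ℕ) : Type := (Fin q → Fin 3) × (Fin p → Fin 3)

/-- The action of a `3 × 3` matrix on component arrays of tensors. For an orthogonal matrix this
is the standard representation on tensors (lower and upper indices transform alike). -/
def rotate {q p : ℕ} (R : Matrix (Fin 3) (Fin 3) ℝ) (v : Idx q p → ℝ) : Idx q p → ℝ :=
  fun K => ∑ K' : Idx q p,
    (∏ a, R (K.1 a) (K'.1 a)) * (∏ b, R (K.2 b) (K'.2 b)) * v K'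

/-- The type of a tensor bundle: covariant rank, contravariant rank and an `O(3)`-invariant
subspace of the tensors of that rank on `ℝ³` (all tensors, symmetric tensors, trace-free symmetric
tensors, forms, ...). -/
structure TensorType where
  cov : ℕ
  contra : ℕ
  fiber : Submodule ℝ (Idx cov contra → ℝ)
  invariant : ∀ R ∈ Matrix.orthogonalGroup (Fin 3) ℝ, ∀ v ∈ fiber, rotate R v ∈ fiber

/-- The weight of a tensor bundle: the covariant rank less the contravariant rank. -/
def TensorType.weight (E : TensorType) : ℝ := (E.cov : ℝ) - (E.contra : ℝ)

variable {M : Type*} [TopologicalSpace M] [ChartedSpace (EuclideanHalfSpace 3) M]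

/-! ### Asymptotically hyperbolic manifolds -/

variable (M) in
/-- A smoothly conformally compact asymptotically hyperbolic structure on the interior of the
three-manifold with boundary `M`: a smooth defining function `ρ` of the boundary and a smooth
Riemannian metric `gbar` on all of `M` with `|dρ| = 1` along the boundary.
The asymptotically hyperbolic metric on the interior is `ρ⁻² gbar`. -/
structure AHStructure [IsManifold (𝓡∂ 3) ∞ M] where
  ρ : M → ℝ
  gbar : Bundle.ContMDiffRiemannianMetric (𝓡∂ 3) ∞ (EuclideanSpace ℝ (Fin 3))
    (fun x : M => TangentSpace (𝓡∂ 3) x)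
  ρ_smooth : ContMDiff (𝓡∂ 3) 𝓘(ℝ) ∞ ρ
  ρ_pos : ∀ x ∈ (𝓡∂ 3).interior M, 0 < ρ x
  ρ_zero : ∀ x ∈ (𝓡∂ 3).boundary M, ρ x = 0
  /-- the `gbar`-gradient of `ρ` has length one along the boundary -/
  unit_gradient : ∀ x ∈ (𝓡∂ 3).boundary M, ∃ ν : TangentSpace (𝓡∂ 3) x,
    (∀ w : TangentSpace (𝓡∂ 3) x, gbar.inner x ν w = (mfderiv (𝓡∂ 3) 𝓘(ℝ) ρ x w : ℝ)) ∧
      gbar.inner x ν ν = 1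

/-! ### Tensor fields and coordinates -/

variable (M) in
/-- Tensor fields (complexified, no regularity). Fields that live only on the interior are
represented by arbitrary extensions; their values at the boundary are never used. -/
abbrev TensorField (E : TensorType) : Type _ :=
  (x : M) → CTensor E.cov E.contra (TangentSpace (𝓡∂ 3) x)

/-- The coordinate vector field `∂ᵢ` of the chart `e`, at `x`. -/
def coordVec (e : OpenPartialHomeomorph M (EuclideanHalfSpace 3)) (x : M) (i : Fin 3) :
    TangentSpace (𝓡∂ 3) x :=
  mfderivWithin 𝓘(ℝ, EuclideanSpace ℝ (Fin 3)) (𝓡∂ 3) (e.extend (𝓡∂ 3)).symm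
    (Set.range (𝓡∂ 3)) (e.extend (𝓡∂ 3) x) (EuclideanSpace.single i (1 : ℝ))

/-- The coordinate differential `dxʲ` of the chart `e`, at `x`. -/
def coordCovec (e : OpenPartialHomeomorph M (EuclideanHalfSpace 3)) (x : M) (j : Fin 3) :
    Module.Dual ℝ (TangentSpace (𝓡∂ 3) x) :=
  (EuclideanSpace.proj j : EuclideanSpace ℝ (Fin 3) →L[ℝ] ℝ).toLinearMap ∘ₗ
    (mfderiv (𝓡∂ 3) 𝓘(ℝ, EuclideanSpace ℝ (Fin 3)) (e.extend (𝓡∂ 3)) x).toLinearMap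

/-- The components of `u` at `x` in the coordinate frame of the chart `e`. -/
def comp {E : TensorType} (e : OpenPartialHomeomorph M (EuclideanHalfSpace 3))
    (u : TensorField M E) (x : M) (K : Idx E.cov E.contra) : ℂ :=
  u x (fun a => coordVec e x (K.1 a)) (fun b => coordCovec e x (K.2 b))

/-- The components of `u` as functions of the coordinates. -/
def localComp {E : TensorType} (e : OpenPartialHomeomorph M (EuclideanHalfSpace 3))
    (u : TensorField M E) (K : Idx E.cov E.contra) : EuclideanSpace ℝ (Fin 3) → ℂ :=
  fun y => comp e u ((e.extend (𝓡∂ 3)).symm y) K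

/-- `u` is of class `Cⁿ` over `S` (used for `S` open: the interior, or the whole manifold). -/
def TensorField.SmoothOn {E : TensorType} (n : ℕ∞) (u : TensorField M E) (S : Set M) : Prop :=
  ∀ e ∈ IsManifold.maximalAtlas (𝓡∂ 3) ∞ M, ∀ K, ContDiffOn ℝ n (localComp e u K)
    ((e.extend (𝓡∂ 3)).target ∩ (e.extend (𝓡∂ 3)).symm ⁻¹' S)

variable [IsManifold (𝓡∂ 3) ∞ M] (A : AHStructure M) (E : TensorType)

namespace AHStructure

/-- The metric `g = ρ⁻² gbar` on the interior. -/
def metric (x : M) (v w : TangentSpace (𝓡∂ 3) x) : ℝ := (A.ρ x)⁻¹ ^ 2 * A.gbar.inner x v w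

/-- The fibre at `x` of the complexified tensor bundle of type `E`: the tensors whose
components in every `gbar`-orthonormal frame (with dual coframe `gbar(bⱼ, ·)`) have real and
imaginary parts in the model fibre. (The metrics `g` and `gbar` give the same condition.) -/
def MemFiber (x : M) (T : CTensor E.cov E.contra (TangentSpace (𝓡∂ 3) x)) : Prop :=
  ∀ b : Fin 3 → TangentSpace (𝓡∂ 3) x,
    (∀ i j, A.gbar.inner x (b i) (b j) = if i = j then 1 else 0) →
    (fun K : Idx E.cov E.contra =>
      (T (fun a => b (K.1 a)) (fun c => (A.gbar.inner x (b (K.2 c))).toLinearMap)).re) ∈ E.fiber ∧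
    (fun K : Idx E.cov E.contra =>
      (T (fun a => b (K.1 a)) (fun c => (A.gbar.inner x (b (K.2 c))).toLinearMap)).im) ∈ E.fiber

/-- Smooth sections over `S` of the complexified tensor bundle of type `E`. -/
structure IsSmoothSection (u : TensorField M E) (S : Set M) : Prop where
  mem : ∀ x ∈ S, A.MemFiber E x (u x)
  smooth : u.SmoothOn ⊤ S

/-- `u`, defined in the interior, extends to a smooth section on the whole manifold with
boundary. -/
def ExtendsSmoothly (u : TensorField M E) : Prop :=
  ∃ v : TensorField M E, A.IsSmoothSection E v Set.univ ∧ ∀ x ∈ (𝓡∂ 3).interior M, v x = u x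

/-! ### Weighted spaces and polyhomogeneity -/

/-- The weighted space `C^k_t`: fields of class `C^k` in the interior whose
derivatives of order `j ≤ k`, measured in the metric `g`, are `O(ρ^t)`. In a chart of the manifold
with boundary, a `j`-th derivative of the components of a tensor of weight `r` has `g`-size
`ρ^(r+j)` times its coordinate size. -/
def InC (k : ℕ) (t : ℝ) (u : TensorField M E) : Prop :=
  u.SmoothOn k ((𝓡∂ 3).interior M) ∧
  ∀ e ∈ IsManifold.maximalAtlas (𝓡∂ 3) ∞ M, ∀ Q : Set M, IsCompact Q → Q ⊆ e.source →
    ∃ C : ℝ, ∀ x ∈ Q ∩ (𝓡∂ 3).interior M, ∀ j ≤ k, ∀ K,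
      ‖iteratedFDeriv ℝ j (localComp e u K) (e.extend (𝓡∂ 3) x)‖
        ≤ C * A.ρ x ^ (t - E.weight - j)

/-- The class `𝓑_δ`, the intersection of all `C^k_t` with `k ≥ 0` and `t < δ`. -/
def InB (δ : ℝ) (u : TensorField M E) : Prop := ∀ k : ℕ, ∀ t < δ, A.InC E k t u

/-- The field `ρ^z u`. -/
def rhoPow (z : ℂ) (u : TensorField M E) : TensorField M E := fun x => ((A.ρ x : ℂ) ^ z) • u x

/-- The field `ρ^z (log ρ)^m u`. -/
def rhoPowLog (z : ℂ) (m : ℕ) (u : TensorField M E) : TensorField M E :=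
  fun x => ((A.ρ x : ℂ) ^ z * (Real.log (A.ρ x) : ℂ) ^ m) • u x

/-- Polyhomogeneous sections: smooth sections over the interior with an asymptotic expansion
`∑ᵢ ∑_{m ≤ dᵢ} ρ^(sᵢ - r) (log ρ)^m ūᵢₘ`. The coefficients are given by smooth extensions of
boundary sections to the manifold with boundary. -/
def IsPolyhomogeneous (u : TensorField M E) : Prop :=
  A.IsSmoothSection E u ((𝓡∂ 3).interior M) ∧
  ∃ (s : ℕ → ℂ) (d : ℕ → ℕ) (U : ℕ → ℕ → TensorField M E),
    Monotone (fun i => (s i).re) ∧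
    Filter.Tendsto (fun i => (s i).re) Filter.atTop Filter.atTop ∧
    (∀ i, ∀ m ≤ d i, A.IsSmoothSection E (U i m) Set.univ) ∧
    ∀ k : ℕ, ∃ N : ℕ, A.InB E k (fun x => u x -
      ∑ i ∈ Finset.range (N + 1), ∑ m ∈ Finset.range (d i + 1),
        A.rhoPowLog E (s i - (E.weight : ℂ)) m (U i m) x)

/-! ### Geometric operators -/

/-- The component `g_ij` of the metric `g` as a function of the coordinates of the chart `e`. -/
def localMetric (e : OpenPartialHomeomorph M (EuclideanHalfSpace 3)) (i j : Fin 3) :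
    EuclideanSpace ℝ (Fin 3) → ℝ :=
  fun y => A.metric ((e.extend (𝓡∂ 3)).symm y)
    (coordVec e ((e.extend (𝓡∂ 3)).symm y) i) (coordVec e ((e.extend (𝓡∂ 3)).symm y) j)

/-- The matrix `(g_ij)` in the chart `e`. -/
def gram (e : OpenPartialHomeomorph M (EuclideanHalfSpace 3)) (y : EuclideanSpace ℝ (Fin 3)) :
    Matrix (Fin 3) (Fin 3) ℝ := Matrix.of fun i j => A.localMetric e i j y

end AHStructure

/-- The variables of the universal polynomials: the partial derivatives of order at most `k` of the
metric components, and `(det g)^(-1/2)`. (Since `det g` is a polynomial in the components of `g`,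
polynomials in these variables include those involving `(det g)^(1/2)`.) -/
inductive MetricVar (k : ℕ) : Type
  | deriv (m : ℕ) (hm : m ≤ k) (α : Fin m → Fin 3) (i j : Fin 3) : MetricVar k
  | invSqrtDet : MetricVar k

/-- Universal polynomial coefficients of an operator of order `l`: the coefficient of a `j`-th
derivative `∂_α u_K'` in the component `K` of the result involves at most `l - j` derivatives
of the metric. -/
abbrev UniversalCoeffs (l q p : ℕ) : Type :=
  (j : ℕ) → (Fin j → Fin 3) → Idx q p → Idx q p → MvPolynomial (MetricVar (l - j)) ℝ

namespace AHStructure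

/-- The values of the metric variables in the chart `e` at the coordinate point `y`. -/
def metricVarValue (e : OpenPartialHomeomorph M (EuclideanHalfSpace 3))
    (y : EuclideanSpace ℝ (Fin 3)) {k : ℕ} : MetricVar k → ℝ
  | .deriv m _ α i j =>
      iteratedFDeriv ℝ m (A.localMetric e i j) y (fun a => EuclideanSpace.single (α a) (1 : ℝ))
  | .invSqrtDet => (Real.sqrt (A.gram e y).det)⁻¹

/-- `P` is a geometric operator of order `l` acting on sections of `E`: it maps sections
to sections, and in every chart the components of `P u` are given by the same expression, linear in
`u` and its partial derivatives, with coefficients universal polynomials in the metric. -/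
def IsGeometric (l : ℕ) (P : TensorField M E → TensorField M E) : Prop :=
  (∀ u, A.IsSmoothSection E u ((𝓡∂ 3).interior M) →
    A.IsSmoothSection E (P u) ((𝓡∂ 3).interior M)) ∧
  ∃ coeff : UniversalCoeffs l E.cov E.contra,
    ∀ u, A.IsSmoothSection E u ((𝓡∂ 3).interior M) →
    ∀ e ∈ IsManifold.maximalAtlas (𝓡∂ 3) ∞ M, ∀ x ∈ e.source ∩ (𝓡∂ 3).interior M, ∀ K,
      comp e (P u) x K =
        ∑ j ∈ Finset.range (l + 1), ∑ α : Fin j → Fin 3, ∑ K' : Idx E.cov E.contra,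
          ((MvPolynomial.eval (A.metricVarValue e (e.extend (𝓡∂ 3) x)) (coeff j α K K') : ℝ) : ℂ) *
            iteratedFDeriv ℝ j (localComp e u K') (e.extend (𝓡∂ 3) x)
              (fun a => EuclideanSpace.single (α a) (1 : ℝ))

/-- Ellipticity of a second-order operator: the principal symbol is injective (hence, the ranks
being equal, invertible) on the fibres of `E` at each interior point and each nonzero real
covector. If `f x = 0`, then `P (f² u) x` is twice the symbol of `P` at `df x` applied
to `u x`. -/
def IsElliptic (P : TensorField M E → TensorField M E) : Prop :=
  ∀ x ∈ (𝓡∂ 3).interior M, ∀ f : M → ℝ, ContMDiff (𝓡∂ 3) 𝓘(ℝ) ∞ f → f x = 0 →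
    mfderiv (𝓡∂ 3) 𝓘(ℝ) f x ≠ 0 →
    ∀ u, A.IsSmoothSection E u ((𝓡∂ 3).interior M) → u x ≠ 0 →
      P (fun z => ((f z : ℂ) ^ 2) • u z) x ≠ 0

/-- The Hermitian inner product of two tensor fields at `x` with respect to the metric `g`,
computed in the chart `e`. -/
def tensorInner (e : OpenPartialHomeomorph M (EuclideanHalfSpace 3)) (u v : TensorField M E)
    (x : M) : ℂ :=
  ∑ K : Idx E.cov E.contra, ∑ K' : Idx E.cov E.contra,
    (((∏ a, (A.gram e (e.extend (𝓡∂ 3) x))⁻¹ (K.1 a) (K'.1 a)) *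
      (∏ b, A.gram e (e.extend (𝓡∂ 3) x) (K.2 b) (K'.2 b)) : ℝ) : ℂ) *
    comp e u x K * (starRingEnd ℂ) (comp e v x K')

/-- The integral, against the volume measure of `g`, of a function supported in the
interior part of the domain of the chart `e`. -/
def chartIntegral (e : OpenPartialHomeomorph M (EuclideanHalfSpace 3)) (F : M → ℂ) : ℂ :=
  ∫ y in (e.extend (𝓡∂ 3)).target ∩ (e.extend (𝓡∂ 3)).symm ⁻¹' (𝓡∂ 3).interior M,
    F ((e.extend (𝓡∂ 3)).symm y) * (Real.sqrt (A.gram e y).det : ℂ)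

/-- Formal self-adjointness with respect to the `L²` product of `g`. A differential operator being
local, it suffices (by a partition of unity) to test on smooth sections whose support is a compact
subset of the interior part of a coordinate domain. -/
def IsFormallySelfAdjoint (P : TensorField M E → TensorField M E) : Prop :=
  ∀ e ∈ IsManifold.maximalAtlas (𝓡∂ 3) ∞ M, ∀ Q : Set M, IsCompact Q →
    Q ⊆ e.source ∩ (𝓡∂ 3).interior M →
    ∀ u v, A.IsSmoothSection E u ((𝓡∂ 3).interior M) →
      A.IsSmoothSection E v ((𝓡∂ 3).interior M) →
      (∀ x ∉ Q, u x = 0) → (∀ x ∉ Q, v x = 0) →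
      A.chartIntegral e (A.tensorInner E e (P u) v) = A.chartIntegral e (A.tensorInner E e u (P v))

/-- Second-order geometric elliptic formally self-adjoint operators on sections of `E`. -/
structure IsAdmissible (P : TensorField M E → TensorField M E) : Prop where
  geometric : A.IsGeometric E 2 P
  elliptic : A.IsElliptic E P
  selfAdjoint : A.IsFormallySelfAdjoint E P

/-! ### Indicial map and characteristic exponents -/

/-- The relation `I_s(P) ū = w` at the boundary point `x₀`: the components of `ρ^(-s) P(ρ^s ū)`
converge at `x₀` to those of `w`. -/
def HasIndicialValue (P : TensorField M E → TensorField M E) (s : ℂ) (x₀ : M)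
    (U : TensorField M E) (w : CTensor E.cov E.contra (TangentSpace (𝓡∂ 3) x₀)) : Prop :=
  ∀ e ∈ IsManifold.maximalAtlas (𝓡∂ 3) ∞ M, x₀ ∈ e.source → ∀ K : Idx E.cov E.contra,
    Filter.Tendsto (fun x => comp e (A.rhoPow E (-s) (P (A.rhoPow E s U))) x K)
      (𝓝[(𝓡∂ 3).interior M] x₀)
      (𝓝 (w (fun a => coordVec e x₀ (K.1 a)) (fun b => coordCovec e x₀ (K.2 b))))

/-- The characteristic exponents of `P`: those `s` for which `I_s(P)` has a nontrivial kernel in the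
complexified fibre of `E` at some boundary point. -/
def characteristicExponents (P : TensorField M E → TensorField M E) : Set ℂ :=
  {s | ∃ x₀ ∈ (𝓡∂ 3).boundary M, ∃ U : TensorField M E,
    A.IsSmoothSection E U Set.univ ∧ U x₀ ≠ 0 ∧ A.HasIndicialValue E P s x₀ U 0}

end AHStructure

end AsympHyp

end

/-! In a boundary chart a geometric operator is a polynomial in the vector fields `ρ ∂ᵢ` with
coefficients smooth up to the boundary (`IsGeometric.exists_coeffs`). The universal polynomials need
not show this, but the same expression is valid in all dilates of a chart. Comparing powers of the
dilation factor leaves only the part of weight `j` in the coefficient of a `j`-th derivative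
(`comp_eq_weighted`). Since `g = ρ⁻² gbar`, the weight under dilations is also the order in `ρ`, so
this part is `ρ^j` times a smooth function. Hence `P` maps `ρ^z (log ρ)^m U` to a combination of
terms `ρ^z (log ρ)^(m-i) Wᵢ` with `Wᵢ` smooth up to the boundary and independent of `m`, and the
boundary value of `W₀` is `I_z(P) U`.

Fix an order `n` and write `u = a + ∑ ρ^z (log ρ)^m U + R` with `a` and all `U` smooth up to the
boundary and `R` negligible for `C^n` regularity. The sum is improved at its leading terms: least
`Re z`, then largest `m`. While `Re z < δ`, the decay of `b` forces `U = 0` on the boundary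
(`comp_eq_zero_of_decay`). Once all exponents have `Re z ≥ δ > μ`, smoothness of `P u` forces
`I_z(P) U = 0` (`hasIndicialValue_zero`), so again `U = 0` on the boundary. In both cases `U = ρ V`,
and the exponent rises by one (`exists_logSum_shift`). The one exception is a term `ρ^z` with `z` a
natural number and no logarithm: its image cannot be told from a Taylor term of a smooth function,
but the term is itself smooth and is moved into `a`.

Exponents with equal real part differ by oscillating factors `ρ^(iτ)`, which neither decay nor
converge; they are separated by the independence of exponentials (`eq_zero_of_tendsto_sum_exp`). The
improvement stops after finitely many steps (`exists_le_re`) with all exponents beyond `n`, so the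
components of `u` are `C^n` up to the boundary for every `n`. By continuity their boundary values
form one section with values in the right fibre (`extendsSmoothly_of_localComp`). -/

noncomputable section

namespace AsympHyp

open Set Filter

/-! ### Calculus on the closed half-space -/

/-- Three-dimensional Euclidean space. -/
abbrev E3 : Type := EuclideanSpace ℝ (Fin 3)

/-- The closed half-space. -/
def Half : Set E3 := {y | 0 ≤ y 0}

/-- The open half-space. -/
def Pos : Set E3 := {y | 0 < y 0}

/-- The first basis vector, which points into the half-space. -/
def e0 : E3 := EuclideanSpace.single 0 1

/-- Relatively open subsets of the closed half-space. -/
structure RelOpen (Ω : Set E3) : Prop where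
  subset : Ω ⊆ Half
  mem_nhds : ∀ y ∈ Ω, Ω ∈ 𝓝[Half] y

lemma isOpen_pos : IsOpen Pos := isOpen_lt continuous_const (by fun_prop)

lemma isClosed_half : IsClosed Half := isClosed_le continuous_const (by fun_prop)

lemma convex_half : Convex ℝ Half := by
  intro x hx y hy a b ha hb _
  simp only [Half, mem_ofPred_eq, PiLp.add_apply, PiLp.smul_apply, smul_eq_mul] at *
  positivity

lemma convex_pos : Convex ℝ Pos := by
  intro x hx y hy a b ha hb hab
  simp only [Pos, mem_ofPred_eq, PiLp.add_apply, PiLp.smul_apply, smul_eq_mul] at *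
  rcases ha.eq_or_lt with rfl | ha
  · simp_all
  · positivity

lemma pos_subset_half : Pos ⊆ Half := fun y hy => show 0 ≤ y 0 from le_of_lt (show 0 < y 0 from hy)

lemma tendsto_add_smul_e0 (y : E3) : Tendsto (fun t : ℝ => y + t • e0) (𝓝[>] 0) (𝓝 y) := by
  have h : Continuous fun t : ℝ => y + t • e0 := by fun_prop
  have := h.tendsto 0
  simp only [zero_smul, add_zero] at this
  exact this.mono_left nhdsWithin_le_nhds

lemma add_smul_e0_zero (y : E3) (t : ℝ) : (y + t • e0) 0 = y 0 + t := by
  simp [e0]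

/-- A point of the half-space is a limit, along the inner normal, of points of the open half-space
staying in any given neighbourhood. -/
lemma tendsto_inner_normal {y : E3} (hy : y ∈ Half) :
    Tendsto (fun t : ℝ => y + t • e0) (𝓝[>] 0) (𝓝[Pos] y) := by
  refine tendsto_nhdsWithin_iff.2 ⟨tendsto_add_smul_e0 y, ?_⟩
  filter_upwards [self_mem_nhdsWithin] with t ht
  have h1 : 0 ≤ y 0 := hy
  have h2 : 0 < t := ht
  change 0 < (y + t • e0) 0
  rw [add_smul_e0_zero]; linarith

namespace RelOpen

variable {Ω : Set E3}

lemma half : RelOpen Half := ⟨subset_rfl, fun _ _ => self_mem_nhdsWithin⟩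

lemma nhdsWithin_eq (hΩ : RelOpen Ω) {y : E3} (hy : y ∈ Ω) : 𝓝[Ω] y = 𝓝[Half] y :=
  le_antisymm (nhdsWithin_mono _ hΩ.subset) (nhdsWithin_le_iff.2 (hΩ.mem_nhds y hy))

lemma inter_isOpen (hΩ : RelOpen Ω) {U : Set E3} (hU : IsOpen U) : RelOpen (Ω ∩ U) :=
  ⟨fun _ h => hΩ.subset h.1, fun y hy =>
    inter_mem (hΩ.mem_nhds y hy.1) (mem_nhdsWithin_of_mem_nhds (hU.mem_nhds hy.2))⟩

lemma uniqueDiffOn (hΩ : RelOpen Ω) : UniqueDiffOn ℝ Ω := by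
  intro y hy
  have h : UniqueDiffWithinAt ℝ Half y := by
    refine uniqueDiffOn_convex convex_half ⟨e0, ?_⟩ y (hΩ.subset hy)
    exact mem_interior.2 ⟨Pos, pos_subset_half, isOpen_pos, by simp [Pos, e0]⟩
  exact (uniqueDiffWithinAt_congr (hΩ.nhdsWithin_eq hy)).2 h

lemma mem_nhds_of_pos (hΩ : RelOpen Ω) {y : E3} (hy : y ∈ Ω) (hp : 0 < y 0) : Ω ∈ 𝓝 y := by
  have h : Half ∈ 𝓝 y := mem_of_superset (isOpen_pos.mem_nhds hp) pos_subset_half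
  have := hΩ.mem_nhds y hy
  rwa [nhdsWithin_eq_nhds.2 h] at this

lemma isOpen_inter_pos (hΩ : RelOpen Ω) : IsOpen (Ω ∩ Pos) :=
  isOpen_iff_mem_nhds.2 fun _ hy =>
    inter_mem (hΩ.mem_nhds_of_pos hy.1 hy.2) (isOpen_pos.mem_nhds hy.2)

lemma nhdsWithin_inter_pos (hΩ : RelOpen Ω) {y : E3} (hy : y ∈ Ω) : 𝓝[Ω ∩ Pos] y = 𝓝[Pos] y := by
  refine le_antisymm (nhdsWithin_mono _ inter_subset_right) (nhdsWithin_le_iff.2 ?_)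
  exact inter_mem (nhdsWithin_mono _ pos_subset_half (hΩ.mem_nhds y hy)) self_mem_nhdsWithin

/-- This identifies values at boundary points: two limits of the same function through the interior
must agree. -/
lemma neBot (hΩ : RelOpen Ω) {y : E3} (hy : y ∈ Ω) : (𝓝[Ω ∩ Pos] y).NeBot := by
  rw [hΩ.nhdsWithin_inter_pos hy]
  exact (tendsto_inner_normal (hΩ.subset hy)).neBot

variable {F : Type*} [NormedAddCommGroup F] [NormedSpace ℝ F]

/-- A function which is continuous up to the boundary and whose derivative in the interior extends
continuously is differentiable up to the boundary. -/
lemma hasFDerivWithinAt_of_interior (hΩ : RelOpen Ω) {G : E3 → F} {D : E3 → E3 →L[ℝ] F}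
    (hG : ContinuousOn G Ω) (hD : ContinuousOn D Ω)
    (h : ∀ y ∈ Ω, 0 < y 0 → HasFDerivAt G (D y) y) {y : E3} (hy : y ∈ Ω) :
    HasFDerivWithinAt G (D y) Ω y := by
  obtain ⟨ε, hε, hsub⟩ : ∃ ε > 0, Metric.closedBall y ε ∩ Half ⊆ Ω := by
    obtain ⟨ε, hε, hs⟩ := Metric.mem_nhdsWithin_iff.1 (hΩ.mem_nhds y hy)
    refine ⟨ε / 2, by positivity, fun z hz => hs ⟨?_, hz.2⟩⟩
    exact Metric.closedBall_subset_ball (by linarith) hz.1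
  -- The criterion for extending a derivative needs a convex open set. The open half-ball is one,
  -- and its closure is a neighbourhood of `y` in the half-space.
  set s : Set E3 := Metric.ball y ε ∩ Pos with hs
  have hsΩ : s ⊆ Ω := fun z hz => hsub ⟨Metric.ball_subset_closedBall hz.1, pos_subset_half hz.2⟩
  have hcl : closure s ⊆ Ω := by
    refine Subset.trans ?_ hsub
    refine closure_minimal ?_ (Metric.isClosed_closedBall.inter isClosed_half)
    exact inter_subset_inter Metric.ball_subset_closedBall pos_subset_half
  have hcl' : Metric.ball y ε ∩ Half ⊆ closure s := by
    intro z hz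
    refine mem_closure_of_tendsto ((tendsto_inner_normal hz.2).mono_right nhdsWithin_le_nhds) ?_
    have h1 := tendsto_inner_normal hz.2
    filter_upwards [h1.eventually (mem_nhdsWithin_of_mem_nhds (Metric.isOpen_ball.mem_nhds hz.1)),
      h1.eventually self_mem_nhdsWithin] with t h1 h2 using ⟨h1, h2⟩
  have key : HasFDerivWithinAt G (D y) (closure s) y := by
    refine hasFDerivWithinAt_closure_of_tendsto_fderiv ?_ ?_ ?_ ?_ ?_
    · exact fun z hz => (h z (hsΩ hz) hz.2).differentiableAt.differentiableWithinAt
    · exact (convex_ball y ε).inter convex_pos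
    · exact Metric.isOpen_ball.inter isOpen_pos
    · exact fun z hz => (hG z (hcl hz)).mono hsΩ
    · refine Tendsto.congr' ?_ ((hD y hy).mono hsΩ)
      filter_upwards [self_mem_nhdsWithin] with z hz using (h z (hsΩ hz) hz.2).fderiv.symm
  refine key.mono_of_mem_nhdsWithin ?_
  rw [hΩ.nhdsWithin_eq hy]
  exact mem_of_superset (inter_mem (mem_nhdsWithin_of_mem_nhds (Metric.ball_mem_nhds y hε))
    self_mem_nhdsWithin) hcl'

/-- The induction step for regularity up to the boundary: the derivative needs to be computed in the
interior only, provided it has a `C^n` extension. -/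
lemma contDiffOn_succ_of_interior (hΩ : RelOpen Ω) {G : E3 → F} {D : E3 → E3 →L[ℝ] F} {n : ℕ}
    (hG : ContinuousOn G Ω) (hD : ContDiffOn ℝ n D Ω)
    (h : ∀ y ∈ Ω, 0 < y 0 → HasFDerivAt G (D y) y) : ContDiffOn ℝ (n + 1) G Ω := by
  rw [contDiffOn_succ_iff_hasFDerivWithinAt_of_uniqueDiffOn hΩ.uniqueDiffOn]
  exact ⟨by simp, D, hD, fun y hy => hΩ.hasFDerivWithinAt_of_interior hG hD.continuousOn h hy⟩

end RelOpen

/-- A function in the interior whose derivatives tend to zero at the boundary extends by zero. -/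
lemma RelOpen.contDiffOn_extend_zero {Ω : Set E3} (hΩ : RelOpen Ω) (n : ℕ) :
    ∀ {F : Type} [NormedAddCommGroup F] [NormedSpace ℝ F] {R : E3 → F},
    ContDiffOn ℝ n R (Ω ∩ Pos) →
    (∀ y ∈ Ω, y 0 = 0 → ∀ j ≤ n,
      Tendsto (fun z => ‖iteratedFDeriv ℝ j R z‖) (𝓝[Ω ∩ Pos] y) (𝓝 0)) →
    ContDiffOn ℝ n (fun y => if 0 < y 0 then R y else 0) Ω := by
  have hcont : ∀ {F : Type} [NormedAddCommGroup F] [NormedSpace ℝ F] {R : E3 → F},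
      ContinuousOn R (Ω ∩ Pos) →
      (∀ y ∈ Ω, y 0 = 0 → Tendsto (fun z => ‖iteratedFDeriv ℝ 0 R z‖) (𝓝[Ω ∩ Pos] y) (𝓝 0)) →
      ContinuousOn (fun y => if 0 < y 0 then R y else 0) Ω := by
    intro F _ _ R hR h y hy
    rcases (show 0 ≤ y 0 from hΩ.subset hy).eq_or_lt with h0 | h0
    · have h1 := h y hy h0.symm
      simp only [norm_iteratedFDeriv_zero] at h1
      have h2 := tendsto_zero_iff_norm_tendsto_zero.2 h1
      -- Along the boundary the extension is constantly zero, so only the approach through the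
      -- interior uses the decay of `R`.
      have h3 : Ω = (Ω ∩ Pos) ∪ (Ω ∩ {y | y 0 = 0}) := by
        ext z
        constructor
        · intro hz
          rcases (show 0 ≤ z 0 from hΩ.subset hz).eq_or_lt with h | h
          · exact Or.inr ⟨hz, h.symm⟩
          · exact Or.inl ⟨hz, h⟩
        · rintro (h | h) <;> exact h.1
      rw [ContinuousWithinAt, if_neg (by rw [← h0]; exact lt_irrefl _), h3, nhdsWithin_union]
      refine Tendsto.sup ?_ ?_
      · refine h2.congr' ?_
        filter_upwards [self_mem_nhdsWithin] with z hz
        rw [if_pos (show 0 < z 0 from hz.2)]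
      · refine tendsto_const_nhds.congr' ?_
        filter_upwards [self_mem_nhdsWithin] with z hz
        rw [if_neg (by rw [hz.2]; exact lt_irrefl _)]
    · have h1 : ContinuousAt R y := hR.continuousAt (hΩ.isOpen_inter_pos.mem_nhds ⟨hy, h0⟩)
      refine (h1.congr ?_).continuousWithinAt
      filter_upwards [isOpen_pos.mem_nhds h0] with z hz
      rw [if_pos (show 0 < z 0 from hz)]
  induction n with
  | zero =>
    intro F _ _ R hR h
    simp only [Nat.cast_zero, contDiffOn_zero] at hR ⊢
    exact hcont hR fun y hy h0 => h y hy h0 0 le_rfl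
  | succ n ih =>
    intro F _ _ R hR h
    have hO := hΩ.isOpen_inter_pos
    have hder : ContDiffOn ℝ n (fderiv ℝ R) (Ω ∩ Pos) :=
      hR.fderiv_of_isOpen hO (by exact_mod_cast le_rfl)
    have h1 := ih hder (fun y hy h0 j hj => by
      simpa only [norm_iteratedFDeriv_fderiv] using h y hy h0 (j + 1) (by omega))
    refine hΩ.contDiffOn_succ_of_interior ?_ h1 ?_
    · exact hcont hR.continuousOn fun y hy h0 => h y hy h0 0 (by omega)
    · intro y hy h0
      rw [if_pos h0]
      have h2 : DifferentiableAt ℝ R y :=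
        (hR.contDiffAt (hO.mem_nhds ⟨hy, h0⟩)).differentiableAt (by simp)
      refine h2.hasFDerivAt.congr_of_eventuallyEq ?_
      filter_upwards [isOpen_pos.mem_nhds h0] with z hz
      rw [if_pos (show 0 < z 0 from hz)]

/-! ### Division by the normal coordinate -/

/-- The linear map multiplying the normal coordinate by `t`. -/
def shrink (t : ℝ) : E3 →L[ℝ] E3 :=
  ContinuousLinearMap.id ℝ E3 + (t - 1) • (EuclideanSpace.proj (0 : Fin 3)).smulRight e0

lemma shrink_apply (t : ℝ) (y : E3) : shrink t y = y + ((t - 1) * y 0) • e0 := by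
  simp [shrink, smul_smul]

lemma shrink_apply_zero (t : ℝ) (y : E3) : shrink t y 0 = t * y 0 := by
  rw [shrink_apply, add_smul_e0_zero]; ring

lemma continuous_shrink : Continuous shrink := by
  unfold shrink; fun_prop

/-- The centre lies on the boundary, so shrinking the normal coordinate does not increase the
distance to it. -/
lemma shrink_mem {y₀ : E3} (h₀ : y₀ 0 = 0) {ε t : ℝ} (ht : t ∈ Icc (0 : ℝ) 1) {y : E3}
    (hy : y ∈ Metric.ball y₀ ε ∩ Half) : shrink t y ∈ Metric.ball y₀ ε ∩ Half := by
  have h1 : 0 ≤ y 0 := hy.2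
  refine ⟨?_, ?_⟩
  · have h2 := hy.1
    rw [Metric.mem_ball, EuclideanSpace.dist_eq] at h2 ⊢
    refine lt_of_le_of_lt (Real.sqrt_le_sqrt ?_) h2
    refine Finset.sum_le_sum fun i _ => ?_
    have h3 : shrink t y i = if i = 0 then t * y 0 else y i := by
      split_ifs with hi
      · rw [hi, shrink_apply_zero]
      · simp [shrink_apply, e0, hi]
    rw [h3]
    split_ifs with hi
    · subst hi
      rw [h₀, Real.dist_eq, Real.dist_eq, sub_zero, sub_zero, abs_mul, mul_pow, abs_of_nonneg ht.1]
      have : t ^ 2 ≤ 1 := pow_le_one₀ ht.1 ht.2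
      nlinarith [sq_nonneg |y 0|]
    · exact le_rfl
  · change 0 ≤ shrink t y 0
    rw [shrink_apply_zero]
    exact mul_nonneg ht.1 h1

/-- Differentiation under the integral gives an integral of the same shape, with the derivative of
`h` in place of `h` and `L ↦ c t ∘ L ∘ shrink t` in place of `c t`. The factor `c` and the arbitrary
target spaces are there to close the induction on `n`. -/
lemma contDiffOn_integral_shrink {y₀ : E3} (h₀ : y₀ 0 = 0) {ε : ℝ} (n : ℕ) :
    ∀ {F F' : Type} [NormedAddCommGroup F] [NormedSpace ℝ F] [NormedAddCommGroup F']
      [NormedSpace ℝ F'] {h : E3 → F} {c : ℝ → F →L[ℝ] F'},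
    ContDiffOn ℝ ∞ h (Metric.ball y₀ ε ∩ Half) → Continuous c →
    ContDiffOn ℝ n (fun y => ∫ t in (0 : ℝ)..1, c t (h (shrink t y)))
      (Metric.ball y₀ ε ∩ Half) := by
  set Ω := Metric.ball y₀ ε ∩ Half with hΩdef
  have hΩ : RelOpen Ω := by
    have := RelOpen.half.inter_isOpen (Metric.isOpen_ball (x := y₀) (ε := ε))
    rwa [inter_comm] at this
  have hcont : ∀ {F F' : Type} [NormedAddCommGroup F] [NormedSpace ℝ F] [NormedAddCommGroup F']
      [NormedSpace ℝ F'] {h : E3 → F} {c : ℝ → F →L[ℝ] F'},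
      ContinuousOn h Ω → Continuous c →
      ContinuousOn (fun y => ∫ t in (0 : ℝ)..1, c t (h (shrink t y))) Ω := by
    intro F F' _ _ _ _ h c hh hc
    rw [continuousOn_iff_continuous_domRestrict]
    -- The integrand is controlled only for `t ∈ [0, 1]`; projecting `t` to this interval makes it
    -- continuous on all of `Ω × ℝ` without changing the integral.
    have h1 : Continuous fun p : Ω × ℝ =>
        c p.2 (h (shrink (projIcc (0 : ℝ) 1 zero_le_one p.2) p.1)) := by
      have h2 : Continuous fun p : Ω × ℝ =>
          (⟨shrink (projIcc (0 : ℝ) 1 zero_le_one p.2) p.1,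
            shrink_mem h₀ (projIcc (0 : ℝ) 1 zero_le_one p.2).2 p.1.2⟩ : Ω) := by
        refine Continuous.subtype_mk ?_ _
        exact (continuous_shrink.comp (continuous_subtype_val.comp
          (continuous_projIcc.comp continuous_snd))).clm_apply
          (continuous_subtype_val.comp continuous_fst)
      exact (hc.comp continuous_snd).clm_apply
        ((continuousOn_iff_continuous_domRestrict.1 hh).comp h2)
    have h3 := intervalIntegral.continuous_parametric_intervalIntegral_of_continuous'
      (μ := MeasureTheory.volume)
      (f := fun (p : Ω) (t : ℝ) => c t (h (shrink (projIcc (0 : ℝ) 1 zero_le_one t) p))) h1 0 1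
    refine h3.congr fun p => ?_
    refine intervalIntegral.integral_congr fun t ht => ?_
    rw [uIcc_of_le zero_le_one] at ht
    simp only [projIcc_of_mem zero_le_one ht]
  induction n with
  | zero =>
    intro F F' _ _ _ _ h c hh hc
    simp only [Nat.cast_zero, contDiffOn_zero]
    exact hcont hh.continuousOn hc
  | succ n ih =>
    intro F F' _ _ _ _ h c hh hc
    set c' : ℝ → (E3 →L[ℝ] F) →L[ℝ] (E3 →L[ℝ] F') := fun t =>
      (ContinuousLinearMap.compL ℝ E3 F F' (c t)).comp
        ((ContinuousLinearMap.compL ℝ E3 E3 F).flip (shrink t)) with hc'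
    have hc'cont : Continuous c' := by
      have := continuous_shrink
      fun_prop
    have hDh : ContDiffOn ℝ ∞ (fderivWithin ℝ h Ω) Ω :=
      hh.fderivWithin hΩ.uniqueDiffOn (by simp)
    refine hΩ.contDiffOn_succ_of_interior (hcont hh.continuousOn hc) (ih hDh hc'cont) ?_
    intro y hy hy0
    have hcl : ∀ z ∈ Ω, ContinuousOn (fun t => c t (h (shrink t z))) (Icc 0 1) := by
      intro z hz
      refine hc.continuousOn.clm_apply (hh.continuousOn.comp ?_ fun t ht => shrink_mem h₀ ht hz)
      exact (continuous_shrink.clm_apply continuous_const).continuousOn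
    have hcl2 : ContinuousOn (fun p : E3 × ℝ => c' p.2 (fderivWithin ℝ h Ω (shrink p.2 p.1)))
        (Ω ×ˢ Icc 0 1) := by
      refine (hc'cont.comp continuous_snd).continuousOn.clm_apply
        (hDh.continuousOn.comp ?_ fun p hp => shrink_mem h₀ hp.2 hp.1)
      exact ((continuous_shrink.comp continuous_snd).clm_apply continuous_fst).continuousOn
    obtain ⟨r, hr, hball⟩ := Metric.nhds_basis_closedBall.mem_iff.1
      (hΩ.isOpen_inter_pos.mem_nhds ⟨hy, hy0⟩)
    obtain ⟨C, hC⟩ := ((isCompact_closedBall y r).prod (isCompact_Icc (a := (0:ℝ)) (b := 1))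
      ).exists_bound_of_continuousOn
      (hcl2.mono (prod_mono (fun z hz => (hball hz).1) subset_rfl))
    have hIoc : Set.uIoc (0 : ℝ) 1 = Ioc 0 1 := uIoc_of_le zero_le_one
    refine intervalIntegral.hasFDerivAt_integral_of_dominated_of_fderiv_le
      (F := fun z t => c t (h (shrink t z)))
      (F' := fun z t => c' t (fderivWithin ℝ h Ω (shrink t z))) (bound := fun _ => C)
      (Metric.closedBall_mem_nhds y hr) ?_ ?_ ?_ ?_ ?_ ?_
    · filter_upwards [hΩ.mem_nhds_of_pos hy hy0] with z hz
      rw [hIoc]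
      exact ((hcl z hz).mono Ioc_subset_Icc_self).aestronglyMeasurable measurableSet_Ioc
    · exact ContinuousOn.intervalIntegrable (by rw [uIcc_of_le zero_le_one]; exact hcl y hy)
    · rw [hIoc]
      refine ContinuousOn.aestronglyMeasurable ?_ measurableSet_Ioc
      exact hcl2.comp (f := fun t : ℝ => (y, t)) (by fun_prop)
        fun t ht => ⟨hy, Ioc_subset_Icc_self ht⟩
    · refine Eventually.of_forall fun t ht z hz => ?_
      rw [hIoc] at ht
      exact hC (z, t) ⟨hz, Ioc_subset_Icc_self ht⟩
    · exact intervalIntegrable_const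
    · refine Eventually.of_forall fun t ht z hz => ?_
      rw [hIoc] at ht
      have hz' := hball hz
      have hm : shrink t z ∈ Ω := shrink_mem h₀ (Ioc_subset_Icc_self ht) hz'.1
      -- At `t = 0` the point would fall on the boundary; the half-open interval excludes this.
      have hp : 0 < shrink t z 0 := by
        rw [shrink_apply_zero]; exact mul_pos ht.1 hz'.2
      have hd : HasFDerivAt h (fderivWithin ℝ h Ω (shrink t z)) (shrink t z) :=
        ((hh.differentiableOn (by simp)) _ hm).hasFDerivWithinAt.hasFDerivAt
          (hΩ.mem_nhds_of_pos hm hp)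
      exact (c t).hasFDerivAt.comp z (hd.comp z (shrink t).hasFDerivAt)

/-- A smooth function vanishing on the boundary is the product of the normal coordinate and a
smooth function. -/
lemma RelOpen.exists_eq_coord_mul {Ω : Set E3} (hΩ : RelOpen Ω) {F : Type} [NormedAddCommGroup F]
    [NormedSpace ℝ F] [CompleteSpace F] {f : E3 → F} (hf : ContDiffOn ℝ ∞ f Ω)
    (h0 : ∀ y ∈ Ω, y 0 = 0 → f y = 0) :
    ∃ g : E3 → F, ContDiffOn ℝ ∞ g Ω ∧ ∀ y ∈ Ω, f y = y 0 • g y := by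
  -- On the boundary the quotient has to be the normal derivative. Near a boundary point both cases
  -- equal Hadamard's integral of `∂₀ f (shrink t y)` over `t ∈ [0, 1]`.
  set g : E3 → F := fun y => if 0 < y 0 then (y 0)⁻¹ • f y else fderivWithin ℝ f Ω y e0 with hg
  refine ⟨g, ?_, ?_⟩
  · intro y₀ hy₀
    rcases (show 0 ≤ y₀ 0 from hΩ.subset hy₀).eq_or_lt with hz | hp
    · obtain ⟨ε, hε, hsub⟩ := Metric.mem_nhdsWithin_iff.1 (hΩ.mem_nhds y₀ hy₀)
      set Ω' := Metric.ball y₀ ε ∩ Half with hΩ'def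
      have hΩ' : RelOpen Ω' := by
        have := RelOpen.half.inter_isOpen (Metric.isOpen_ball (x := y₀) (ε := ε))
        rwa [inter_comm] at this
      have hf' : ContDiffOn ℝ ∞ f Ω' := hf.mono hsub
      have hder : ContDiffOn ℝ ∞ (fun y => fderivWithin ℝ f Ω' y e0) Ω' :=
        (hf'.fderivWithin hΩ'.uniqueDiffOn (m := ∞) (by simp)).clm_apply contDiffOn_const
      have hint : ContDiffOn ℝ ∞ (fun y => ∫ t in (0 : ℝ)..1,
          (ContinuousLinearMap.id ℝ F) (fderivWithin ℝ f Ω' (shrink t y) e0)) Ω' :=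
        contDiffOn_infty.2 fun n =>
          contDiffOn_integral_shrink (h := fun y => fderivWithin ℝ f Ω' y e0)
            (c := fun _ => ContinuousLinearMap.id ℝ F) hz.symm n hder continuous_const
      have hy₀' : y₀ ∈ Ω' := ⟨Metric.mem_ball_self hε, hΩ.subset hy₀⟩
      have hfd : ∀ y ∈ Ω', HasFDerivWithinAt f (fderivWithin ℝ f Ω' y) Ω' y := fun y hy =>
        (hf'.differentiableOn (by simp) y hy).hasFDerivWithinAt
      have key : EqOn g (fun y => ∫ t in (0 : ℝ)..1,
          (ContinuousLinearMap.id ℝ F) (fderivWithin ℝ f Ω' (shrink t y) e0)) Ω' := by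
        intro y hy
        simp only [ContinuousLinearMap.id_apply, hg]
        rcases (show 0 ≤ y 0 from hy.2).eq_or_lt with hyz | hyp
        · rw [if_neg (by rw [← hyz]; exact lt_irrefl _)]
          have : ∀ t : ℝ, shrink t y = y := fun t => by rw [shrink_apply, ← hyz]; simp
          simp only [this, intervalIntegral.integral_const, sub_zero, one_smul]
          congr 1
          have h1 : 𝓝[Ω] y = 𝓝[Ω'] y := by
            rw [hΩ.nhdsWithin_eq (hsub hy), hΩ'.nhdsWithin_eq hy]
          have h2 := hfd y hy
          rw [HasFDerivWithinAt, ← h1] at h2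
          exact (HasFDerivWithinAt.fderivWithin h2 (hΩ.uniqueDiffOn y (hsub hy)))
        · rw [if_pos hyp]
          have hsm : ∀ t ∈ Icc (0 : ℝ) 1, shrink t y ∈ Ω' := fun t ht =>
            shrink_mem hz.symm ht hy
          have hftc : ∫ t in (0 : ℝ)..1, y 0 • fderivWithin ℝ f Ω' (shrink t y) e0 =
              f (shrink 1 y) - f (shrink 0 y) := by
            refine intervalIntegral.integral_eq_sub_of_hasDerivAt_of_le
              (f := fun t => f (shrink t y)) zero_le_one ?_ ?_ ?_
            · exact hf'.continuousOn.comp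
                (continuous_shrink.clm_apply continuous_const).continuousOn hsm
            · intro t ht
              have hm := hsm t (Ioo_subset_Icc_self ht)
              have hp : 0 < shrink t y 0 := by
                rw [shrink_apply_zero]; exact mul_pos ht.1 hyp
              have h1 := (hfd _ hm).hasFDerivAt (hΩ'.mem_nhds_of_pos hm hp)
              have h2 : HasDerivAt (fun t => shrink t y) (y 0 • e0) t := by
                simp only [shrink_apply]
                have h3 : HasDerivAt (fun t : ℝ => (t - 1) * y 0) (y 0) t := by
                  simpa using ((hasDerivAt_id t).sub_const 1).mul_const (y 0)
                exact (h3.smul_const e0).const_add y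
              have := h1.comp_hasDerivAt t h2
              simpa [Function.comp_def] using this
            · refine ContinuousOn.intervalIntegrable ?_
              rw [uIcc_of_le zero_le_one]
              exact continuousOn_const.smul (hder.continuousOn.comp
                (continuous_shrink.clm_apply continuous_const).continuousOn hsm)
          rw [intervalIntegral.integral_smul] at hftc
          have h1 : shrink 1 y = y := by simp [shrink_apply]
          have h2 : f (shrink 0 y) = 0 :=
            h0 _ (hsub (hsm 0 ⟨le_rfl, zero_le_one⟩)) (by rw [shrink_apply_zero, zero_mul])
          rw [h1, h2, sub_zero] at hftc
          rw [← hftc, smul_smul, inv_mul_cancel₀ hyp.ne', one_smul]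
      have := (hint y₀ hy₀').congr (fun y hy => key hy) (key hy₀')
      refine this.mono_of_mem_nhdsWithin ?_
      rw [hΩ.nhdsWithin_eq hy₀]
      exact hΩ'.mem_nhds y₀ hy₀'
    · have h1 : ContDiffAt ℝ ∞ f y₀ := (hf y₀ hy₀).contDiffAt (hΩ.mem_nhds_of_pos hy₀ hp)
      have h2 : ContDiffAt ℝ ∞ (fun y : E3 => (y 0)⁻¹ • f y) y₀ := by
        refine ContDiffAt.smul (ContDiffAt.inv ?_ hp.ne') h1
        exact (EuclideanSpace.proj (0 : Fin 3) : E3 →L[ℝ] ℝ).contDiff.contDiffAt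
      refine (h2.congr_of_eventuallyEq ?_).contDiffWithinAt
      filter_upwards [isOpen_pos.mem_nhds hp] with z hz
      simp only [hg]
      rw [if_pos (show 0 < z 0 from hz)]
  · intro y hy
    rcases (show 0 ≤ y 0 from hΩ.subset hy).eq_or_lt with hz | hp
    · rw [h0 y hy hz.symm, ← hz, zero_smul]
    · simp only [hg]
      rw [if_pos hp, smul_smul, mul_inv_cancel₀ hp.ne', one_smul]

end AsympHyp
end

noncomputable section

namespace AsympHyp

open Set Filter

/-! ### Asymptotics of complex powers and logarithms -/

/-- The function `t^z (log t)^m` on the positive half-line, extended by zero. -/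
def powLog (z : ℂ) (m : ℕ) (t : ℝ) : ℂ :=
  if 0 < t then (t : ℂ) ^ z * (Real.log t : ℂ) ^ m else 0

lemma powLog_of_pos {z : ℂ} {m : ℕ} {t : ℝ} (ht : 0 < t) :
    powLog z m t = (t : ℂ) ^ z * (Real.log t : ℂ) ^ m := if_pos ht

lemma powLog_of_nonpos {z : ℂ} {m : ℕ} {t : ℝ} (ht : t ≤ 0) : powLog z m t = 0 :=
  if_neg ht.not_gt

lemma norm_powLog_of_pos {z : ℂ} {m : ℕ} {t : ℝ} (ht : 0 < t) :
    ‖powLog z m t‖ = t ^ z.re * |Real.log t| ^ m := by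
  rw [powLog_of_pos ht, norm_mul, norm_pow, Complex.norm_cpow_eq_rpow_re_of_pos ht,
    Complex.norm_real, Real.norm_eq_abs]

lemma powLog_add {z w : ℂ} {m : ℕ} {t : ℝ} (ht : 0 < t) :
    powLog (z + w) m t = (t : ℂ) ^ w * powLog z m t := by
  rw [powLog_of_pos ht, powLog_of_pos ht, Complex.cpow_add _ _ (by exact_mod_cast ht.ne')]
  ring

lemma tendsto_rpow_mul_abs_log_pow {a : ℝ} (ha : 0 < a) (m : ℕ) :
    Tendsto (fun t : ℝ => t ^ a * |Real.log t| ^ m) (𝓝[>] 0) (𝓝 0) := by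
  have h := (isLittleO_abs_log_rpow_rpow_nhdsGT_zero (s := -a) (m : ℝ) (by linarith)
    ).tendsto_div_nhds_zero
  refine h.congr' ?_
  filter_upwards [self_mem_nhdsWithin] with t ht
  have ht' : 0 < t := ht
  rw [Real.rpow_neg ht'.le, div_inv_eq_mul, Real.rpow_natCast, mul_comm]

lemma tendsto_powLog {z : ℂ} (hz : 0 < z.re) (m : ℕ) :
    Tendsto (powLog z m) (𝓝[>] 0) (𝓝 0) := by
  rw [tendsto_zero_iff_norm_tendsto_zero]
  refine (tendsto_rpow_mul_abs_log_pow hz m).congr' ?_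
  filter_upwards [self_mem_nhdsWithin] with t ht
  rw [norm_powLog_of_pos ht]

lemma hasDerivAt_powLog_of_pos (z : ℂ) (m : ℕ) {t : ℝ} (ht : 0 < t) :
    HasDerivAt (powLog z m) (z * powLog (z - 1) m t + m * powLog (z - 1) (m - 1) t) t := by
  have h1 : HasDerivAt (fun s : ℝ => (s : ℂ) ^ z) (z * (t : ℂ) ^ (z - 1)) t := by
    have h := ((hasDerivAt_id (t : ℂ)).cpow_const (c := z)
      (Or.inl (by simpa using ht))).comp_ofReal
    simpa using h
  have h2 : HasDerivAt (fun s : ℝ => (Real.log s : ℂ) ^ m)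
      (m * (Real.log t : ℂ) ^ (m - 1) * ((t⁻¹ : ℝ) : ℂ)) t :=
    ((Real.hasDerivAt_log ht.ne').ofReal_comp).pow m
  have ht0 : (t : ℂ) ≠ 0 := by exact_mod_cast ht.ne'
  refine ((h1.mul h2).congr_of_eventuallyEq ?_).congr_deriv ?_
  · filter_upwards [lt_mem_nhds ht] with s hs
    rw [powLog_of_pos hs]
    rfl
  · rw [powLog_of_pos ht, powLog_of_pos ht]
    have h3 : (t : ℂ) ^ (z - 1) = (t : ℂ) ^ z * (t : ℂ)⁻¹ := by
      rw [Complex.cpow_sub _ _ ht0, Complex.cpow_one, div_eq_mul_inv]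
    rw [h3]
    push_cast
    ring

/-- At `0` the right difference quotient is again a `powLog`, with exponent `z - 1`, and tends to
zero because `Re (z - 1) > 0`. -/
lemma hasDerivAt_powLog {z : ℂ} (hz : 1 < z.re) (m : ℕ) (t : ℝ) :
    HasDerivAt (powLog z m) (z * powLog (z - 1) m t + m * powLog (z - 1) (m - 1) t) t := by
  rcases lt_trichotomy t 0 with ht | rfl | ht
  · rw [powLog_of_nonpos ht.le, powLog_of_nonpos ht.le, mul_zero, mul_zero, add_zero]
    refine (hasDerivAt_const t (0 : ℂ)).congr_of_eventuallyEq ?_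
    filter_upwards [gt_mem_nhds ht] with s hs
    exact powLog_of_nonpos hs.le
  · rw [powLog_of_nonpos le_rfl, powLog_of_nonpos le_rfl, mul_zero, mul_zero, add_zero,
      hasDerivAt_iff_tendsto_slope_left_right]
    constructor
    · refine tendsto_const_nhds.congr' ?_
      filter_upwards [self_mem_nhdsWithin] with s hs
      rw [slope, powLog_of_nonpos le_rfl, powLog_of_nonpos (le_of_lt hs)]
      simp
    · refine (tendsto_powLog (z := z - 1) (by simpa using hz) m).congr' ?_
      filter_upwards [self_mem_nhdsWithin] with s hs
      have hs' : 0 < s := hs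
      have hs0 : (s : ℂ) ≠ 0 := by exact_mod_cast hs'.ne'
      rw [slope, powLog_of_nonpos le_rfl, powLog_of_pos hs', powLog_of_pos hs',
        Complex.cpow_sub _ _ hs0, Complex.cpow_one]
      simp only [sub_zero, vsub_eq_sub, Complex.real_smul, Complex.ofReal_inv]
      field_simp
  · exact hasDerivAt_powLog_of_pos z m ht

lemma continuous_powLog {z : ℂ} (hz : 0 < z.re) (m : ℕ) : Continuous (powLog z m) := by
  rw [continuous_iff_continuousAt]
  intro t
  rcases lt_trichotomy t 0 with ht | rfl | ht
  · refine (continuousAt_const (y := (0 : ℂ))).congr ?_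
    filter_upwards [gt_mem_nhds ht] with s hs
    exact (powLog_of_nonpos hs.le).symm
  · rw [continuousAt_iff_continuous_left'_right']
    refine ⟨?_, ?_⟩
    · rw [ContinuousWithinAt, powLog_of_nonpos le_rfl]
      refine tendsto_const_nhds.congr' ?_
      filter_upwards [self_mem_nhdsWithin] with s hs
      exact (powLog_of_nonpos (le_of_lt hs)).symm
    · rw [ContinuousWithinAt, powLog_of_nonpos le_rfl]
      exact tendsto_powLog hz m
  · exact (hasDerivAt_powLog_of_pos z m ht).continuousAt

/-- Every derivative costs one unit of `Re z`. This is why terms of an expansion with `Re z > n` do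
no harm to `C^n` regularity. -/
lemma contDiff_powLog (n : ℕ) : ∀ {z : ℂ} (_ : (n : ℝ) < z.re) (m : ℕ),
    ContDiff ℝ n (powLog z m) := by
  induction n with
  | zero =>
    intro z hz m
    simpa using continuous_powLog (by simpa using hz) m
  | succ n ih =>
    intro z hz m
    push_cast at hz
    have h1 : 1 < z.re := by
      have : (0 : ℝ) ≤ n := n.cast_nonneg
      linarith
    have hz' : (n : ℝ) < (z - 1).re := by simp; linarith
    rw [show ((n + 1 : ℕ) : WithTop ℕ∞) = (n : WithTop ℕ∞) + 1 by push_cast; rfl,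
      contDiff_succ_iff_deriv]
    refine ⟨fun t => (hasDerivAt_powLog h1 m t).differentiableAt, by simp, ?_⟩
    rw [show deriv (powLog z m) = fun t =>
      z * powLog (z - 1) m t + m * powLog (z - 1) (m - 1) t from
      funext fun t => (hasDerivAt_powLog h1 m t).deriv]
    exact (contDiff_const.mul (ih hz' m)).add (contDiff_const.mul (ih hz' (m - 1)))

lemma contDiffOn_powLog (z : ℂ) (m : ℕ) : ContDiffOn ℝ ∞ (powLog z m) (Ioi 0) := by
  intro t ht
  have ht' : 0 < t := ht
  have h1 : ContDiffAt ℝ ∞ (fun s : ℝ => Complex.exp (z * (Real.log s : ℂ)) *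
      (Real.log s : ℂ) ^ m) t := by
    have h2 : ContDiffAt ℝ ∞ (fun s : ℝ => (Real.log s : ℂ)) t :=
      Complex.ofRealCLM.contDiff.contDiffAt.comp t (Real.contDiffAt_log.2 ht'.ne')
    exact ((contDiffAt_const.mul h2).cexp).mul (h2.pow m)
  refine (h1.congr_of_eventuallyEq ?_).contDiffWithinAt
  filter_upwards [lt_mem_nhds ht'] with s hs
  rw [powLog_of_pos hs, Complex.cpow_def_of_ne_zero (by exact_mod_cast hs.ne'),
    ← Complex.ofReal_log hs.le, mul_comm z]

/-! ### Independence of exponentials -/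

/-- If `f` is the sum, then `f (x + a) - exp (i j a) f x` tends to zero and has lost the frequency
`j`, while the coefficient at `k` is multiplied by `exp (i k a) - exp (i j a)`. For `a = π / (k -
j)` this factor is `-2 exp (i j a) ≠ 0`, so induction gives `c k = 0`. The single term that remains
has constant modulus. -/
lemma eq_zero_of_tendsto_sum_exp (S : Finset ℝ) : ∀ c : ℝ → ℂ,
    Tendsto (fun x : ℝ => ∑ τ ∈ S, c τ * Complex.exp (Complex.I * τ * x)) atTop (𝓝 0) →
    ∀ τ ∈ S, c τ = 0 := by
  induction S using Finset.induction_on with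
  | empty => simp
  | insert j S hj ih =>
    intro c h
    have hS : ∀ k ∈ S, c k = 0 := by
      intro k hk
      have hkj : (k : ℝ) - j ≠ 0 := sub_ne_zero.2 (by rintro rfl; exact hj hk)
      set a : ℝ := Real.pi / (k - j) with ha
      have h1 := (h.comp (tendsto_atTop_add_const_right atTop a tendsto_id)).sub
        (h.const_mul (Complex.exp (Complex.I * j * a)))
      have h2 : Tendsto (fun x : ℝ => ∑ τ ∈ S, (c τ * (Complex.exp (Complex.I * τ * a) -
          Complex.exp (Complex.I * j * a))) * Complex.exp (Complex.I * τ * x)) atTop (𝓝 0) := by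
        rw [mul_zero, sub_zero] at h1
        refine h1.congr fun x => ?_
        simp only [Function.comp_apply, id_eq, Finset.sum_insert hj]
        have h3 : ∀ τ : ℝ, Complex.exp (Complex.I * τ * ((x + a : ℝ) : ℂ)) =
            Complex.exp (Complex.I * τ * x) * Complex.exp (Complex.I * τ * a) := by
          intro τ; rw [← Complex.exp_add]; push_cast; ring_nf
        simp only [h3, mul_add, Finset.mul_sum]
        rw [add_sub_add_comm, ← Finset.sum_sub_distrib]
        rw [show c j * (Complex.exp (Complex.I * j * x) * Complex.exp (Complex.I * j * a)) -
          Complex.exp (Complex.I * j * a) * (c j * Complex.exp (Complex.I * j * x)) = 0 by ring,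
          zero_add]
        exact Finset.sum_congr rfl fun τ _ => by ring
      have h4 := ih _ h2 k hk
      rcases mul_eq_zero.1 h4 with h5 | h5
      · exact h5
      · exfalso
        have h6 : Complex.exp (Complex.I * k * a) = - Complex.exp (Complex.I * j * a) := by
          have h7 : Complex.I * k * a = Real.pi * Complex.I + Complex.I * j * a := by
            have h8 : ((k - j : ℝ) : ℂ) * a = Real.pi := by
              rw [← Complex.ofReal_mul, ha, mul_div_cancel₀ _ hkj]
            push_cast at h8
            linear_combination Complex.I * h8
          rw [h7, Complex.exp_add, Complex.exp_pi_mul_I, neg_one_mul]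
        rw [h6, ← neg_add', neg_eq_zero, ← two_mul] at h5
        exact (mul_ne_zero two_ne_zero (Complex.exp_ne_zero _)) h5
    intro τ hτ
    rcases Finset.mem_insert.1 hτ with rfl | hτ
    · have h1 : Tendsto (fun x : ℝ => c τ * Complex.exp (Complex.I * τ * x)) atTop (𝓝 0) := by
        refine h.congr fun x => ?_
        rw [Finset.sum_insert hj, Finset.sum_eq_zero, add_zero]
        intro k hk
        rw [hS k hk, zero_mul]
      have h2 := h1.norm
      have h3 : (fun x : ℝ => ‖c τ * Complex.exp (Complex.I * τ * x)‖) = fun _ => ‖c τ‖ := by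
        funext x
        rw [norm_mul, show Complex.I * τ * x = ((τ * x : ℝ) : ℂ) * Complex.I by push_cast; ring,
          Complex.norm_exp_ofReal_mul_I, mul_one]
      rw [h3, norm_zero] at h2
      exact norm_eq_zero.1 (tendsto_nhds_unique tendsto_const_nhds h2)
    · exact hS τ hτ

/-- A nonzero limit is a term of frequency zero; it can be added to the sum as one more exponential
if that frequency is not yet present. -/
lemma eq_zero_of_tendsto_sum_exp_const (S : Finset ℝ) (c : ℝ → ℂ) (L : ℂ)
    (h : Tendsto (fun x : ℝ => ∑ τ ∈ S, c τ * Complex.exp (Complex.I * τ * x)) atTop (𝓝 L))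
    (hL : L = 0 ∨ (0 : ℝ) ∉ S) : ∀ τ ∈ S, c τ = 0 := by
  rcases hL with rfl | h0
  · exact eq_zero_of_tendsto_sum_exp S c h
  · have h1 := eq_zero_of_tendsto_sum_exp (insert 0 S) (Function.update c 0 (-L)) (by
      have h2 := h.sub_const L
      rw [sub_self] at h2
      refine h2.congr fun x => ?_
      rw [Finset.sum_insert h0, Function.update_self, add_comm, sub_eq_add_neg]
      congr 1
      · exact Finset.sum_congr rfl fun τ hτ => by
          rw [Function.update_of_ne (by rintro rfl; exact h0 hτ)]
      · simp)
    intro τ hτ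
    have h2 := h1 τ (Finset.mem_insert_of_mem hτ)
    rwa [Function.update_of_ne (by rintro rfl; exact h0 hτ)] at h2

/-- The substitution `t = exp (-x)` turns `t^(iτ)` into `exp (-iτx)`. The assumption `hβ` says that
`β` takes all small positive values along `l`, so that a limit along `l` is a limit in the variable
`t`. -/
lemma eq_zero_of_tendsto_sum_powLog {X : Type*} {l : Filter X} {β : X → ℝ}
    (hβ : 𝓝[>] 0 ≤ map β l) (S : Finset ℝ) (c : ℝ → ℂ) (L : ℂ)
    (h : Tendsto (fun x => ∑ τ ∈ S, c τ * powLog (Complex.I * τ) 0 (β x)) l (𝓝 L))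
    (hL : L = 0 ∨ (0 : ℝ) ∉ S) : ∀ τ ∈ S, c τ = 0 := by
  have h1 : Tendsto (fun t : ℝ => ∑ τ ∈ S, c τ * powLog (Complex.I * τ) 0 t) (𝓝[>] 0) (𝓝 L) :=
    Tendsto.mono_left
      (tendsto_map'_iff (f := fun t : ℝ => ∑ τ ∈ S, c τ * powLog (Complex.I * τ) 0 t) |>.2 h) hβ
  have hexp : Tendsto (fun x : ℝ => Real.exp (-x)) atTop (𝓝[>] 0) :=
    tendsto_nhdsWithin_iff.2 ⟨Real.tendsto_exp_neg_atTop_nhds_zero,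
      Eventually.of_forall fun x => Real.exp_pos _⟩
  have h2 := h1.comp hexp
  intro τ hτ
  have h3 := eq_zero_of_tendsto_sum_exp_const (S.image fun τ => -τ) (fun τ => c (-τ)) L (by
    refine h2.congr fun x => ?_
    rw [Finset.sum_image (fun a _ b _ hab => by simpa using hab)]
    refine Finset.sum_congr rfl fun τ _ => ?_
    simp only [neg_neg]
    rw [powLog_of_pos (Real.exp_pos _), pow_zero, mul_one,
      Complex.cpow_def_of_ne_zero (by exact_mod_cast (Real.exp_pos _).ne'),
      ← Complex.ofReal_log (Real.exp_pos _).le, Real.log_exp]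
    congr 2
    push_cast
    ring) (by
    rcases hL with hL | hL
    · exact Or.inl hL
    · refine Or.inr fun h0 => hL ?_
      obtain ⟨a, ha, ha'⟩ := Finset.mem_image.1 h0
      rw [neg_eq_zero] at ha'
      rwa [ha'] at ha) (-τ) (Finset.mem_image_of_mem _ hτ)
  simpa using h3

/-- Passing from `a` to `2 * a` and subtracting `2^j` times the given relation removes the exponent
`j` and multiplies the coefficient at `k` by `2^k - 2^j ≠ 0`. -/
lemma eq_zero_of_sum_zpow (S : Finset ℤ) : ∀ c : ℤ → ℂ,
    (∀ a : ℝ, 0 < a → ∑ n ∈ S, c n * (a : ℂ) ^ n = 0) → ∀ n ∈ S, c n = 0 := by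
  induction S using Finset.induction_on with
  | empty => simp
  | insert j S hj ih =>
    intro c h
    have hS : ∀ k ∈ S, c k = 0 := by
      intro k hk
      have h1 := ih (fun n => c n * ((2 : ℂ) ^ n - 2 ^ j)) (fun a ha => by
        have h2 := h (2 * a) (by positivity)
        have h3 := h a ha
        rw [Finset.sum_insert hj] at h2 h3
        have h4 : ∑ n ∈ S, c n * ((2 : ℂ) ^ n - 2 ^ j) * (a : ℂ) ^ n =
            ∑ n ∈ S, c n * ((2 * a : ℝ) : ℂ) ^ n - 2 ^ j * ∑ n ∈ S, c n * (a : ℂ) ^ n := by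
          rw [Finset.mul_sum, ← Finset.sum_sub_distrib]
          refine Finset.sum_congr rfl fun n _ => ?_
          push_cast
          rw [mul_zpow]
          ring
        rw [h4]
        push_cast at h2 ⊢
        rw [mul_zpow] at h2
        linear_combination h2 - 2 ^ j * h3) k hk
      rcases mul_eq_zero.1 h1 with h5 | h5
      · exact h5
      · exfalso
        have h6 : (2 : ℝ) ^ k = 2 ^ j := by
          apply Complex.ofReal_injective
          push_cast
          exact sub_eq_zero.1 h5
        have h7 := zpow_right_injective₀ (a := (2 : ℝ)) (by norm_num) (by norm_num) h6
        exact hj (h7 ▸ hk)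
    intro n hn
    rcases Finset.mem_insert.1 hn with rfl | hn
    · have h1 := h 1 one_pos
      rw [Finset.sum_insert hj, Finset.sum_eq_zero (fun k hk => by rw [hS k hk, zero_mul])] at h1
      simpa using h1
    · exact hS n hn

/-! ### Leading terms of expansions -/

/-- The normalization `t^(-σ) (log t)^(-M)`. -/
def leadNorm (σ : ℝ) (M : ℕ) (t : ℝ) : ℂ := (t : ℂ) ^ (-σ : ℂ) * ((Real.log t : ℂ) ^ M)⁻¹

lemma eventually_one_le_abs_log : ∀ᶠ t : ℝ in 𝓝[>] 0, 0 < t ∧ 1 ≤ |Real.log t| := by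
  filter_upwards [self_mem_nhdsWithin,
    Real.tendsto_log_nhdsGT_zero.eventually (eventually_le_atBot (-1))] with t ht h
  exact ⟨ht, by rw [abs_of_nonpos (by linarith)]; linarith⟩

lemma norm_leadNorm {σ : ℝ} {M : ℕ} {t : ℝ} (ht : 0 < t) :
    ‖leadNorm σ M t‖ = t ^ (-σ) * (|Real.log t| ^ M)⁻¹ := by
  rw [leadNorm, norm_mul, norm_inv, norm_pow, Complex.norm_cpow_eq_rpow_re_of_pos ht,
    Complex.norm_real, Real.norm_eq_abs]
  simp

lemma norm_leadNorm_le {σ : ℝ} {M : ℕ} {t : ℝ} (ht : 0 < t) (h1 : 1 ≤ |Real.log t|) :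
    ‖leadNorm σ M t‖ ≤ t ^ (-σ) := by
  rw [norm_leadNorm ht]
  exact mul_le_of_le_one_right (by positivity) (inv_le_one_of_one_le₀ (one_le_pow₀ h1))

/-- What is left after normalization is a factor of modulus one, which oscillates, and a nonpositive
power of the logarithm. -/
lemma leadNorm_mul_powLog {σ : ℝ} {M m : ℕ} {z : ℂ} {t : ℝ} (ht : 0 < t)
    (h1 : 1 ≤ |Real.log t|) (hz : z.re = σ) (hm : m ≤ M) :
    leadNorm σ M t * powLog z m t =
      powLog (Complex.I * z.im) 0 t * ((Real.log t : ℂ) ^ (M - m))⁻¹ := by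
  have ht0 : (t : ℂ) ≠ 0 := by exact_mod_cast ht.ne'
  have hl0 : (Real.log t : ℂ) ≠ 0 := by
    intro h
    rw [Complex.ofReal_eq_zero.1 h, abs_zero] at h1
    linarith
  obtain ⟨k, rfl⟩ := Nat.exists_eq_add_of_le hm
  have h3 : z = σ + Complex.I * z.im := by
    rw [← hz, mul_comm]; exact (Complex.re_add_im z).symm
  rw [leadNorm, powLog_of_pos ht, powLog_of_pos ht, pow_zero, mul_one, Nat.add_sub_cancel_left]
  conv_lhs => rw [h3, Complex.cpow_add _ _ ht0, Complex.cpow_neg, pow_add]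
  have h4 : (t : ℂ) ^ (σ : ℂ) ≠ 0 := by simp [Complex.cpow_eq_zero_iff, ht0]
  field_simp

section Leading

variable {X : Type*} {l : Filter X} {β : X → ℝ}

lemma tendsto_leadNorm_mul_of_norm_le (hβ : Tendsto β l (𝓝[>] 0)) {σ τ C : ℝ} (hτ : σ < τ) (M : ℕ)
    {R : X → ℂ} (hR : ∀ᶠ x in l, ‖R x‖ ≤ C * β x ^ τ) :
    Tendsto (fun x => leadNorm σ M (β x) * R x) l (𝓝 0) := by
  have h0 : Tendsto (fun x => C * (β x ^ (τ - σ) * |Real.log (β x)| ^ 0)) l (𝓝 0) := by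
    simpa using ((tendsto_rpow_mul_abs_log_pow (sub_pos.2 hτ) 0).comp hβ).const_mul C
  refine squeeze_zero_norm' ?_ h0
  filter_upwards [hR, hβ.eventually eventually_one_le_abs_log] with x h1 ⟨h2, h3⟩
  rw [norm_mul, pow_zero, mul_one]
  calc ‖leadNorm σ M (β x)‖ * ‖R x‖ ≤ β x ^ (-σ) * (C * β x ^ τ) :=
        mul_le_mul (norm_leadNorm_le h2 h3) h1 (norm_nonneg _) (by positivity)
    _ = C * β x ^ (τ - σ) := by rw [sub_eq_add_neg, Real.rpow_add h2]; ring

/-- A normalized term survives only if both its real exponent and its power of the logarithm are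
leading. It then oscillates and need not converge, so the oscillation is subtracted. -/
lemma tendsto_leadNorm_mul_powLog_mul (hβ : Tendsto β l (𝓝[>] 0)) {σ : ℝ} {M m : ℕ} {z : ℂ}
    (hz : σ ≤ z.re) (hm : z.re = σ → m ≤ M) {G : X → ℂ} {c : ℂ} (hG : Tendsto G l (𝓝 c)) :
    Tendsto (fun x => leadNorm σ M (β x) * (powLog z m (β x) * G x) -
      if z.re = σ ∧ m = M then c * powLog (Complex.I * z.im) 0 (β x) else 0) l (𝓝 0) := by
  have hlog := hβ.eventually eventually_one_le_abs_log
  rcases hz.eq_or_lt with hz | hz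
  · rcases (hm hz.symm).eq_or_lt with rfl | hmM
    · have h1 : Tendsto (fun x => powLog (Complex.I * z.im) 0 (β x) * (G x - c)) l (𝓝 0) := by
        have h2 : Tendsto (fun x => G x - c) l (𝓝 0) := by
          simpa using hG.sub_const c
        refine squeeze_zero_norm' ?_ (tendsto_zero_iff_norm_tendsto_zero.1 h2)
        filter_upwards [hlog] with x hx
        rw [norm_mul, norm_powLog_of_pos hx.1]
        simp
      refine h1.congr' ?_
      filter_upwards [hlog] with x hx
      rw [if_pos ⟨hz.symm, rfl⟩, ← mul_assoc, leadNorm_mul_powLog hx.1 hx.2 hz.symm le_rfl]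
      simp
      ring
    · have h1 : Tendsto (fun x => |Real.log (β x)|⁻¹ * ‖G x‖) l (𝓝 0) := by
        have h2 : Tendsto (fun t : ℝ => |Real.log t|⁻¹) (𝓝[>] 0) (𝓝 0) :=
          (tendsto_abs_atBot_atTop.comp Real.tendsto_log_nhdsGT_zero).inv_tendsto_atTop
        simpa using (h2.comp hβ).mul hG.norm
      refine squeeze_zero_norm' ?_ h1
      filter_upwards [hlog] with x hx
      rw [if_neg (by simp [hmM.ne]), sub_zero, ← mul_assoc,
        leadNorm_mul_powLog hx.1 hx.2 hz.symm hmM.le, norm_mul, norm_mul, norm_inv, norm_pow,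
        Complex.norm_real, Real.norm_eq_abs, norm_powLog_of_pos hx.1]
      gcongr
      simp only [Complex.mul_re, Complex.I_re, Complex.I_im, Complex.ofReal_re, Complex.ofReal_im,
        zero_mul, mul_zero, sub_zero, Real.rpow_zero, pow_zero, one_mul]
      refine inv_anti₀ (by linarith [hx.2]) ?_
      exact le_self_pow₀ hx.2 (by omega)
  · have h1 : Tendsto (fun x => β x ^ (z.re - σ) * |Real.log (β x)| ^ m * ‖G x‖) l (𝓝 0) := by
      simpa using ((tendsto_rpow_mul_abs_log_pow (sub_pos.2 hz) m).comp hβ).mul hG.norm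
    refine squeeze_zero_norm' ?_ h1
    filter_upwards [hlog] with x hx
    rw [if_neg (by simp [hz.ne']), sub_zero, norm_mul, norm_mul, norm_powLog_of_pos hx.1,
      sub_eq_add_neg, Real.rpow_add hx.1]
    have := norm_leadNorm_le (σ := σ) (M := M) hx.1 hx.2
    calc ‖leadNorm σ M (β x)‖ * (β x ^ z.re * |Real.log (β x)| ^ m * ‖G x‖)
        ≤ β x ^ (-σ) * (β x ^ z.re * |Real.log (β x)| ^ m * ‖G x‖) := by
          have := hx.1
          gcongr
      _ = _ := by ring

end Leading

end AsympHyp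
end

noncomputable section

set_option linter.unusedSectionVars false

namespace AsympHyp

open Set Filter

variable {M : Type*} [TopologicalSpace M] [ChartedSpace (EuclideanHalfSpace 3) M]

/-! ### Charts of a manifold with boundary -/

lemma range_model : range (𝓡∂ 3) = Half := range_modelWithCornersEuclideanHalfSpace 3

lemma relOpen_target (e : OpenPartialHomeomorph M (EuclideanHalfSpace 3)) :
    RelOpen (e.extend (𝓡∂ 3)).target := by
  constructor
  · rw [← range_model]
    exact e.extend_target_subset_range
  · intro y hy
    have h1 : (e.extend (𝓡∂ 3)).symm y ∈ e.source := by
      rw [← e.extend_source (I := 𝓡∂ 3)]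
      exact (e.extend (𝓡∂ 3)).map_target hy
    have := e.extend_target_mem_nhdsWithin (I := 𝓡∂ 3) h1
    rwa [(e.extend (𝓡∂ 3)).right_inv hy, range_model] at this

lemma extend_symm_mem {e : OpenPartialHomeomorph M (EuclideanHalfSpace 3)} {y : E3}
    (hy : y ∈ (e.extend (𝓡∂ 3)).target) : (e.extend (𝓡∂ 3)).symm y ∈ e.source := by
  rw [← e.extend_source (I := 𝓡∂ 3)]
  exact (e.extend (𝓡∂ 3)).map_target hy

lemma extend_mem {e : OpenPartialHomeomorph M (EuclideanHalfSpace 3)} {x : M}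
    (hx : x ∈ e.source) : e.extend (𝓡∂ 3) x ∈ (e.extend (𝓡∂ 3)).target := by
  rw [← e.extend_source (I := 𝓡∂ 3)] at hx
  exact (e.extend (𝓡∂ 3)).map_source hx

lemma extend_left_inv {e : OpenPartialHomeomorph M (EuclideanHalfSpace 3)} {x : M}
    (hx : x ∈ e.source) : (e.extend (𝓡∂ 3)).symm (e.extend (𝓡∂ 3) x) = x := by
  rw [← e.extend_source (I := 𝓡∂ 3)] at hx
  exact (e.extend (𝓡∂ 3)).left_inv hx

variable [IsManifold (𝓡∂ 3) ∞ M] {e : OpenPartialHomeomorph M (EuclideanHalfSpace 3)}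

lemma contMDiffOn_extend_symm_target (he : e ∈ IsManifold.maximalAtlas (𝓡∂ 3) ∞ M) :
    ContMDiffOn 𝓘(ℝ, E3) (𝓡∂ 3) ∞ (e.extend (𝓡∂ 3)).symm (e.extend (𝓡∂ 3)).target := by
  have h := contMDiffOn_extend_symm (I := 𝓡∂ 3) he
  rwa [← e.extend_target'] at h

/-- Interior points are defined through the preferred chart. Any chart of the maximal atlas is a
local diffeomorphism to the half-space, and these preserve interior points. -/
lemma mem_interior_iff (he : e ∈ IsManifold.maximalAtlas (𝓡∂ 3) ∞ M) {x : M} (hx : x ∈ e.source) :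
    x ∈ (𝓡∂ 3).interior M ↔ 0 < e.extend (𝓡∂ 3) x 0 := by
  let Φ : PartialDiffeomorph (𝓡∂ 3) (𝓡∂ 3) M (EuclideanHalfSpace 3) ∞ :=
    { e.toPartialEquiv with
      open_source := e.open_source
      open_target := e.open_target
      contMDiffOn_toFun := contMDiffOn_of_mem_maximalAtlas he
      contMDiffOn_invFun := contMDiffOn_symm_of_mem_maximalAtlas he }
  have h1 : IsLocalDiffeomorphAt (𝓡∂ 3) (𝓡∂ 3) ∞ e x := ⟨Φ, hx, fun _ _ => rfl⟩
  have h2 := h1.isInteriorPoint_iff (by simp)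
  change (𝓡∂ 3).IsInteriorPoint x ↔ _
  rw [h2, ModelWithCorners.isInteriorPoint_iff]
  have h3 : interior (extChartAt (𝓡∂ 3) (e x)).target = {y : E3 | 0 < y 0} := by
    rw [show (extChartAt (𝓡∂ 3) (e x)).target = range (𝓡∂ 3) by
      rw [extChartAt, chartAt_self_eq]; ext y; simp [mfld_simps]]
    exact interior_range_modelWithCornersEuclideanHalfSpace 3
  rw [h3]
  rfl

lemma symm_mem_interior_iff (he : e ∈ IsManifold.maximalAtlas (𝓡∂ 3) ∞ M) {y : E3}
    (hy : y ∈ (e.extend (𝓡∂ 3)).target) :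
    (e.extend (𝓡∂ 3)).symm y ∈ (𝓡∂ 3).interior M ↔ 0 < y 0 := by
  rw [mem_interior_iff he (extend_symm_mem hy), (e.extend (𝓡∂ 3)).right_inv hy]

lemma target_inter_preimage_interior (he : e ∈ IsManifold.maximalAtlas (𝓡∂ 3) ∞ M) :
    (e.extend (𝓡∂ 3)).target ∩ (e.extend (𝓡∂ 3)).symm ⁻¹' (𝓡∂ 3).interior M =
      (e.extend (𝓡∂ 3)).target ∩ Pos := by
  ext y
  constructor
  · rintro ⟨h1, h2⟩
    exact ⟨h1, (symm_mem_interior_iff he h1).1 h2⟩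
  · rintro ⟨h1, h2⟩
    exact ⟨h1, (symm_mem_interior_iff he h1).2 h2⟩

lemma extend_zero_of_boundary (he : e ∈ IsManifold.maximalAtlas (𝓡∂ 3) ∞ M) {x : M}
    (hx : x ∈ e.source) (hb : x ∈ (𝓡∂ 3).boundary M) : e.extend (𝓡∂ 3) x 0 = 0 := by
  rw [← ModelWithCorners.compl_interior] at hb
  have h1 : ¬ 0 < e.extend (𝓡∂ 3) x 0 := fun h => hb ((mem_interior_iff he hx).2 h)
  have h2 : 0 ≤ e.extend (𝓡∂ 3) x 0 := (relOpen_target e).subset (extend_mem hx)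
  linarith

lemma symm_mem_boundary (he : e ∈ IsManifold.maximalAtlas (𝓡∂ 3) ∞ M) {y : E3}
    (hy : y ∈ (e.extend (𝓡∂ 3)).target) (h0 : y 0 = 0) :
    (e.extend (𝓡∂ 3)).symm y ∈ (𝓡∂ 3).boundary M := by
  rw [← ModelWithCorners.compl_interior]
  intro h
  have := (symm_mem_interior_iff he hy).1 h
  linarith

/-- The chart carries the interior part of the neighbourhood filter of a point to that of its
image. -/
lemma map_extend_nhdsWithin_interior (he : e ∈ IsManifold.maximalAtlas (𝓡∂ 3) ∞ M) {x : M}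
    (hx : x ∈ e.source) :
    Tendsto (e.extend (𝓡∂ 3)) (𝓝[(𝓡∂ 3).interior M] x)
      (𝓝[(e.extend (𝓡∂ 3)).target ∩ Pos] (e.extend (𝓡∂ 3) x)) := by
  refine tendsto_nhdsWithin_iff.2 ⟨?_, ?_⟩
  · exact (e.continuousAt_extend (I := 𝓡∂ 3) hx).tendsto.mono_left nhdsWithin_le_nhds
  · filter_upwards [self_mem_nhdsWithin, mem_nhdsWithin_of_mem_nhds (e.open_source.mem_nhds hx)]
      with z h1 h2
    exact ⟨extend_mem h2, (mem_interior_iff he h2).1 h1⟩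

lemma map_symm_nhdsWithin (he : e ∈ IsManifold.maximalAtlas (𝓡∂ 3) ∞ M) {y : E3}
    (hy : y ∈ (e.extend (𝓡∂ 3)).target) :
    Tendsto (e.extend (𝓡∂ 3)).symm (𝓝[(e.extend (𝓡∂ 3)).target ∩ Pos] y)
      (𝓝[(𝓡∂ 3).interior M] ((e.extend (𝓡∂ 3)).symm y)) := by
  refine tendsto_nhdsWithin_iff.2 ⟨?_, ?_⟩
  · exact ((contMDiffOn_extend_symm_target he).continuousOn y hy).tendsto.mono_left
      (nhdsWithin_mono _ inter_subset_left)
  · filter_upwards [self_mem_nhdsWithin] with z hz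
    exact (symm_mem_interior_iff he hz.1).2 hz.2

lemma interior_neBot (x : M) : (𝓝[(𝓡∂ 3).interior M] x).NeBot := by
  have he := IsManifold.chart_mem_maximalAtlas (I := 𝓡∂ 3) (n := ∞) x
  have hx := mem_chart_source (EuclideanHalfSpace 3) x
  have h1 := map_symm_nhdsWithin he (extend_mem hx)
  rw [extend_left_inv hx] at h1
  have := (relOpen_target (chartAt (EuclideanHalfSpace 3) x)).neBot (extend_mem hx)
  exact h1.neBot

/-! ### Coordinate frames -/

lemma hasMFDerivWithinAt_extend_symm (he : e ∈ IsManifold.maximalAtlas (𝓡∂ 3) ∞ M) {y : E3}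
    (hy : y ∈ (e.extend (𝓡∂ 3)).target) :
    HasMFDerivWithinAt 𝓘(ℝ, E3) (𝓡∂ 3) (e.extend (𝓡∂ 3)).symm (range (𝓡∂ 3)) y
      (mfderivWithin 𝓘(ℝ, E3) (𝓡∂ 3) (e.extend (𝓡∂ 3)).symm (range (𝓡∂ 3)) y) := by
  have h1 : MDifferentiableWithinAt 𝓘(ℝ, E3) (𝓡∂ 3) (e.extend (𝓡∂ 3)).symm (range (𝓡∂ 3)) y := by
    refine ((contMDiffOn_extend_symm_target he).mdifferentiableOn (by simp) y hy
      ).mono_of_mem_nhdsWithin ?_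
    rw [range_model]
    exact (relOpen_target e).mem_nhds y hy
  exact h1.hasMFDerivWithinAt

lemma hasMFDerivAt_extend (he : e ∈ IsManifold.maximalAtlas (𝓡∂ 3) ∞ M) {x : M}
    (hx : x ∈ e.source) :
    HasMFDerivAt (𝓡∂ 3) 𝓘(ℝ, E3) (e.extend (𝓡∂ 3)) x
      (mfderiv (𝓡∂ 3) 𝓘(ℝ, E3) (e.extend (𝓡∂ 3)) x) :=
  ((e.contMDiffAt_extend he hx).mdifferentiableAt (by simp)).hasMFDerivAt

lemma mfderiv_extend_mfderivWithin_symm (he : e ∈ IsManifold.maximalAtlas (𝓡∂ 3) ∞ M) {x : M}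
    (hx : x ∈ e.source) (v : E3) :
    mfderiv (𝓡∂ 3) 𝓘(ℝ, E3) (e.extend (𝓡∂ 3)) x
      (mfderivWithin 𝓘(ℝ, E3) (𝓡∂ 3) (e.extend (𝓡∂ 3)).symm (range (𝓡∂ 3))
        (e.extend (𝓡∂ 3) x) v) = v := by
  have hy := extend_mem hx
  have h1 := hasMFDerivWithinAt_extend_symm he hy
  have h2 := hasMFDerivAt_extend he (extend_symm_mem hy)
  have h3 := HasMFDerivAt.comp_hasMFDerivWithinAt _ h2 h1
  have h4 : HasMFDerivWithinAt 𝓘(ℝ, E3) 𝓘(ℝ, E3) (e.extend (𝓡∂ 3) ∘ (e.extend (𝓡∂ 3)).symm)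
      (range (𝓡∂ 3)) (e.extend (𝓡∂ 3) x) (ContinuousLinearMap.id ℝ E3) := by
    refine (hasMFDerivWithinAt_id _ _).congr_of_eventuallyEq ?_ ?_
    · rw [range_model]
      filter_upwards [(relOpen_target e).mem_nhds _ hy] with z hz
      exact (e.extend (𝓡∂ 3)).right_inv hz
    · exact (e.extend (𝓡∂ 3)).right_inv hy
  have hu : UniqueMDiffWithinAt 𝓘(ℝ, E3) (range (𝓡∂ 3)) (e.extend (𝓡∂ 3) x) :=
    ((𝓡∂ 3).uniqueDiffOn _ (e.extend_target_subset_range hy)).uniqueMDiffWithinAt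
  have h5 := hu.eq h3 h4
  rw [extend_left_inv hx] at h5
  exact DFunLike.congr_fun h5 v

lemma mfderivWithin_symm_mfderiv_extend (he : e ∈ IsManifold.maximalAtlas (𝓡∂ 3) ∞ M) {x : M}
    (hx : x ∈ e.source) (v : TangentSpace (𝓡∂ 3) x) :
    mfderivWithin 𝓘(ℝ, E3) (𝓡∂ 3) (e.extend (𝓡∂ 3)).symm (range (𝓡∂ 3))
        (e.extend (𝓡∂ 3) x) (mfderiv (𝓡∂ 3) 𝓘(ℝ, E3) (e.extend (𝓡∂ 3)) x v) = v := by
  have hy := extend_mem hx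
  have h1 := hasMFDerivWithinAt_extend_symm he hy
  have h2 := hasMFDerivAt_extend he hx
  have h3 := HasMFDerivWithinAt.comp x h1 h2.hasMFDerivWithinAt (s := univ)
    (fun z _ => by simp [mfld_simps])
  have h4 : HasMFDerivWithinAt (𝓡∂ 3) (𝓡∂ 3) ((e.extend (𝓡∂ 3)).symm ∘ e.extend (𝓡∂ 3))
      univ x (ContinuousLinearMap.id ℝ (TangentSpace (𝓡∂ 3) x)) := by
    refine (hasMFDerivWithinAt_id _ _).congr_of_eventuallyEq ?_ ?_
    · rw [nhdsWithin_univ]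
      filter_upwards [e.open_source.mem_nhds hx] with z hz
      exact extend_left_inv hz
    · exact extend_left_inv hx
  have h5 := (uniqueMDiffWithinAt_univ (𝓡∂ 3)).eq h3 h4
  exact DFunLike.congr_fun h5 v

/-- The differential of a chart, with values in Euclidean space. -/
def dExtend (e : OpenPartialHomeomorph M (EuclideanHalfSpace 3)) (x : M) :
    TangentSpace (𝓡∂ 3) x →L[ℝ] E3 :=
  mfderiv (𝓡∂ 3) 𝓘(ℝ, E3) (e.extend (𝓡∂ 3)) x

/-- The differential of an inverse chart, defined on Euclidean space. -/
def dSymm (e : OpenPartialHomeomorph M (EuclideanHalfSpace 3)) (x : M) :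
    E3 →L[ℝ] TangentSpace (𝓡∂ 3) x :=
  mfderivWithin 𝓘(ℝ, E3) (𝓡∂ 3) (e.extend (𝓡∂ 3)).symm (range (𝓡∂ 3)) (e.extend (𝓡∂ 3) x)

lemma dExtend_dSymm (he : e ∈ IsManifold.maximalAtlas (𝓡∂ 3) ∞ M) {x : M}
    (hx : x ∈ e.source) (v : E3) : dExtend e x (dSymm e x v) = v :=
  mfderiv_extend_mfderivWithin_symm he hx v

lemma dSymm_dExtend (he : e ∈ IsManifold.maximalAtlas (𝓡∂ 3) ∞ M) {x : M}
    (hx : x ∈ e.source) (v : TangentSpace (𝓡∂ 3) x) : dSymm e x (dExtend e x v) = v :=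
  mfderivWithin_symm_mfderiv_extend he hx v

lemma coordVec_eq (x : M) (i : Fin 3) :
    coordVec e x i = dSymm e x (EuclideanSpace.single i (1 : ℝ)) := rfl

lemma coordCovec_apply (x : M) (j : Fin 3) (v : TangentSpace (𝓡∂ 3) x) :
    coordCovec e x j v = dExtend e x v j := rfl

lemma coordCovec_coordVec (he : e ∈ IsManifold.maximalAtlas (𝓡∂ 3) ∞ M) {x : M}
    (hx : x ∈ e.source) (i j : Fin 3) :
    coordCovec e x j (coordVec e x i) = if j = i then 1 else 0 := by
  rw [coordCovec_apply, coordVec_eq, dExtend_dSymm he hx]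
  simp

lemma euclidean_eq_sum (v : E3) : v = ∑ i, v i • EuclideanSpace.single i (1 : ℝ) := by
  ext j
  simp [WithLp.ofLp_sum, Finset.sum_apply, Pi.single_apply]

lemma eq_sum_coordVec (he : e ∈ IsManifold.maximalAtlas (𝓡∂ 3) ∞ M) {x : M}
    (hx : x ∈ e.source) (v : TangentSpace (𝓡∂ 3) x) :
    v = ∑ i, coordCovec e x i v • coordVec e x i := by
  conv_lhs => rw [← dSymm_dExtend he hx v, euclidean_eq_sum (dExtend e x v), map_sum]
  refine Finset.sum_congr rfl fun i _ => ?_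
  rw [map_smul, coordVec_eq, coordCovec_apply]

lemma dual_eq_sum_coordCovec (he : e ∈ IsManifold.maximalAtlas (𝓡∂ 3) ∞ M) {x : M}
    (hx : x ∈ e.source) (w : Module.Dual ℝ (TangentSpace (𝓡∂ 3) x)) :
    w = ∑ i, w (coordVec e x i) • coordCovec e x i := by
  ext v
  conv_lhs => rw [eq_sum_coordVec he hx v]
  simp [mul_comm]

variable {q p : ℕ}

/-- Expansion of a tensor in terms of its components in a coordinate frame. -/
lemma ctensor_apply_eq_sum (he : e ∈ IsManifold.maximalAtlas (𝓡∂ 3) ∞ M) {x : M}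
    (hx : x ∈ e.source) (T : CTensor q p (TangentSpace (𝓡∂ 3) x))
    (v : Fin q → TangentSpace (𝓡∂ 3) x) (w : Fin p → Module.Dual ℝ (TangentSpace (𝓡∂ 3) x)) :
    T v w = ∑ K : Idx q p, (((∏ a, coordCovec e x (K.1 a) (v a)) *
      (∏ b, w b (coordVec e x (K.2 b))) : ℝ) : ℂ) *
      T (fun a => coordVec e x (K.1 a)) (fun b => coordCovec e x (K.2 b)) := by
  have h1 : v = fun a => ∑ i, coordCovec e x i (v a) • coordVec e x i :=
    funext fun a => eq_sum_coordVec he hx (v a)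
  have h2 : w = fun b => ∑ i, w b (coordVec e x i) • coordCovec e x i :=
    funext fun b => dual_eq_sum_coordCovec he hx (w b)
  rw [Fintype.sum_prod_type]
  conv_lhs => rw [h1, T.map_sum]
  rw [sum_apply]
  refine Finset.sum_congr rfl fun r _ => ?_
  rw [T.map_smul_univ, smul_apply]
  conv_lhs => rw [h2]
  rw [MultilinearMap.map_sum, Finset.smul_sum]
  refine Finset.sum_congr rfl fun s _ => ?_
  rw [MultilinearMap.map_smul_univ, smul_smul, Complex.real_smul]

/-- The tensor with given components in a coordinate frame. -/
def ofComp (e : OpenPartialHomeomorph M (EuclideanHalfSpace 3)) (x : M) (c : Idx q p → ℂ) :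
    CTensor q p (TangentSpace (𝓡∂ 3) x) :=
  ∑ K : Idx q p, (MultilinearMap.mkPiRing ℝ (Fin q)
    ((MultilinearMap.mkPiRing ℝ (Fin p) (c K)).compLinearMap
      fun b => Module.Dual.eval ℝ _ (coordVec e x (K.2 b)))).compLinearMap
        fun a => coordCovec e x (K.1 a)

lemma ofComp_apply (x : M) (c : Idx q p → ℂ)
    (v : Fin q → TangentSpace (𝓡∂ 3) x) (w : Fin p → Module.Dual ℝ (TangentSpace (𝓡∂ 3) x)) :
    ofComp e x c v w = ∑ K : Idx q p, (((∏ a, coordCovec e x (K.1 a) (v a)) *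
      (∏ b, w b (coordVec e x (K.2 b))) : ℝ) : ℂ) * c K := by
  simp only [ofComp, sum_apply, MultilinearMap.compLinearMap_apply,
    MultilinearMap.mkPiRing_apply, smul_apply, Module.Dual.eval_apply,
    Complex.real_smul]
  refine Finset.sum_congr rfl fun K _ => ?_
  push_cast
  ring

end AsympHyp
end

noncomputable section

set_option linter.unusedSectionVars false

namespace AsympHyp

open Set Filter

variable {M : Type*} [TopologicalSpace M] [ChartedSpace (EuclideanHalfSpace 3) M]
variable [IsManifold (𝓡∂ 3) ∞ M] {e : OpenPartialHomeomorph M (EuclideanHalfSpace 3)}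

/-! ### Change of charts -/

/-- These are the entries of the Jacobian matrix of the transition map, which is smooth up to the
boundary on the relatively open set `W` where both charts are defined. -/
lemma tendsto_transition {e' : OpenPartialHomeomorph M (EuclideanHalfSpace 3)}
    (he : e ∈ IsManifold.maximalAtlas (𝓡∂ 3) ∞ M) (he' : e' ∈ IsManifold.maximalAtlas (𝓡∂ 3) ∞ M)
    {x : M} (hx : x ∈ e.source) (hx' : x ∈ e'.source) (i j : Fin 3) :
    Tendsto (fun z => coordCovec e' z j (coordVec e z i)) (𝓝 x)
      (𝓝 (coordCovec e' x j (coordVec e x i))) := by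
  set W : Set E3 := (e.extend (𝓡∂ 3)).target ∩ (e.extend (𝓡∂ 3)).symm ⁻¹' e'.source with hW
  have hWopen : RelOpen W := by
    refine ⟨fun y hy => (relOpen_target e).subset hy.1, fun y hy => ?_⟩
    rw [← (relOpen_target e).nhdsWithin_eq hy.1]
    refine inter_mem self_mem_nhdsWithin ?_
    exact (contMDiffOn_extend_symm_target he).continuousOn y hy.1 (e'.open_source.mem_nhds hy.2)
  set τ : E3 → E3 := e'.extend (𝓡∂ 3) ∘ (e.extend (𝓡∂ 3)).symm with hτ
  have hsm : ContDiffOn ℝ ∞ τ W := by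
    rw [← contMDiffOn_iff_contDiffOn]
    exact (e'.contMDiffOn_extend he').comp
      ((contMDiffOn_extend_symm_target he).mono inter_subset_left) fun y hy => hy.2
  have hmem : ∀ z ∈ e.source ∩ e'.source, e.extend (𝓡∂ 3) z ∈ W := fun z hz =>
    ⟨extend_mem hz.1, by rw [mem_preimage, extend_left_inv hz.1]; exact hz.2⟩
  have key : ∀ z ∈ e.source ∩ e'.source, coordCovec e' z j (coordVec e z i) =
      fderivWithin ℝ τ W (e.extend (𝓡∂ 3) z) (EuclideanSpace.single i (1 : ℝ)) j := by
    intro z hz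
    have hWsub : W ⊆ range (𝓡∂ 3) := by rw [range_model]; exact hWopen.subset
    have h1 := hasMFDerivWithinAt_extend_symm he (extend_mem hz.1)
    have h2 := hasMFDerivAt_extend he' (x := (e.extend (𝓡∂ 3)).symm (e.extend (𝓡∂ 3) z))
      (by rw [extend_left_inv hz.1]; exact hz.2)
    let D₁ : M → E3 →L[ℝ] E3 := fun w => dExtend e' w
    let D₂ : E3 →L[ℝ] E3 := dSymm e z
    have h3 : HasFDerivWithinAt τ
        ((D₁ ((e.extend (𝓡∂ 3)).symm (e.extend (𝓡∂ 3) z))).comp D₂) (range (𝓡∂ 3))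
        (e.extend (𝓡∂ 3) z) :=
      hasMFDerivWithinAt_iff_hasFDerivWithinAt.1 (HasMFDerivAt.comp_hasMFDerivWithinAt _ h2 h1)
    rw [(h3.mono hWsub).fderivWithin (hWopen.uniqueDiffOn _ (hmem z hz)), extend_left_inv hz.1]
    rfl
  have hc : ContinuousOn (fun y => fderivWithin ℝ τ W y (EuclideanSpace.single i (1 : ℝ)) j) W := by
    have h1 := (hsm.fderivWithin hWopen.uniqueDiffOn (m := ∞) (by simp)).continuousOn
    have h2 : ContinuousOn (fun y => fderivWithin ℝ τ W y (EuclideanSpace.single i (1 : ℝ))) W :=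
      h1.clm_apply continuousOn_const
    exact (EuclideanSpace.proj j : E3 →L[ℝ] ℝ).continuous.comp_continuousOn h2
  rw [key x ⟨hx, hx'⟩]
  have hnear : ∀ᶠ z in 𝓝 x, z ∈ e.source ∩ e'.source :=
    (e.open_source.inter e'.open_source).mem_nhds ⟨hx, hx'⟩
  have ht : Tendsto (e.extend (𝓡∂ 3)) (𝓝 x) (𝓝[W] (e.extend (𝓡∂ 3) x)) :=
    tendsto_nhdsWithin_iff.2 ⟨(e.continuousAt_extend (I := 𝓡∂ 3) hx).tendsto,
      hnear.mono hmem⟩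
  refine ((hc _ (hmem x ⟨hx, hx'⟩)).tendsto.comp ht).congr' ?_
  filter_upwards [hnear] with z hz using (key z hz).symm

lemma comp_eq_sum {E : TensorType} {e' : OpenPartialHomeomorph M (EuclideanHalfSpace 3)}
    (he' : e' ∈ IsManifold.maximalAtlas (𝓡∂ 3) ∞ M)
    {x : M} (hx' : x ∈ e'.source) (u : TensorField M E) (K : Idx E.cov E.contra) :
    comp e u x K = ∑ K' : Idx E.cov E.contra,
      (((∏ a, coordCovec e' x (K'.1 a) (coordVec e x (K.1 a))) *
        (∏ b, coordCovec e x (K.2 b) (coordVec e' x (K'.2 b))) : ℝ) : ℂ) * comp e' u x K' :=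
  ctensor_apply_eq_sum he' hx' _ _ _

/-! ### The metric in coordinates -/

namespace AHStructure

variable (A : AHStructure M)

/-- The components of the compactified metric, as functions of the coordinates. -/
def gbarComp (e : OpenPartialHomeomorph M (EuclideanHalfSpace 3)) (i j : Fin 3) (y : E3) : ℝ :=
  A.gbar.inner ((e.extend (𝓡∂ 3)).symm y)
    (coordVec e ((e.extend (𝓡∂ 3)).symm y) i) (coordVec e ((e.extend (𝓡∂ 3)).symm y) j)

/-- A coordinate field is the image of a constant field under the tangent map of the inverse chart.
-/
lemma contMDiffOn_coordVec (he : e ∈ IsManifold.maximalAtlas (𝓡∂ 3) ∞ M) (i : Fin 3) :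
    ContMDiffOn 𝓘(ℝ, E3) (𝓡∂ 3).tangent ∞
      (fun y : E3 => (⟨(e.extend (𝓡∂ 3)).symm y, coordVec e ((e.extend (𝓡∂ 3)).symm y) i⟩ :
        TangentBundle (𝓡∂ 3) M)) (e.extend (𝓡∂ 3)).target := by
  set Ω := (e.extend (𝓡∂ 3)).target with hΩ
  have hu : UniqueMDiffOn 𝓘(ℝ, E3) Ω := (relOpen_target e).uniqueDiffOn.uniqueMDiffOn
  have h1 := (contMDiffOn_extend_symm_target he).contMDiffOn_tangentMapWithin (m := ∞)
    (by simp) hu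
  have h2 : ContMDiffOn 𝓘(ℝ, E3) 𝓘(ℝ, E3).tangent ∞
      (fun y : E3 => (⟨y, EuclideanSpace.single i (1 : ℝ)⟩ : TangentBundle 𝓘(ℝ, E3) E3)) Ω :=
    contMDiffOn_vectorSpace_iff_contDiffOn.2 contDiffOn_const
  refine (h1.comp h2 fun y hy => hy).congr fun y hy => ?_
  have h3 : mfderivWithin 𝓘(ℝ, E3) (𝓡∂ 3) (e.extend (𝓡∂ 3)).symm Ω y =
      mfderivWithin 𝓘(ℝ, E3) (𝓡∂ 3) (e.extend (𝓡∂ 3)).symm (range (𝓡∂ 3)) y :=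
    ((hasMFDerivWithinAt_extend_symm he hy).mono
      e.extend_target_subset_range).mfderivWithin (hu y hy)
  simp only [Function.comp_apply, tangentMapWithin]
  rw [h3]
  unfold coordVec
  rw [(e.extend (𝓡∂ 3)).right_inv hy]

lemma contDiffOn_gbarComp (he : e ∈ IsManifold.maximalAtlas (𝓡∂ 3) ∞ M) (i j : Fin 3) :
    ContDiffOn ℝ ∞ (A.gbarComp e i j) (e.extend (𝓡∂ 3)).target := by
  rw [← contMDiffOn_iff_contDiffOn]
  intro y hy
  have hb := contMDiffOn_extend_symm_target he y hy
  have hv := contMDiffOn_coordVec he i y hy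
  have hw := contMDiffOn_coordVec he j y hy
  have : ContMDiffWithinAt 𝓘(ℝ, E3) ((𝓡∂ 3).prod 𝓘(ℝ)) ∞
      (fun m : E3 ↦ Bundle.TotalSpace.mk' ℝ (E := Bundle.Trivial M ℝ) ((e.extend (𝓡∂ 3)).symm m)
        (A.gbar.inner ((e.extend (𝓡∂ 3)).symm m)
          (coordVec e ((e.extend (𝓡∂ 3)).symm m) i)
          (coordVec e ((e.extend (𝓡∂ 3)).symm m) j))) (e.extend (𝓡∂ 3)).target y := by
    apply ContMDiffWithinAt.clm_bundle_apply₂ (F₁ := E3) (F₂ := E3)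
    · exact ContMDiffAt.comp_contMDiffWithinAt y A.gbar.contMDiff.contMDiffAt hb
    · exact hv
    · exact hw
  simp only [Bundle.contMDiffWithinAt_totalSpace] at this
  exact this.2

lemma tendsto_gbar (he : e ∈ IsManifold.maximalAtlas (𝓡∂ 3) ∞ M) {x : M} (hx : x ∈ e.source)
    (i j : Fin 3) :
    Tendsto (fun z => A.gbar.inner z (coordVec e z i) (coordVec e z j)) (𝓝 x)
      (𝓝 (A.gbar.inner x (coordVec e x i) (coordVec e x j))) := by
  have h1 := (A.contDiffOn_gbarComp he i j).continuousOn _ (extend_mem hx)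
  have ht : Tendsto (e.extend (𝓡∂ 3)) (𝓝 x)
      (𝓝[(e.extend (𝓡∂ 3)).target] (e.extend (𝓡∂ 3) x)) :=
    tendsto_nhdsWithin_iff.2 ⟨(e.continuousAt_extend (I := 𝓡∂ 3) hx).tendsto, by
      filter_upwards [e.open_source.mem_nhds hx] with z hz using extend_mem hz⟩
  have h2 := h1.tendsto.comp ht
  have h3 : A.gbarComp e i j (e.extend (𝓡∂ 3) x) =
      A.gbar.inner x (coordVec e x i) (coordVec e x j) := by
    unfold gbarComp; rw [extend_left_inv hx]
  rw [h3] at h2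
  refine h2.congr' ?_
  filter_upwards [e.open_source.mem_nhds hx] with z hz
  simp only [Function.comp_apply, gbarComp]
  rw [extend_left_inv hz]

end AHStructure

end AsympHyp
end

noncomputable section

set_option linter.unusedSectionVars false

namespace AsympHyp

open Set Filter

/-! ### Orthonormalization -/

/-- Unipotent lower triangular matrix diagonalizing a symmetric form. -/
def gsUni (N : Matrix (Fin 3) (Fin 3) ℝ) : Matrix (Fin 3) (Fin 3) ℝ :=
  let p := N 0 1 / N 0 0
  let n := N 1 1 - p * N 0 1
  let r := (N 1 2 - p * N 0 2) / n
  !![1, 0, 0; -p, 1, 0; r * p - N 0 2 / N 0 0, -r, 1]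

/-- The diagonal entries of the diagonalized form. -/
def gsDiag (N : Matrix (Fin 3) (Fin 3) ℝ) : Fin 3 → ℝ :=
  let p := N 0 1 / N 0 0
  let n := N 1 1 - p * N 0 1
  let r := (N 1 2 - p * N 0 2) / n
  ![N 0 0, n, N 2 2 - N 0 2 / N 0 0 * N 0 2 - r * (N 1 2 - p * N 0 2)]

/-- The matrix of the Gram–Schmidt orthonormalization of a symmetric form. -/
def gsMat (N : Matrix (Fin 3) (Fin 3) ℝ) : Matrix (Fin 3) (Fin 3) ℝ :=
  Matrix.of fun i j => (Real.sqrt (gsDiag N i))⁻¹ * gsUni N i j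

lemma gsUni_mul (N : Matrix (Fin 3) (Fin 3) ℝ) (hN : N.IsSymm) (h0 : 0 < gsDiag N 0)
    (h1 : 0 < gsDiag N 1) (i j : Fin 3) :
    ∑ k, ∑ l, gsUni N i k * gsUni N j l * N k l = if i = j then gsDiag N i else 0 := by
  have e1 : N 1 0 = N 0 1 := hN.apply 0 1
  have e2 : N 2 0 = N 0 2 := hN.apply 0 2
  have e3 : N 2 1 = N 1 2 := hN.apply 1 2
  have h0' : N 0 0 ≠ 0 := ne_of_gt (by simpa [gsDiag] using h0)
  have h1' : N 1 1 - N 0 1 / N 0 0 * N 0 1 ≠ 0 := ne_of_gt (by simpa [gsDiag] using h1)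
  have hp : N 0 1 / N 0 0 * N 0 0 = N 0 1 := div_mul_cancel₀ _ h0'
  have hs : N 0 2 / N 0 0 * N 0 0 = N 0 2 := div_mul_cancel₀ _ h0'
  have hr : (N 1 2 - N 0 1 / N 0 0 * N 0 2) / (N 1 1 - N 0 1 / N 0 0 * N 0 1) *
      (N 1 1 - N 0 1 / N 0 0 * N 0 1) = N 1 2 - N 0 1 / N 0 0 * N 0 2 := div_mul_cancel₀ _ h1'
  have hps : N 0 1 / N 0 0 * N 0 2 = N 0 2 / N 0 0 * N 0 1 := by ring
  simp only [gsUni, gsDiag, Fin.sum_univ_three]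
  -- With the quotients as new variables, subject to `hp`, `hs`, `hr` and `hps`, only polynomial
  -- identities remain.
  generalize (N 1 2 - N 0 1 / N 0 0 * N 0 2) / (N 1 1 - N 0 1 / N 0 0 * N 0 1) = r at *
  generalize N 0 1 / N 0 0 = p at *
  generalize N 0 2 / N 0 0 = s at *
  fin_cases i <;> fin_cases j <;> simp [e1, e2, e3] <;> grind

lemma gsMat_mul (N : Matrix (Fin 3) (Fin 3) ℝ) (hN : N.IsSymm) (h : ∀ i, 0 < gsDiag N i)
    (i j : Fin 3) :
    ∑ k, ∑ l, gsMat N i k * gsMat N j l * N k l = if i = j then 1 else 0 := by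
  have h1 : ∑ k, ∑ l, gsMat N i k * gsMat N j l * N k l =
      (Real.sqrt (gsDiag N i))⁻¹ * (Real.sqrt (gsDiag N j))⁻¹ *
        ∑ k, ∑ l, gsUni N i k * gsUni N j l * N k l := by
    simp only [Finset.mul_sum, gsMat, Matrix.of_apply]
    exact Finset.sum_congr rfl fun k _ => Finset.sum_congr rfl fun l _ => by ring
  rw [h1, gsUni_mul N hN (h 0) (h 1)]
  split_ifs with hij
  · subst hij
    rw [← mul_inv, Real.mul_self_sqrt (h i).le, inv_mul_cancel₀ (h i).ne']
  · simp

lemma gsDiag_one (i : Fin 3) : gsDiag 1 i = 1 := by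
  fin_cases i <;> simp [gsDiag]

lemma continuousAt_gsDiag (i : Fin 3) : ContinuousAt (fun N => gsDiag N i) 1 := by
  have hc : ∀ i j : Fin 3, ContinuousAt (fun N : Matrix (Fin 3) (Fin 3) ℝ => N i j) 1 :=
    fun i j => (continuous_id.matrix_elem i j).continuousAt
  have hp := (hc 0 1).div (hc 0 0) (by simp)
  have hn := (hc 1 1).sub (hp.mul (hc 0 1))
  have hr := ((hc 1 2).sub (hp.mul (hc 0 2))).div hn (by simp)
  fin_cases i
  · exact hc 0 0
  · exact hn
  · exact ((hc 2 2).sub (((hc 0 2).div (hc 0 0) (by simp)).mul (hc 0 2))).sub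
      (hr.mul ((hc 1 2).sub (hp.mul (hc 0 2))))

lemma tendsto_gsMat (i j : Fin 3) :
    Tendsto (fun N => gsMat N i j) (𝓝 1) (𝓝 ((1 : Matrix (Fin 3) (Fin 3) ℝ) i j)) := by
  have hc : ∀ i j : Fin 3, ContinuousAt (fun N : Matrix (Fin 3) (Fin 3) ℝ => N i j) 1 :=
    fun i j => (continuous_id.matrix_elem i j).continuousAt
  have hp := (hc 0 1).div (hc 0 0) (by simp)
  have hs := (hc 0 2).div (hc 0 0) (by simp)
  have hn := (hc 1 1).sub (hp.mul (hc 0 1))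
  have hr := ((hc 1 2).sub (hp.mul (hc 0 2))).div hn (by simp)
  have hU : ContinuousAt (fun N => gsUni N i j) 1 := by
    fin_cases i <;> fin_cases j
    · exact continuousAt_const
    · exact continuousAt_const
    · exact continuousAt_const
    · exact hp.neg
    · exact continuousAt_const
    · exact continuousAt_const
    · exact (hr.mul hp).sub hs
    · exact hr.neg
    · exact continuousAt_const
  have h1 : ContinuousAt (fun N => gsMat N i j) 1 := by
    simp only [gsMat, Matrix.of_apply]
    exact ((continuousAt_gsDiag i).sqrt.inv₀ (by simp [gsDiag_one])).mul hU
  have h2 : gsMat 1 i j = (1 : Matrix (Fin 3) (Fin 3) ℝ) i j := by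
    simp only [gsMat, Matrix.of_apply, gsDiag_one]
    fin_cases i <;> fin_cases j <;> simp [gsUni]
  rw [← h2]
  exact h1

lemma eventually_gsDiag_pos :
    ∀ᶠ N in 𝓝 (1 : Matrix (Fin 3) (Fin 3) ℝ), ∀ i, 0 < gsDiag N i := by
  rw [eventually_all]
  intro i
  exact (continuousAt_gsDiag i).eventually (lt_mem_nhds (by simp [gsDiag_one]))

variable {M : Type*} [TopologicalSpace M] [ChartedSpace (EuclideanHalfSpace 3) M]
variable [IsManifold (𝓡∂ 3) ∞ M] {e : OpenPartialHomeomorph M (EuclideanHalfSpace 3)}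

namespace AHStructure

variable (A : AHStructure M)

lemma inner_sum_smul (z : M) (a a' : Fin 3 → ℝ) (w : Fin 3 → TangentSpace (𝓡∂ 3) z) :
    A.gbar.inner z (∑ k, a k • w k) (∑ k, a' k • w k) =
      ∑ k, ∑ l, a k * a' l * A.gbar.inner z (w k) (w l) := by
  simp only [map_sum, map_smul, sum_apply, FunLike.coe_smul, Pi.smul_apply, smul_eq_mul,
    Finset.mul_sum]
  rw [Finset.sum_comm]
  exact Finset.sum_congr rfl fun k _ => Finset.sum_congr rfl fun l _ => by ring

/-- An orthonormal frame at a point is the limit of orthonormal frames at nearby points. -/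
lemma exists_orthonormal_frame_near (he : e ∈ IsManifold.maximalAtlas (𝓡∂ 3) ∞ M) {x : M}
    (hx : x ∈ e.source) (b : Fin 3 → TangentSpace (𝓡∂ 3) x)
    (hb : ∀ i j, A.gbar.inner x (b i) (b j) = if i = j then 1 else 0) :
    ∃ c : M → Fin 3 → Fin 3 → ℝ,
      (∀ i j, Tendsto (fun z => c z i j) (𝓝 x) (𝓝 (coordCovec e x j (b i)))) ∧
      ∀ᶠ z in 𝓝 x, ∀ i j, A.gbar.inner z (∑ k, c z i k • coordVec e z k)
        (∑ k, c z j k • coordVec e z k) = if i = j then 1 else 0 := by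
  -- The frame is continued with constant coordinate components. Its Gram matrix `N z` tends to `1`,
  -- so that near `x` Gram–Schmidt is defined and changes the frame very little.
  set c₀ : Fin 3 → Fin 3 → ℝ := fun i j => coordCovec e x j (b i) with hc₀
  set N : M → Matrix (Fin 3) (Fin 3) ℝ := fun z => Matrix.of fun i j =>
    A.gbar.inner z (∑ k, c₀ i k • coordVec e z k) (∑ k, c₀ j k • coordVec e z k) with hN
  have hNx : N x = 1 := by
    ext i j
    simp only [hN, Matrix.of_apply, hc₀]
    rw [← eq_sum_coordVec he hx, ← eq_sum_coordVec he hx, hb, Matrix.one_apply]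
  have hNe : ∀ z i j, N z i j = ∑ k, ∑ l, c₀ i k * c₀ j l *
      A.gbar.inner z (coordVec e z k) (coordVec e z l) := by
    intro z i j
    exact A.inner_sum_smul z _ _ _
  have hNt : Tendsto N (𝓝 x) (𝓝 1) := by
    rw [← hNx]
    refine tendsto_pi_nhds.2 fun i => tendsto_pi_nhds.2 fun j => ?_
    have h1 : Tendsto (fun z => ∑ k, ∑ l, c₀ i k * c₀ j l *
        A.gbar.inner z (coordVec e z k) (coordVec e z l)) (𝓝 x) (𝓝 (∑ k, ∑ l, c₀ i k * c₀ j l *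
        A.gbar.inner x (coordVec e x k) (coordVec e x l))) :=
      tendsto_finsetSum _ fun k _ => tendsto_finsetSum _ fun l _ =>
        (A.tendsto_gbar he hx k l).const_mul _
    rw [hNe x i j]
    exact h1.congr fun z => (hNe z i j).symm
  refine ⟨fun z i j => ∑ k, gsMat (N z) i k * c₀ k j, fun i j => ?_, ?_⟩
  · have h1 : Tendsto (fun z => ∑ k, gsMat (N z) i k * c₀ k j) (𝓝 x)
        (𝓝 (∑ k, (1 : Matrix (Fin 3) (Fin 3) ℝ) i k * c₀ k j)) :=
      tendsto_finsetSum _ fun k _ => ((tendsto_gsMat i k).comp hNt).mul_const _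
    simpa [Matrix.one_apply] using h1
  · filter_upwards [hNt.eventually eventually_gsDiag_pos] with z hz i j
    have hsym : (N z).IsSymm := by
      ext i j
      simp only [hN, Matrix.transpose_apply, Matrix.of_apply]
      exact A.gbar.symm z _ _
    rw [← gsMat_mul (N z) hsym hz i j]
    have h1 : ∀ i, ∑ k, (∑ k', gsMat (N z) i k' * c₀ k' k) • coordVec e z k =
        ∑ k', gsMat (N z) i k' • ∑ k, c₀ k' k • coordVec e z k := by
      intro i
      simp only [Finset.sum_smul, Finset.smul_sum, smul_smul]
      rw [Finset.sum_comm]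
    rw [h1, h1]
    rw [A.inner_sum_smul]
    rfl

end AHStructure

end AsympHyp
end

noncomputable section

set_option linter.unusedSectionVars false

namespace AsympHyp

open Set Filter

variable {M : Type*} [TopologicalSpace M] [ChartedSpace (EuclideanHalfSpace 3) M]

/-! ### Components of sums and multiples -/

section Comp

variable {E : TensorType} (e : OpenPartialHomeomorph M (EuclideanHalfSpace 3))

lemma comp_sum {ι : Type*} (s : Finset ι) (u : ι → TensorField M E) (x : M)
    (K : Idx E.cov E.contra) :
    comp e (fun x => ∑ i ∈ s, u i x) x K = ∑ i ∈ s, comp e (u i) x K := by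
  simp only [comp, sum_apply]

lemma comp_congr {u v : TensorField M E} {x : M} (h : u x = v x) (K : Idx E.cov E.contra) :
    comp e u x K = comp e v x K := by
  simp only [comp, h]

end Comp

variable [IsManifold (𝓡∂ 3) ∞ M] {e : OpenPartialHomeomorph M (EuclideanHalfSpace 3)}

namespace AHStructure

variable (A : AHStructure M) {E : TensorType}

/-! ### The fibre condition -/

section Fiber

variable {A} {x : M} {T T' : CTensor E.cov E.contra (TangentSpace (𝓡∂ 3) x)}

lemma MemFiber.add (h : A.MemFiber E x T) (h' : A.MemFiber E x T') : A.MemFiber E x (T + T') := by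
  intro b hb
  exact ⟨by simpa using! E.fiber.add_mem (h b hb).1 (h' b hb).1,
    by simpa using! E.fiber.add_mem (h b hb).2 (h' b hb).2⟩

lemma MemFiber.smul (c : ℂ) (h : A.MemFiber E x T) : A.MemFiber E x (c • T) := by
  intro b hb
  have h1 := E.fiber.sub_mem (E.fiber.smul_mem c.re (h b hb).1) (E.fiber.smul_mem c.im (h b hb).2)
  have h2 := E.fiber.add_mem (E.fiber.smul_mem c.re (h b hb).2) (E.fiber.smul_mem c.im (h b hb).1)
  refine ⟨?_, ?_⟩
  · convert h1 using 1
    funext K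
    exact Complex.mul_re _ _
  · convert h2 using 1
    funext K
    exact Complex.mul_im _ _

lemma memFiber_zero : A.MemFiber E x 0 := by
  intro b hb
  exact ⟨E.fiber.zero_mem, E.fiber.zero_mem⟩

end Fiber

/-! ### Operations on smooth sections -/

section Sections

variable {A} {S : Set M} {u v : TensorField M E}

lemma IsSmoothSection.add (hu : A.IsSmoothSection E u S) (hv : A.IsSmoothSection E v S) :
    A.IsSmoothSection E (fun x => u x + v x) S :=
  ⟨fun x hx => (hu.mem x hx).add (hv.mem x hx), fun e he K =>
    (hu.smooth e he K).add (hv.smooth e he K)⟩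

lemma isSmoothSection_zero : A.IsSmoothSection E (0 : TensorField M E) S :=
  ⟨fun _ _ => memFiber_zero, fun _ _ _ => contDiffOn_const (c := (0 : ℂ))⟩

lemma IsSmoothSection.fsmul (hu : A.IsSmoothSection E u S) {f : M → ℂ}
    (hf : ∀ e ∈ IsManifold.maximalAtlas (𝓡∂ 3) ∞ M,
      ContDiffOn ℝ ∞ (fun y => f ((e.extend (𝓡∂ 3)).symm y))
        ((e.extend (𝓡∂ 3)).target ∩ (e.extend (𝓡∂ 3)).symm ⁻¹' S)) :
    A.IsSmoothSection E (fun x => f x • u x) S :=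
  ⟨fun x hx => (hu.mem x hx).smul _, fun e he K => (hf e he).mul (hu.smooth e he K)⟩

lemma IsSmoothSection.sum {ι : Type*} {s : Finset ι} {u : ι → TensorField M E}
    (h : ∀ i ∈ s, A.IsSmoothSection E (u i) S) :
    A.IsSmoothSection E (fun x => ∑ i ∈ s, u i x) S := by
  classical
  induction s using Finset.induction_on with
  | empty => simpa using! isSmoothSection_zero
  | insert a s ha ih =>
    simp only [Finset.sum_insert ha]
    exact (h a (Finset.mem_insert_self _ _)).add
      (ih fun i hi => h i (Finset.mem_insert_of_mem hi))

lemma IsSmoothSection.mono {S' : Set M} (hu : A.IsSmoothSection E u S) (h : S' ⊆ S) :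
    A.IsSmoothSection E u S' :=
  ⟨fun x hx => hu.mem x (h hx), fun e he K => (hu.smooth e he K).mono
    (inter_subset_inter_right _ (preimage_mono h))⟩

lemma IsSmoothSection.congr {S : Set M} (hu : A.IsSmoothSection E u S)
    (h : ∀ x ∈ S, v x = u x) : A.IsSmoothSection E v S :=
  ⟨fun x hx => by rw [h x hx]; exact hu.mem x hx, fun e he K =>
    (hu.smooth e he K).congr fun y hy => comp_congr e (h _ hy.2) K⟩

lemma IsSmoothSection.sub (hu : A.IsSmoothSection E u S) (hv : A.IsSmoothSection E v S) :
    A.IsSmoothSection E (fun x => u x - v x) S := by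
  have h1 := hu.add (hv.fsmul (f := fun _ => -1) fun e _ => contDiffOn_const)
  refine h1.congr fun x _ => ?_
  rw [show (-1 : ℂ) • v x = -v x from neg_one_smul ℂ (v x), sub_eq_add_neg]

lemma IsSmoothSection.contDiffOn (hu : A.IsSmoothSection E u univ)
    (he : e ∈ IsManifold.maximalAtlas (𝓡∂ 3) ∞ M) (K : Idx E.cov E.contra) :
    ContDiffOn ℝ ∞ (localComp e u K) (e.extend (𝓡∂ 3)).target := by
  have := hu.smooth e he K
  rwa [preimage_univ, inter_univ] at this

lemma IsSmoothSection.contDiffOn_interior (hu : A.IsSmoothSection E u ((𝓡∂ 3).interior M))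
    (he : e ∈ IsManifold.maximalAtlas (𝓡∂ 3) ∞ M) (K : Idx E.cov E.contra) :
    ContDiffOn ℝ ∞ (localComp e u K) ((e.extend (𝓡∂ 3)).target ∩ Pos) := by
  have := hu.smooth e he K
  rwa [target_inter_preimage_interior he] at this

end Sections

/-! ### Extension of sections to the boundary -/

/-- A section over the interior extends to a smooth section if its components in every chart
extend to functions of class `C^n` for every `n`. -/
theorem extendsSmoothly_of_localComp {u : TensorField M E}
    (hmem : ∀ x ∈ (𝓡∂ 3).interior M, A.MemFiber E x (u x))
    (h : ∀ e ∈ IsManifold.maximalAtlas (𝓡∂ 3) ∞ M, ∀ K, ∀ n : ℕ, ∃ f : E3 → ℂ,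
      ContDiffOn ℝ n f (e.extend (𝓡∂ 3)).target ∧
        ∀ y ∈ (e.extend (𝓡∂ 3)).target, 0 < y 0 → f y = localComp e u K y) :
    A.ExtendsSmoothly E u := by
  classical
  have hch : ∀ x : M, chartAt (EuclideanHalfSpace 3) x ∈ IsManifold.maximalAtlas (𝓡∂ 3) ∞ M :=
    fun x => IsManifold.chart_mem_maximalAtlas x
  have hsrc : ∀ x : M, x ∈ (chartAt (EuclideanHalfSpace 3) x).source := mem_chart_source _
  -- Continuity in one chart around each point already fixes the boundary values; extensions of
  -- higher regularity are compared with them at the end.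
  choose f hf hfu using fun (x : M) (K : Idx E.cov E.contra) => h _ (hch x) K 0
  set c : (x : M) → Idx E.cov E.contra → ℂ :=
    fun x K => f x K ((chartAt (EuclideanHalfSpace 3) x).extend (𝓡∂ 3) x) with hc
  set T : TensorField M E := fun x => ofComp (chartAt (EuclideanHalfSpace 3) x) x (c x) with hT
  have hlim0 : ∀ x K, Tendsto (fun z => comp (chartAt (EuclideanHalfSpace 3) x) u z K)
      (𝓝[(𝓡∂ 3).interior M] x) (𝓝 (c x K)) := by
    intro x K
    have h1 : Tendsto (f x K) (𝓝[((chartAt (EuclideanHalfSpace 3) x).extend (𝓡∂ 3)).target ∩ Pos]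
        ((chartAt (EuclideanHalfSpace 3) x).extend (𝓡∂ 3) x)) (𝓝 (c x K)) :=
      ((hf x K).continuousOn _ (extend_mem (hsrc x))).tendsto.mono_left
        (nhdsWithin_mono _ inter_subset_left)
    refine (h1.comp (map_extend_nhdsWithin_interior (hch x) (hsrc x))).congr' ?_
    filter_upwards [self_mem_nhdsWithin,
      mem_nhdsWithin_of_mem_nhds ((chartAt (EuclideanHalfSpace 3) x).open_source.mem_nhds (hsrc x))]
      with z h1 h2
    rw [Function.comp_apply, hfu x K _ (extend_mem h2) ((mem_interior_iff (hch x) h2).1 h1)]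
    unfold localComp
    rw [extend_left_inv h2]
  -- The components of `u` and of `T` change by the same matrices, continuous up to the boundary, so
  -- the limit found in the preferred chart at `x` gives the limit in every chart.
  have hlim : ∀ e ∈ IsManifold.maximalAtlas (𝓡∂ 3) ∞ M, ∀ x ∈ e.source, ∀ K,
      Tendsto (fun z => comp e u z K) (𝓝[(𝓡∂ 3).interior M] x) (𝓝 (comp e T x K)) := by
    intro e he x hx K
    have h1 : comp e T x K = ∑ K' : Idx E.cov E.contra,
        (((∏ a, coordCovec (chartAt (EuclideanHalfSpace 3) x) x (K'.1 a) (coordVec e x (K.1 a))) *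
          (∏ b, coordCovec e x (K.2 b) (coordVec (chartAt (EuclideanHalfSpace 3) x) x (K'.2 b))) :
            ℝ) : ℂ) * c x K' := by
      simp only [comp, hT, ofComp_apply]
    rw [h1]
    refine Tendsto.congr' (f₁ := fun z => ∑ K' : Idx E.cov E.contra,
        (((∏ a, coordCovec (chartAt (EuclideanHalfSpace 3) x) z (K'.1 a) (coordVec e z (K.1 a))) *
          (∏ b, coordCovec e z (K.2 b) (coordVec (chartAt (EuclideanHalfSpace 3) x) z (K'.2 b))) :
            ℝ) : ℂ) * comp (chartAt (EuclideanHalfSpace 3) x) u z K') ?_ ?_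
    · filter_upwards [mem_nhdsWithin_of_mem_nhds
        ((chartAt (EuclideanHalfSpace 3) x).open_source.mem_nhds (hsrc x))] with z hz
      exact (comp_eq_sum (hch x) hz u K).symm
    · refine tendsto_finsetSum _ fun K' _ => Tendsto.mul ?_ (hlim0 x K')
      refine (Complex.continuous_ofReal.tendsto _).comp (Tendsto.mul ?_ ?_)
      · exact tendsto_finsetProd _ fun a _ =>
          (tendsto_transition he (hch x) hx (hsrc x) _ _).mono_left nhdsWithin_le_nhds
      · exact tendsto_finsetProd _ fun b _ =>
          (tendsto_transition (hch x) he (hsrc x) hx _ _).mono_left nhdsWithin_le_nhds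
  set v : TensorField M E := fun x => if x ∈ (𝓡∂ 3).interior M then u x else T x with hv
  have hvu : ∀ x ∈ (𝓡∂ 3).interior M, v x = u x := fun x hx => if_pos hx
  have hvT : ∀ x ∉ (𝓡∂ 3).interior M, v x = T x := fun x hx => if_neg hx
  refine ⟨v, ⟨?_, ?_⟩, hvu⟩
  · intro x _
    by_cases hx : x ∈ (𝓡∂ 3).interior M
    · rw [hvu x hx]; exact hmem x hx
    rw [hvT x hx]
    intro b hb
    -- The components of `T x` in the frame `b` are limits of components of `u` in orthonormal
    -- frames at interior points, and the model fibre is closed.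
    obtain ⟨s, hs, hs1⟩ := A.exists_orthonormal_frame_near (hch x) (hsrc x) b hb
    set e := chartAt (EuclideanHalfSpace 3) x with he
    have hce : e ∈ IsManifold.maximalAtlas (𝓡∂ 3) ∞ M := hch x
    have hse : x ∈ e.source := hsrc x
    have hnb : (𝓝[(𝓡∂ 3).interior M] x).NeBot := interior_neBot x
    set fr : (z : M) → Fin 3 → TangentSpace (𝓡∂ 3) z :=
      fun z i => ∑ k, s z i k • coordVec e z k with hfr
    have hnear : ∀ᶠ z in 𝓝[(𝓡∂ 3).interior M] x, z ∈ e.source :=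
      mem_nhdsWithin_of_mem_nhds (e.open_source.mem_nhds (hsrc x))
    have hcomp : ∀ K : Idx E.cov E.contra, Tendsto
        (fun z => u z (fun a => fr z (K.1 a)) (fun c => (A.gbar.inner z (fr z (K.2 c))).toLinearMap))
        (𝓝[(𝓡∂ 3).interior M] x)
        (𝓝 (T x (fun a => b (K.1 a)) (fun c => (A.gbar.inner x (b (K.2 c))).toLinearMap))) := by
      intro K
      have h1 : T x (fun a => b (K.1 a)) (fun c => (A.gbar.inner x (b (K.2 c))).toLinearMap) =
          ∑ K' : Idx E.cov E.contra,
          (((∏ a, coordCovec e x (K'.1 a) (b (K.1 a))) *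
          (∏ c, A.gbar.inner x (b (K.2 c)) (coordVec e x (K'.2 c))) : ℝ) : ℂ) * c x K' := by
        simp only [hT, ofComp_apply]
        rfl
      rw [h1]
      have h2 : Tendsto (fun z => ∑ K' : Idx E.cov E.contra,
          (((∏ a, s z (K.1 a) (K'.1 a)) * (∏ c, ∑ k, s z (K.2 c) k *
            A.gbar.inner z (coordVec e z k) (coordVec e z (K'.2 c))) : ℝ) : ℂ) * comp e u z K')
          (𝓝[(𝓡∂ 3).interior M] x) (𝓝 (∑ K' : Idx E.cov E.contra,
          (((∏ a, coordCovec e x (K'.1 a) (b (K.1 a))) *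
            (∏ c, ∑ k, coordCovec e x k (b (K.2 c)) *
            A.gbar.inner x (coordVec e x k) (coordVec e x (K'.2 c))) : ℝ) : ℂ) * c x K')) := by
        refine tendsto_finsetSum _ fun K' _ => Tendsto.mul ?_ (hlim0 x K')
        refine (Complex.continuous_ofReal.tendsto _).comp (Tendsto.mul ?_ ?_)
        · exact tendsto_finsetProd _ fun a _ => (hs _ _).mono_left nhdsWithin_le_nhds
        · exact tendsto_finsetProd _ fun c _ => tendsto_finsetSum _ fun k _ =>
            ((hs _ _).mul (A.tendsto_gbar hce hse _ _)).mono_left nhdsWithin_le_nhds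
      have h3 : ∀ i l, A.gbar.inner x (b i) (coordVec e x l) = ∑ k, coordCovec e x k (b i) *
          A.gbar.inner x (coordVec e x k) (coordVec e x l) := by
        intro i l
        conv_lhs => rw [eq_sum_coordVec hce hse (b i)]
        simp only [map_sum, map_smul, sum_apply, FunLike.coe_smul, Pi.smul_apply, smul_eq_mul]
      simp only [h3]
      refine h2.congr' ?_
      filter_upwards [hnear] with z hz
      rw [ctensor_apply_eq_sum hce hz (u z)]
      refine Finset.sum_congr rfl fun K' _ => ?_
      congr 2
      congr 1
      · refine Finset.prod_congr rfl fun a _ => ?_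
        simp only [hfr, map_sum, map_smul, coordCovec_coordVec hce hz, smul_eq_mul]
        simp
      · refine Finset.prod_congr rfl fun c _ => ?_
        simp only [hfr, ContinuousLinearMap.coe_coe, map_sum, map_smul, sum_apply,
          FunLike.coe_smul, Pi.smul_apply, smul_eq_mul]
    have hmem' : ∀ᶠ z in 𝓝[(𝓡∂ 3).interior M] x, A.MemFiber E z (u z) := by
      filter_upwards [self_mem_nhdsWithin] with z hz using hmem z hz
    have hcl : IsClosed (E.fiber : Set (Idx E.cov E.contra → ℝ)) :=
      Submodule.closed_of_finiteDimensional _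
    constructor
    · refine hcl.mem_of_tendsto (tendsto_pi_nhds.2 fun K =>
        (Complex.continuous_re.tendsto _).comp (hcomp K)) ?_
      filter_upwards [hmem', hs1.filter_mono nhdsWithin_le_nhds] with z h1 h2
      exact (h1 (fr z) h2).1
    · refine hcl.mem_of_tendsto (tendsto_pi_nhds.2 fun K =>
        (Complex.continuous_im.tendsto _).comp (hcomp K)) ?_
      filter_upwards [hmem', hs1.filter_mono nhdsWithin_le_nhds] with z h1 h2
      exact (h1 (fr z) h2).2
  · intro e he K
    rw [preimage_univ, inter_univ]
    refine contDiffOn_infty.2 fun n => ?_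
    -- The function `g` depends on `n`. At a boundary point it is the limit of the components of `u`
    -- from the interior, hence equals the component of `v`, which does not depend on `n`.
    obtain ⟨g, hg, hgu⟩ := h e he K n
    refine hg.congr fun y hy => ?_
    rcases (show 0 ≤ y 0 from (relOpen_target e).subset hy).eq_or_lt with h0 | h0
    · have hb : (e.extend (𝓡∂ 3)).symm y ∉ (𝓡∂ 3).interior M := fun hi => by
        have := (symm_mem_interior_iff he hy).1 hi
        linarith
      have hnb := (relOpen_target e).neBot hy
      have h1 : Tendsto g (𝓝[(e.extend (𝓡∂ 3)).target ∩ Pos] y) (𝓝 (g y)) :=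
        (hg.continuousOn y hy).tendsto.mono_left (nhdsWithin_mono _ inter_subset_left)
      have h2 := (hlim e he _ (extend_symm_mem hy) K).comp (map_symm_nhdsWithin he hy)
      have h3 : localComp e v K y = comp e T ((e.extend (𝓡∂ 3)).symm y) K :=
        comp_congr e (hvT _ hb) K
      rw [h3]
      refine tendsto_nhds_unique_of_eventuallyEq h2 h1 ?_
      filter_upwards [self_mem_nhdsWithin] with z hz using (hgu z hz.1 hz.2).symm
    · rw [hgu y hy h0]
      exact comp_congr e (hvu _ ((symm_mem_interior_iff he hy).2 h0)) K

end AHStructure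

end AsympHyp
end

noncomputable section

set_option linter.unusedSectionVars false

namespace AsympHyp

open Set Filter

variable {M : Type*} [TopologicalSpace M] [ChartedSpace (EuclideanHalfSpace 3) M]
variable [IsManifold (𝓡∂ 3) ∞ M] {e : OpenPartialHomeomorph M (EuclideanHalfSpace 3)}

namespace AHStructure

variable (A : AHStructure M) {E : TensorType}

/-! ### The defining function in coordinates -/

/-- The defining function as a function of the coordinates. -/
def rhoLoc (e : OpenPartialHomeomorph M (EuclideanHalfSpace 3)) (y : E3) : ℝ :=
  A.ρ ((e.extend (𝓡∂ 3)).symm y)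

lemma contDiffOn_rhoLoc (he : e ∈ IsManifold.maximalAtlas (𝓡∂ 3) ∞ M) :
    ContDiffOn ℝ ∞ (A.rhoLoc e) (e.extend (𝓡∂ 3)).target := by
  rw [← contMDiffOn_iff_contDiffOn]
  exact A.ρ_smooth.comp_contMDiffOn (contMDiffOn_extend_symm_target he)

lemma rhoLoc_pos (he : e ∈ IsManifold.maximalAtlas (𝓡∂ 3) ∞ M) {y : E3}
    (hy : y ∈ (e.extend (𝓡∂ 3)).target) (h0 : 0 < y 0) : 0 < A.rhoLoc e y :=
  A.ρ_pos _ ((symm_mem_interior_iff he hy).2 h0)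

lemma rhoLoc_zero (he : e ∈ IsManifold.maximalAtlas (𝓡∂ 3) ∞ M) {y : E3}
    (hy : y ∈ (e.extend (𝓡∂ 3)).target) (h0 : y 0 = 0) : A.rhoLoc e y = 0 :=
  A.ρ_zero _ (symm_mem_boundary he hy h0)

lemma mfderiv_rho_ne_zero {x : M} (hx : x ∈ (𝓡∂ 3).boundary M) :
    mfderiv (𝓡∂ 3) 𝓘(ℝ) A.ρ x ≠ 0 := by
  obtain ⟨ν, h1, h2⟩ := A.unit_gradient x hx
  intro h
  have h3 : (mfderiv (𝓡∂ 3) 𝓘(ℝ) A.ρ x ν : ℝ) = 1 := (h1 ν).symm.trans h2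
  rw [h] at h3
  exact zero_ne_one (α := ℝ) h3

/-- The defining function is the product of the normal coordinate and a smooth function without
zeros. -/
lemma exists_rhoLoc_eq (he : e ∈ IsManifold.maximalAtlas (𝓡∂ 3) ∞ M) :
    ∃ b : E3 → ℝ, ContDiffOn ℝ ∞ b (e.extend (𝓡∂ 3)).target ∧
      ∀ y ∈ (e.extend (𝓡∂ 3)).target, A.rhoLoc e y = y 0 * b y ∧ b y ≠ 0 := by
  obtain ⟨b, hb, hb1⟩ := (relOpen_target e).exists_eq_coord_mul (A.contDiffOn_rhoLoc he)
    fun y hy h0 => A.rhoLoc_zero he hy h0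
  refine ⟨b, hb, fun y hy => ⟨hb1 y hy, fun hby => ?_⟩⟩
  rcases (show 0 ≤ y 0 from (relOpen_target e).subset hy).eq_or_lt with h0 | h0
  -- If `b` vanished at a boundary point, the product of the normal coordinate and `b` would have
  -- zero derivative there, contrary to `|dρ| = 1`.
  · have hd : HasFDerivWithinAt (A.rhoLoc e) (0 : E3 →L[ℝ] ℝ) (e.extend (𝓡∂ 3)).target y := by
      have h1 : HasFDerivWithinAt b (fderivWithin ℝ b (e.extend (𝓡∂ 3)).target y)
          (e.extend (𝓡∂ 3)).target y := (hb.differentiableOn (by simp) y hy).hasFDerivWithinAt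
      have h2 := ((EuclideanSpace.proj (0 : Fin 3) : E3 →L[ℝ] ℝ).hasFDerivWithinAt
        (s := (e.extend (𝓡∂ 3)).target) (x := y)).mul h1
      refine (h2.congr (fun z hz => hb1 z hz) (hb1 y hy)).congr_fderiv ?_
      ext v
      simp [hby, ← h0]
    have hx := symm_mem_boundary he hy h0.symm
    set x := (e.extend (𝓡∂ 3)).symm y with hxdef
    have hxs : x ∈ e.source := extend_symm_mem hy
    have hxy : e.extend (𝓡∂ 3) x = y := (e.extend (𝓡∂ 3)).right_inv hy
    rw [← hxy] at hd
    have h3 := HasMFDerivWithinAt.comp x hd.hasMFDerivWithinAt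
      (hasMFDerivAt_extend he hxs).hasMFDerivWithinAt (s := e.source)
      (fun z hz => extend_mem hz)
    have h4 : HasMFDerivWithinAt (𝓡∂ 3) 𝓘(ℝ) A.ρ e.source x
        (((0 : E3 →L[ℝ] ℝ)).comp (dExtend e x)) := by
      refine h3.congr_of_eventuallyEq ?_ ?_
      · filter_upwards [self_mem_nhdsWithin] with z hz
        simp only [Function.comp_apply, rhoLoc]
        rw [extend_left_inv hz]
      · simp only [Function.comp_apply, rhoLoc]
        rw [extend_left_inv hxs]
    have h5 := (h4.hasMFDerivAt (e.open_source.mem_nhds hxs)).mfderiv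
    refine A.mfderiv_rho_ne_zero hx ?_
    rw [h5, ContinuousLinearMap.zero_comp]
    rfl
  · have h1 := A.rhoLoc_pos he hy h0
    rw [hb1 y hy, hby, smul_zero] at h1
    exact lt_irrefl _ h1

lemma exists_eq_rhoLoc_mul (he : e ∈ IsManifold.maximalAtlas (𝓡∂ 3) ∞ M) {f : E3 → ℂ}
    (hf : ContDiffOn ℝ ∞ f (e.extend (𝓡∂ 3)).target)
    (h0 : ∀ y ∈ (e.extend (𝓡∂ 3)).target, y 0 = 0 → f y = 0) :
    ∃ g : E3 → ℂ, ContDiffOn ℝ ∞ g (e.extend (𝓡∂ 3)).target ∧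
      ∀ y ∈ (e.extend (𝓡∂ 3)).target, f y = A.rhoLoc e y * g y := by
  obtain ⟨b, hb, hb1⟩ := A.exists_rhoLoc_eq he
  obtain ⟨g, hg, hg1⟩ := (relOpen_target e).exists_eq_coord_mul hf h0
  refine ⟨fun y => (b y : ℂ)⁻¹ * g y, ?_, fun y hy => ?_⟩
  · refine ContDiffOn.mul (ContDiffOn.inv ?_ fun y hy => ?_) hg
    · exact Complex.ofRealCLM.contDiff.comp_contDiffOn hb
    · exact_mod_cast (hb1 y hy).2
  · have h1 : (b y : ℂ) ≠ 0 := by exact_mod_cast (hb1 y hy).2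
    rw [hg1 y hy, (hb1 y hy).1]
    push_cast
    rw [Complex.real_smul]
    field_simp

/-- A smooth section vanishing on the boundary is divisible by the defining function. -/
lemma exists_eq_rho_smul {U : TensorField M E} (hU : A.IsSmoothSection E U univ)
    (h0 : ∀ e ∈ IsManifold.maximalAtlas (𝓡∂ 3) ∞ M, ∀ x ∈ e.source, x ∈ (𝓡∂ 3).boundary M →
      ∀ K, comp e U x K = 0) :
    ∃ V : TensorField M E, A.IsSmoothSection E V univ ∧
      ∀ x ∈ (𝓡∂ 3).interior M, U x = (A.ρ x : ℂ) • V x := by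
  obtain ⟨V, hV, hV1⟩ := A.extendsSmoothly_of_localComp (E := E)
    (u := fun x => (A.ρ x : ℂ)⁻¹ • U x) (fun x _ => (hU.mem x (mem_univ x)).smul _)
    (by
      intro e he K n
      obtain ⟨g, hg, hg1⟩ := A.exists_eq_rhoLoc_mul he (hU.contDiffOn he K) (fun y hy hy0 =>
        h0 e he _ (extend_symm_mem hy) (symm_mem_boundary he hy hy0) K)
      refine ⟨g, contDiffOn_infty.1 hg n, fun y hy hy0 => ?_⟩
      have h1 : (A.rhoLoc e y : ℂ) ≠ 0 := by exact_mod_cast (A.rhoLoc_pos he hy hy0).ne'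
      change g y = (A.rhoLoc e y : ℂ)⁻¹ * localComp e U K y
      rw [hg1 y hy, inv_mul_cancel_left₀ h1])
  refine ⟨V, hV, fun x hx => ?_⟩
  have h1 : (A.ρ x : ℂ) ≠ 0 := by exact_mod_cast (A.ρ_pos x hx).ne'
  rw [hV1 x hx, smul_smul, mul_inv_cancel₀ h1, one_smul]

lemma tendsto_rhoLoc (he : e ∈ IsManifold.maximalAtlas (𝓡∂ 3) ∞ M) {y : E3}
    (hy : y ∈ (e.extend (𝓡∂ 3)).target) (h0 : y 0 = 0) :
    Tendsto (A.rhoLoc e) (𝓝[(e.extend (𝓡∂ 3)).target ∩ Pos] y) (𝓝[>] 0) := by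
  refine tendsto_nhdsWithin_iff.2 ⟨?_, ?_⟩
  · rw [← A.rhoLoc_zero he hy h0]
    exact ((A.contDiffOn_rhoLoc he).continuousOn y hy).tendsto.mono_left
      (nhdsWithin_mono _ inter_subset_left)
  · filter_upwards [self_mem_nhdsWithin] with z hz using A.rhoLoc_pos he hz.1 hz.2

/-- By the intermediate value theorem on short inner normal segments, `ρ` takes all small positive
values arbitrarily close to `y`. -/
lemma nhdsGT_le_map_rhoLoc (he : e ∈ IsManifold.maximalAtlas (𝓡∂ 3) ∞ M) {y : E3}
    (hy : y ∈ (e.extend (𝓡∂ 3)).target) (h0 : y 0 = 0) :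
    𝓝[>] 0 ≤ map (A.rhoLoc e) (𝓝[(e.extend (𝓡∂ 3)).target ∩ Pos] y) := by
  intro s hs
  rw [mem_map, (relOpen_target e).nhdsWithin_inter_pos hy] at hs
  have hev := (tendsto_inner_normal ((relOpen_target e).subset hy)).eventually hs
  have hΩ : ∀ᶠ t : ℝ in 𝓝[>] 0, y + t • e0 ∈ (e.extend (𝓡∂ 3)).target := by
    have := self_mem_nhdsWithin (a := y) (s := (e.extend (𝓡∂ 3)).target ∩ Pos)
    rw [(relOpen_target e).nhdsWithin_inter_pos hy] at this
    exact ((tendsto_inner_normal ((relOpen_target e).subset hy)).eventually this).mono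
      fun t ht => ht.1
  obtain ⟨a, ha, hsub⟩ := (mem_nhdsGT_iff_exists_Ioc_subset).1 (hev.and hΩ)
  have ha' : (0 : ℝ) < a := ha
  have hmem : ∀ t ∈ Icc 0 a, y + t • e0 ∈ (e.extend (𝓡∂ 3)).target := by
    intro t ht
    rcases ht.1.eq_or_lt with rfl | h
    · simpa using hy
    · exact (hsub ⟨h, ht.2⟩).2
  have hc : ContinuousOn (fun t : ℝ => A.rhoLoc e (y + t • e0)) (Icc 0 a) :=
    (A.contDiffOn_rhoLoc he).continuousOn.comp (by fun_prop) hmem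
  have hivt := intermediate_value_Ioc ha'.le hc
  simp only [zero_smul, add_zero, A.rhoLoc_zero he hy h0] at hivt
  have hpos : 0 < A.rhoLoc e (y + a • e0) :=
    A.rhoLoc_pos he (hmem a ⟨ha'.le, le_rfl⟩) (by rw [add_smul_e0_zero, h0]; linarith)
  refine mem_of_superset (Ioc_mem_nhdsGT hpos) fun r hr => ?_
  obtain ⟨t, ht, rfl⟩ := hivt hr
  exact (hsub ht).1

end AHStructure

end AsympHyp
end

noncomputable section

set_option linter.unusedSectionVars false

namespace AsympHyp

open Set Filter

/-! ### Iterated partial derivatives -/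

section PartialDeriv

variable {F : Type*} [NormedAddCommGroup F] [NormedSpace ℝ F]

/-- The iterated partial derivative with multi-index `α`. -/
def pderiv {j : ℕ} (α : Fin j → Fin 3) (f : E3 → F) (y : E3) : F :=
  iteratedFDeriv ℝ j f y (fun a => EuclideanSpace.single (α a) (1 : ℝ))

lemma pderiv_zero (α : Fin 0 → Fin 3) (f : E3 → F) (y : E3) : pderiv α f y = f y := rfl

lemma pderiv_succ {j : ℕ} (α : Fin (j + 1) → Fin 3) {f : E3 → F} {y : E3}
    (hf : ContDiffAt ℝ ∞ f y) :
    pderiv α f y = fderiv ℝ (pderiv (Fin.tail α) f) y (EuclideanSpace.single (α 0) 1) := by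
  have h1 : DifferentiableAt ℝ (iteratedFDeriv ℝ j f) y :=
    hf.differentiableAt_iteratedFDeriv (by exact_mod_cast ENat.natCast_lt_top j)
  have h2 := (ContinuousMultilinearMap.apply ℝ (fun _ : Fin j => E3) F
    (fun a : Fin j => EuclideanSpace.single (Fin.tail α a) (1 : ℝ))).hasFDerivAt.comp y
      h1.hasFDerivAt
  unfold pderiv
  rw [iteratedFDeriv_succ_apply_left]
  exact (congrArg (fun L => L (EuclideanSpace.single (α 0) (1 : ℝ))) h2.fderiv).symm

lemma pderiv_congr {j : ℕ} (α : Fin j → Fin 3) {f g : E3 → F} {y : E3} (h : f =ᶠ[𝓝 y] g) :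
    pderiv α f y = pderiv α g y := by
  unfold pderiv
  rw [h.iteratedFDeriv ℝ j |>.eq_of_nhds]

/-- Partial derivatives under dilation. -/
lemma pderiv_dilation {j : ℕ} (α : Fin j → Fin 3) {f g : E3 → F} {y : E3} {a c : ℝ} (ha : 0 < a)
    (hf : ContDiffAt ℝ ∞ f y) (h : g =ᶠ[𝓝 (a • y)] fun w => c • f (a⁻¹ • w)) :
    pderiv α g (a • y) = (c * a⁻¹ ^ j) • pderiv α f y := by
  have hy : a⁻¹ • a • y = y := inv_smul_smul₀ ha.ne' y
  let L : E3 ≃L[ℝ] E3 := ContinuousLinearEquiv.smulLeft (Units.mk0 a⁻¹ (inv_pos.2 ha).ne')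
  have hL : ∀ w, L w = a⁻¹ • w := fun w => rfl
  have h2 : ContDiffAt ℝ j (f ∘ L) (a • y) := by
    refine ContDiffAt.comp _ ?_ L.contDiff.contDiffAt
    rw [hL, hy]
    exact hf.of_le (by exact_mod_cast le_top)
  rw [pderiv_congr α h]
  unfold pderiv
  have h3 := iteratedFDeriv_const_smul_apply (𝕜 := ℝ) (a := c) h2
  have h4 := L.iteratedFDerivWithin_comp_right f uniqueDiffOn_univ (mem_univ (L (a • y))) j
  simp only [preimage_univ, iteratedFDerivWithin_univ] at h4
  have h5 : (fun w => c • f (a⁻¹ • w)) = c • (f ∘ L) := rfl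
  rw [h5, h3, h4, hL, hy]
  simp only [smul_apply, ContinuousMultilinearMap.compContinuousLinearMap_apply,
    ContinuousLinearEquiv.coe_coe, hL]
  rw [ContinuousMultilinearMap.map_smul_univ]
  simp [smul_smul]

end PartialDeriv

namespace RelOpen

variable {Ω : Set E3}

lemma contDiffAt (hΩ : RelOpen Ω) {F : Type*} [NormedAddCommGroup F] [NormedSpace ℝ F]
    {f : E3 → F} (hf : ContDiffOn ℝ ∞ f (Ω ∩ Pos)) {y : E3} (hy : y ∈ Ω ∩ Pos) :
    ContDiffAt ℝ ∞ f y :=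
  hf.contDiffAt (hΩ.isOpen_inter_pos.mem_nhds hy)

lemma hasFDerivAt_of_contDiffOn (hΩ : RelOpen Ω) {F : Type*} [NormedAddCommGroup F]
    [NormedSpace ℝ F] {f : E3 → F} (hf : ContDiffOn ℝ ∞ f Ω) {y : E3} (hy : y ∈ Ω ∩ Pos) :
    HasFDerivAt f (fderivWithin ℝ f Ω y) y :=
  ((hf.differentiableOn (by simp) y hy.1).hasFDerivWithinAt).hasFDerivAt
    (mem_of_superset (hΩ.isOpen_inter_pos.mem_nhds hy) inter_subset_left)

lemma contDiffOn_fderivWithin_apply (hΩ : RelOpen Ω) {F : Type*} [NormedAddCommGroup F]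
    [NormedSpace ℝ F] {f : E3 → F} (hf : ContDiffOn ℝ ∞ f Ω) (v : E3) :
    ContDiffOn ℝ ∞ (fun y => fderivWithin ℝ f Ω y v) Ω :=
  (hf.fderivWithin hΩ.uniqueDiffOn (m := ∞) (by simp)).clm_apply contDiffOn_const

/-- Smooth functions on a relatively open set have partial derivatives that extend smoothly. -/
lemma exists_pderiv_eq (hΩ : RelOpen Ω) {F : Type*} [NormedAddCommGroup F]
    [NormedSpace ℝ F] {f : E3 → F} (hf : ContDiffOn ℝ ∞ f Ω) : ∀ {j : ℕ} (α : Fin j → Fin 3),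
    ∃ g : E3 → F, ContDiffOn ℝ ∞ g Ω ∧ ∀ y ∈ Ω ∩ Pos, pderiv α f y = g y := by
  intro j
  induction j with
  | zero => exact fun α => ⟨f, hf, fun y _ => pderiv_zero α f y⟩
  | succ j ih =>
    intro α
    obtain ⟨g, hg, hfg⟩ := ih (Fin.tail α)
    refine ⟨_, hΩ.contDiffOn_fderivWithin_apply hg (EuclideanSpace.single (α 0) 1), fun y hy => ?_⟩
    rw [pderiv_succ α (hΩ.contDiffAt (hf.mono inter_subset_left) hy),
      ← (hΩ.hasFDerivAt_of_contDiffOn hg hy).fderiv]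
    congr 1
    refine Filter.EventuallyEq.fderiv_eq ?_
    filter_upwards [hΩ.isOpen_inter_pos.mem_nhds hy] with w hw using hfg w hw

end RelOpen

/-! ### Functions homogeneous in a defining function -/

/-- Real functions on the interior part of `Ω` of the form `β^w h` with `h` smooth up to the
boundary. -/
def HomOn (Ω : Set E3) (β : E3 → ℝ) (w : ℤ) (f : E3 → ℝ) : Prop :=
  ∃ h : E3 → ℝ, ContDiffOn ℝ ∞ h Ω ∧ ∀ y ∈ Ω ∩ Pos, f y = β y ^ w * h y

section HomOn

variable {Ω : Set E3} {β : E3 → ℝ} {w w' : ℤ} {f f' : E3 → ℝ}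

lemma HomOn.add (hf : HomOn Ω β w f) (hf' : HomOn Ω β w f') :
    HomOn Ω β w (fun y => f y + f' y) := by
  obtain ⟨h, hh, h1⟩ := hf
  obtain ⟨h', hh', h1'⟩ := hf'
  exact ⟨_, hh.add hh', fun y hy => by
    simp only [h1 y hy, h1' y hy]; ring⟩

lemma homOn_zero : HomOn Ω β w (fun _ => 0) :=
  ⟨_, contDiffOn_const (c := 0), fun y _ => by ring⟩

lemma homOn_const (c : ℝ) : HomOn Ω β 0 (fun _ => c) :=
  ⟨_, contDiffOn_const (c := c), fun y _ => by simp⟩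

lemma HomOn.mul (hβ : ∀ y ∈ Ω ∩ Pos, 0 < β y) (hf : HomOn Ω β w f) (hf' : HomOn Ω β w' f') :
    HomOn Ω β (w + w') (fun y => f y * f' y) := by
  obtain ⟨h, hh, h1⟩ := hf
  obtain ⟨h', hh', h1'⟩ := hf'
  exact ⟨_, hh.mul hh', fun y hy => by
    simp only [h1 y hy, h1' y hy]
    rw [zpow_add₀ (hβ y hy).ne']; ring⟩

lemma HomOn.pow (hβ : ∀ y ∈ Ω ∩ Pos, 0 < β y) (hf : HomOn Ω β w f) (n : ℕ) :
    HomOn Ω β (n * w) (fun y => f y ^ n) := by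
  induction n with
  | zero => simpa using homOn_const (Ω := Ω) (β := β) 1
  | succ n ih =>
    have := ih.mul hβ hf
    simp only [pow_succ]
    convert this using 1
    push_cast
    ring

lemma homOn_sum {ι : Type*} (s : Finset ι) (F : ι → E3 → ℝ) (h : ∀ i ∈ s, HomOn Ω β w (F i)) :
    HomOn Ω β w (fun y => ∑ i ∈ s, F i y) := by
  classical
  induction s using Finset.induction_on with
  | empty => simpa using homOn_zero
  | insert a s ha ih =>
    simp only [Finset.sum_insert ha]
    exact (h a (Finset.mem_insert_self _ _)).add (ih fun i hi => h i (Finset.mem_insert_of_mem hi))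

lemma homOn_prod (hβ : ∀ y ∈ Ω ∩ Pos, 0 < β y) {ι : Type*} (s : Finset ι) (F : ι → E3 → ℝ)
    (wt : ι → ℤ) (h : ∀ i ∈ s, HomOn Ω β (wt i) (F i)) :
    HomOn Ω β (∑ i ∈ s, wt i) (fun y => ∏ i ∈ s, F i y) := by
  classical
  induction s using Finset.induction_on with
  | empty => simpa using homOn_const 1
  | insert a s ha ih =>
    simp only [Finset.sum_insert ha, Finset.prod_insert ha]
    exact (h a (Finset.mem_insert_self _ _)).mul hβ
      (ih fun i hi => h i (Finset.mem_insert_of_mem hi))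

lemma HomOn.contDiffOn (hβs : ContDiffOn ℝ ∞ β Ω) (hβ : ∀ y ∈ Ω ∩ Pos, 0 < β y)
    (hf : HomOn Ω β w f) : ContDiffOn ℝ ∞ f (Ω ∩ Pos) := by
  obtain ⟨h, hh, h1⟩ := hf
  refine ContDiffOn.congr (f := fun y => β y ^ w * h y) ?_ h1
  refine ContDiffOn.mul ?_ (hh.mono inter_subset_left)
  have h2 : ContDiffOn ℝ ∞ (fun t : ℝ => t ^ w) (Ioi 0) := by
    cases w with
    | ofNat n => simpa using (contDiff_id.pow n).contDiffOn
    | negSucc n =>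
      simp only [zpow_negSucc]
      exact (contDiff_id.pow (n + 1)).contDiffOn.inv fun t ht =>
        pow_ne_zero _ (show (0 : ℝ) < t from ht).ne'
  exact h2.comp (hβs.mono inter_subset_left) hβ

/-- The derivative of `β^w h` is `β^(w-1) (w h ∂β + β ∂h)`, whose second factor is smooth up to the
boundary. -/
lemma HomOn.fderiv (hΩ : RelOpen Ω) (hβs : ContDiffOn ℝ ∞ β Ω) (hβ : ∀ y ∈ Ω ∩ Pos, 0 < β y)
    (hf : HomOn Ω β w f) (v : E3) : HomOn Ω β (w - 1) (fun y => fderiv ℝ f y v) := by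
  obtain ⟨h, hh, h1⟩ := hf
  refine ⟨fun y => w * fderivWithin ℝ β Ω y v * h y + β y * fderivWithin ℝ h Ω y v, ?_, ?_⟩
  · exact ((contDiffOn_const.mul (hΩ.contDiffOn_fderivWithin_apply hβs v)).mul hh).add
      (hβs.mul (hΩ.contDiffOn_fderivWithin_apply hh v))
  · intro y hy
    have h2 := hΩ.hasFDerivAt_of_contDiffOn hβs hy
    have h3 := hΩ.hasFDerivAt_of_contDiffOn hh hy
    have h4 := (hasDerivAt_zpow w (β y) (Or.inl (hβ y hy).ne')).comp_hasFDerivAt y h2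
    have h5 := (h4.mul h3).congr_of_eventuallyEq
      (show f =ᶠ[𝓝 y] _ by
        filter_upwards [hΩ.isOpen_inter_pos.mem_nhds hy] with z hz using h1 z hz)
    simp only [h5.fderiv]
    have h6 : β y ^ w = β y ^ (w - 1) * β y := by
      rw [← zpow_add_one₀ (hβ y hy).ne', sub_add_cancel]
    simp only [Function.comp_apply, add_apply, smul_apply, smul_eq_mul]
    rw [h6]
    ring

lemma HomOn.pderiv (hΩ : RelOpen Ω) (hβs : ContDiffOn ℝ ∞ β Ω) (hβ : ∀ y ∈ Ω ∩ Pos, 0 < β y)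
    (hf : HomOn Ω β w f) : ∀ {j : ℕ} (α : Fin j → Fin 3),
    HomOn Ω β (w - j) (fun y => pderiv α f y) := by
  intro j
  induction j with
  | zero => intro α; simpa using! hf
  | succ j ih =>
    intro α
    obtain ⟨h, hh, h1⟩ := (ih (Fin.tail α)).fderiv hΩ hβs hβ (EuclideanSpace.single (α 0) 1)
    refine ⟨h, hh, fun y hy => ?_⟩
    refine (pderiv_succ α (hΩ.contDiffAt (hf.contDiffOn hβs hβ) hy)).trans ((h1 y hy).trans ?_)
    congr 2
    push_cast
    ring

end HomOn

/-! ### Derivatives of products with powers and logarithms -/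

/-- A derivative lowers the power of `β` by one and keeps the logarithm or takes one factor of it
away. One family `H` serves all `m`, with the dependence on `m` confined to the falling factorials;
so the case `m = 0` determines the top coefficient for every `m`. -/
lemma RelOpen.exists_pderiv_powLog_mul {Ω : Set E3} {β : E3 → ℝ} (hΩ : RelOpen Ω)
    (hβs : ContDiffOn ℝ ∞ β Ω) (hβ : ∀ y ∈ Ω ∩ Pos, 0 < β y) (z : ℂ) {G : E3 → ℂ}
    (hG : ContDiffOn ℝ ∞ G Ω) : ∀ {j : ℕ} (α : Fin j → Fin 3), ∃ H : ℕ → E3 → ℂ,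
      (∀ l, ContDiffOn ℝ ∞ (H l) Ω) ∧ ∀ m : ℕ, ∀ y ∈ Ω ∩ Pos,
        pderiv α (fun y => powLog z m (β y) * G y) y =
          ∑ l ∈ Finset.range (m + 1), (m.descFactorial l : ℂ) *
            (powLog (z - j) (m - l) (β y) * H l y) := by
  intro j
  induction j with
  | zero =>
    intro α
    refine ⟨fun l => if l = 0 then G else 0, fun l => ?_, fun m y hy => ?_⟩
    · dsimp only
      split_ifs
      · exact hG
      · exact contDiffOn_const
    · rw [pderiv_zero, Finset.sum_eq_single 0]
      · simp
      · intro l _ hl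
        simp [hl]
      · simp
  | succ j ih =>
    intro α
    obtain ⟨H, hH, h1⟩ := ih (Fin.tail α)
    set v : E3 := EuclideanSpace.single (α 0) 1 with hv
    set b : E3 → ℂ := fun y => ((fderivWithin ℝ β Ω y v : ℝ) : ℂ) with hb
    have hbs : ContDiffOn ℝ ∞ b Ω :=
      Complex.ofRealCLM.contDiff.comp_contDiffOn (hΩ.contDiffOn_fderivWithin_apply hβs v)
    have hβc : ContDiffOn ℝ ∞ (fun y => (β y : ℂ)) Ω :=
      Complex.ofRealCLM.contDiff.comp_contDiffOn hβs
    -- `B` is `b H` with its index shifted by one: it records the terms in which the new derivative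
    -- falls on a logarithm.
    set B : ℕ → E3 → ℂ := fun l => Nat.casesOn l 0 fun l => fun y => b y * H l y with hB
    refine ⟨fun l y => (z - j) * b y * H l y + β y * fderivWithin ℝ (H l) Ω y v + B l y,
      fun l => ?_, fun m y hy => ?_⟩
    · refine (((contDiffOn_const.mul hbs).mul (hH l)).add
        (hβc.mul (hΩ.contDiffOn_fderivWithin_apply (hH l) v))).add ?_
      cases l with
      | zero => exact contDiffOn_const
      | succ l => exact hbs.mul (hH l)
    · have hpos := hβ y hy
      have hsm : ContDiffOn ℝ ∞ (fun y => powLog z m (β y) * G y) (Ω ∩ Pos) :=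
        ((contDiffOn_powLog z m).comp (hβs.mono inter_subset_left) hβ).mul
          (hG.mono inter_subset_left)
      have hd : ∀ l, HasFDerivAt (fun y => powLog (z - j) (m - l) (β y) * H l y)
          (powLog (z - j) (m - l) (β y) • fderivWithin ℝ (H l) Ω y + H l y •
            (ContinuousLinearMap.toSpanSingleton ℝ ((z - j) * powLog (z - j - 1) (m - l) (β y) +
              (m - l : ℕ) * powLog (z - j - 1) (m - l - 1) (β y))).comp
            (fderivWithin ℝ β Ω y)) y := fun l =>
        ((hasDerivAt_powLog_of_pos (z - j) (m - l) hpos).hasFDerivAt.comp y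
          (hΩ.hasFDerivAt_of_contDiffOn hβs hy)).mul (hΩ.hasFDerivAt_of_contDiffOn (hH l) hy)
      have hd2 := HasFDerivAt.fun_sum (u := Finset.range (m + 1)) fun l _ =>
        (hd l).const_mul (m.descFactorial l : ℂ)
      rw [pderiv_succ α (hΩ.contDiffAt hsm hy)]
      have hev : pderiv (Fin.tail α) (fun y => powLog z m (β y) * G y) =ᶠ[𝓝 y] fun y =>
          ∑ l ∈ Finset.range (m + 1), (m.descFactorial l : ℂ) *
            (powLog (z - j) (m - l) (β y) * H l y) := by
        filter_upwards [hΩ.isOpen_inter_pos.mem_nhds hy] with w hw using h1 m w hw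
      rw [hev.fderiv_eq, hd2.fderiv, sum_apply]
      have hz : z - ((j + 1 : ℕ) : ℂ) = z - j - 1 := by push_cast; ring
      rw [hz]
      have hp : ∀ k, powLog (z - j) k (β y) = powLog (z - j - 1) k (β y) * β y := by
        intro k
        have := powLog_add (z := z - j - 1) (w := 1) (m := k) hpos
        rw [sub_add_cancel] at this
        rw [this, Complex.cpow_one]
        ring
      -- The index shift has no boundary terms, as `B 0` and `m.descFactorial (m + 1)` are zero.
      have hT : ∑ l ∈ Finset.range (m + 1), (m.descFactorial l : ℂ) *
            (powLog (z - j - 1) (m - l) (β y) * B l y) =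
          ∑ l ∈ Finset.range (m + 1), (m.descFactorial (l + 1) : ℂ) *
            (powLog (z - j - 1) (m - (l + 1)) (β y) * B (l + 1) y) := by
        have h2 := Finset.sum_range_succ (fun l => (m.descFactorial l : ℂ) *
            (powLog (z - j - 1) (m - l) (β y) * B l y)) (m + 1)
        have h3 := Finset.sum_range_succ' (fun l => (m.descFactorial l : ℂ) *
            (powLog (z - j - 1) (m - l) (β y) * B l y)) (m + 1)
        have h4 : B 0 y = 0 := rfl
        rw [h2, h4, Nat.descFactorial_eq_zero_iff_lt.2 (Nat.lt_succ_self m)] at h3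
        simpa using h3
      simp only [mul_add, Finset.sum_add_distrib]
      rw [hT, ← Finset.sum_add_distrib, ← Finset.sum_add_distrib]
      refine Finset.sum_congr rfl fun l _ => ?_
      have h5 : B (l + 1) y = b y * H l y := rfl
      simp only [smul_apply, add_apply, ContinuousLinearMap.comp_apply,
        ContinuousLinearMap.toSpanSingleton_apply, smul_eq_mul, Complex.real_smul]
      rw [h5, hp, Nat.descFactorial_succ, Nat.sub_sub]
      simp only [hb, ← hv]
      push_cast
      ring

end AsympHyp
end

noncomputable section

set_option linter.unusedSectionVars false

namespace AsympHyp

open Set Filter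

/-! ### Laurent polynomials -/

/-- `F` is, on the positive reals, a Laurent polynomial with constant coefficient `c₀`. -/
def IsLaurent (F : ℝ → ℂ) (c₀ : ℂ) : Prop :=
  ∃ c : ℤ →₀ ℂ, (∀ a : ℝ, 0 < a → F a = c.sum fun n z => z * (a : ℂ) ^ n) ∧ c 0 = c₀

lemma IsLaurent.add {F G : ℝ → ℂ} {c d : ℂ} (hF : IsLaurent F c) (hG : IsLaurent G d) :
    IsLaurent (fun a => F a + G a) (c + d) := by
  obtain ⟨f, hf, rfl⟩ := hF
  obtain ⟨g, hg, rfl⟩ := hG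
  refine ⟨f + g, fun a ha => ?_, rfl⟩
  rw [Finsupp.sum_add_index' (by simp) (by intros; ring), ← hf a ha, ← hg a ha]

lemma isLaurent_monomial (n : ℤ) (z : ℂ) :
    IsLaurent (fun a => z * (a : ℂ) ^ n) (if n = 0 then z else 0) := by
  refine ⟨Finsupp.single n z, fun a _ => ?_, ?_⟩
  · rw [Finsupp.sum_single_index (by simp)]
  · rw [Finsupp.single_apply]

lemma isLaurent_sum {ι : Type*} (s : Finset ι) {F : ι → ℝ → ℂ} {c : ι → ℂ}
    (h : ∀ i ∈ s, IsLaurent (F i) (c i)) :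
    IsLaurent (fun a => ∑ i ∈ s, F i a) (∑ i ∈ s, c i) := by
  classical
  induction s using Finset.induction_on with
  | empty => exact ⟨0, by simp, by simp⟩
  | insert j s hj ih =>
    simp only [Finset.sum_insert hj]
    exact (h j (Finset.mem_insert_self _ _)).add (ih fun i hi => h i (Finset.mem_insert_of_mem hi))

lemma IsLaurent.congr {F G : ℝ → ℂ} {c : ℂ} (hF : IsLaurent F c) (h : ∀ a, 0 < a → G a = F a) :
    IsLaurent G c := by
  obtain ⟨f, hf, rfl⟩ := hF
  exact ⟨f, fun a ha => (h a ha).trans (hf a ha), rfl⟩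

/-- A constant Laurent polynomial is its constant coefficient. -/
lemma IsLaurent.eq_of_const {C c : ℂ} (h : IsLaurent (fun _ => C) c) : C = c := by
  obtain ⟨f, hf, h0⟩ := h.add (isLaurent_monomial 0 (-C))
  have h1 : ∀ n, f n = 0 := by
    intro n
    by_cases hn : n ∈ f.support
    · refine eq_zero_of_sum_zpow f.support f (fun a ha => ?_) n hn
      have := hf a ha
      simp only [zpow_zero, mul_one, add_neg_cancel] at this
      exact this.symm
    · simpa using hn
  rw [h1, if_pos rfl] at h0
  exact (sub_eq_zero.1 (by rw [sub_eq_add_neg]; exact h0.symm)).symm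

/-! ### Weighted homogeneous parts of polynomials -/

section Weighted

variable {σ : Type*} (wt : σ → ℤ)

/-- The weight of a monomial. -/
def monomialWeight (d : σ →₀ ℕ) : ℤ := ∑ i ∈ d.support, (d i : ℤ) * wt i

/-- The value of the part of weight `n` of a polynomial. -/
def weightedEval (n : ℤ) (v : σ → ℝ) (p : MvPolynomial σ ℝ) : ℝ :=
  ∑ d ∈ p.support, if monomialWeight wt d = n then p.coeff d * ∏ i ∈ d.support, v i ^ d i else 0

lemma eval_weighted {a : ℝ} (ha : 0 < a) (v : σ → ℝ) (p : MvPolynomial σ ℝ) :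
    MvPolynomial.eval (fun i => a ^ wt i * v i) p =
      ∑ d ∈ p.support, (p.coeff d * ∏ i ∈ d.support, v i ^ d i) * a ^ monomialWeight wt d := by
  classical
  rw [MvPolynomial.eval_eq]
  refine Finset.sum_congr rfl fun d _ => ?_
  rw [mul_assoc]
  congr 1
  have h : a ^ monomialWeight wt d = ∏ i ∈ d.support, a ^ ((d i : ℤ) * wt i) := by
    unfold monomialWeight
    induction d.support using Finset.induction_on with
    | empty => simp
    | insert j s hj ih => rw [Finset.sum_insert hj, Finset.prod_insert hj, zpow_add₀ ha.ne', ih]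
  rw [h, ← Finset.prod_mul_distrib]
  refine Finset.prod_congr rfl fun i _ => ?_
  rw [mul_pow, mul_comm, mul_comm (d i : ℤ), zpow_mul, zpow_natCast]

lemma homOn_weightedEval {Ω : Set E3} {β : E3 → ℝ} (hβ : ∀ y ∈ Ω ∩ Pos, 0 < β y)
    {v : E3 → σ → ℝ} (hv : ∀ i, HomOn Ω β (wt i) (fun y => v y i)) (n : ℤ)
    (p : MvPolynomial σ ℝ) : HomOn Ω β n (fun y => weightedEval wt n (v y) p) := by
  refine homOn_sum _ _ fun d _ => ?_
  split_ifs with h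
  · subst h
    have h1 := (homOn_const (p.coeff d)).mul hβ
      (homOn_prod hβ d.support (fun i y => v y i ^ d i) (fun i => (d i : ℤ) * wt i)
        fun i _ => (hv i).pow hβ (d i))
    rwa [zero_add] at h1
  · exact homOn_zero

/-- A part of weight `n` varies as `a^n`, and the factor `a⁻¹ ^ j` coming from a `j`-th derivative
turns this into `a^(n-j)`. Only weight `j` is constant in `a`. -/
lemma isLaurent_eval {F : ℝ → σ → ℝ} {v : σ → ℝ}
    (hF : ∀ a, 0 < a → ∀ i, F a i = a ^ wt i * v i) (p : MvPolynomial σ ℝ) (j : ℕ) (z : ℂ) :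
    IsLaurent (fun a => ((MvPolynomial.eval (F a) p : ℝ) : ℂ) * (((a⁻¹ ^ j : ℝ) : ℂ) * z))
      (((weightedEval wt j v p : ℝ) : ℂ) * z) := by
  have h1 := isLaurent_sum p.support (F := fun d a =>
    (((p.coeff d * ∏ i ∈ d.support, v i ^ d i : ℝ) : ℂ) * z) * (a : ℂ) ^ (monomialWeight wt d - j))
    fun d _ => isLaurent_monomial _ _
  convert h1.congr (G := fun a => ((MvPolynomial.eval (F a) p : ℝ) : ℂ) *
    (((a⁻¹ ^ j : ℝ) : ℂ) * z)) fun a ha => ?_ using 1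
  · unfold weightedEval
    rw [Complex.ofReal_sum, Finset.sum_mul]
    refine Finset.sum_congr rfl fun d _ => ?_
    simp only [sub_eq_zero]
    split_ifs <;> simp
  · rw [show F a = fun i => a ^ wt i * v i from funext (hF a ha), eval_weighted wt ha,
      Complex.ofReal_sum, Finset.sum_mul]
    refine Finset.sum_congr rfl fun d _ => ?_
    have ha' : (a : ℂ) ≠ 0 := by exact_mod_cast ha.ne'
    rw [zpow_sub₀ ha', zpow_natCast]
    push_cast
    rw [inv_pow]
    field_simp

end Weighted

/-! ### Dilated charts -/

/-- Dilations of the half-space. -/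
def dilation (a : ℝ) (ha : 0 < a) : EuclideanHalfSpace 3 ≃ₜ EuclideanHalfSpace 3 where
  toFun x := ⟨a • x.1, mul_nonneg ha.le x.2⟩
  invFun x := ⟨a⁻¹ • x.1, mul_nonneg (inv_nonneg.2 ha.le) x.2⟩
  left_inv x := Subtype.ext (inv_smul_smul₀ ha.ne' x.1)
  right_inv x := Subtype.ext (smul_inv_smul₀ ha.ne' x.1)
  continuous_toFun := (continuous_subtype_val.const_smul a).subtype_mk _
  continuous_invFun := (continuous_subtype_val.const_smul a⁻¹).subtype_mk _

lemma contMDiff_smul_halfSpace {f : EuclideanHalfSpace 3 → EuclideanHalfSpace 3} (a : ℝ)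
    (hf : ∀ x, (f x).1 = a • x.1) : ContMDiff (𝓡∂ 3) (𝓡∂ 3) ∞ f := by
  have h1 : f = (𝓡∂ 3).symm ∘ (fun y : E3 => a • y) ∘ (𝓡∂ 3) := by
    funext x
    change f x = (𝓡∂ 3).symm (a • x.1)
    rw [← hf x]
    exact ((𝓡∂ 3).left_inv (f x)).symm
  rw [h1, ← contMDiffOn_univ]
  refine ContMDiffOn.comp (t := range (𝓡∂ 3)) (𝓡∂ 3).contMDiffOn_symm ?_ ?_
  · exact ((contDiff_const_smul a).contMDiff.comp (𝓡∂ 3).contMDiff).contMDiffOn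
  · intro x _
    exact ⟨f x, hf x⟩

variable {M : Type*} [TopologicalSpace M] [ChartedSpace (EuclideanHalfSpace 3) M]

/-- A chart followed by a dilation. -/
def dilChart (e : OpenPartialHomeomorph M (EuclideanHalfSpace 3)) (a : ℝ) (ha : 0 < a) :
    OpenPartialHomeomorph M (EuclideanHalfSpace 3) := e.transHomeomorph (dilation a ha)

lemma extend_dilChart (e : OpenPartialHomeomorph M (EuclideanHalfSpace 3)) {a : ℝ} (ha : 0 < a)
    (x : M) : (dilChart e a ha).extend (𝓡∂ 3) x = a • e.extend (𝓡∂ 3) x := rfl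

variable [IsManifold (𝓡∂ 3) ∞ M] {e : OpenPartialHomeomorph M (EuclideanHalfSpace 3)}

lemma dilChart_mem_maximalAtlas (he : e ∈ IsManifold.maximalAtlas (𝓡∂ 3) ∞ M) {a : ℝ}
    (ha : 0 < a) : dilChart e a ha ∈ IsManifold.maximalAtlas (𝓡∂ 3) ∞ M := by
  apply OpenPartialHomeomorph.mem_maximalAtlas_of_contMDiffOn
  · exact (contMDiff_smul_halfSpace (f := dilation a ha) a fun x => rfl).comp_contMDiffOn
      (contMDiffOn_of_mem_maximalAtlas he)
  · exact (contMDiffOn_symm_of_mem_maximalAtlas he).comp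
      (contMDiff_smul_halfSpace (f := (dilation a ha).symm) a⁻¹ fun x => rfl).contMDiffOn fun x hx => hx

lemma dExtend_dilChart (he : e ∈ IsManifold.maximalAtlas (𝓡∂ 3) ∞ M) {a : ℝ} (ha : 0 < a)
    {x : M} (hx : x ∈ e.source) (v : TangentSpace (𝓡∂ 3) x) :
    dExtend (dilChart e a ha) x v = a • dExtend e x v := by
  have h1 := hasMFDerivAt_extend (dilChart_mem_maximalAtlas he ha) (x := x) hx
  have h2 := (hasMFDerivAt_extend he hx).const_smul a
  have h3 := hasMFDerivAt_unique h1 h2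
  exact DFunLike.congr_fun h3 v

lemma dSymm_dilChart (he : e ∈ IsManifold.maximalAtlas (𝓡∂ 3) ∞ M) {a : ℝ} (ha : 0 < a)
    {x : M} (hx : x ∈ e.source) (v : E3) :
    dSymm (dilChart e a ha) x v = a⁻¹ • dSymm e x v := by
  have h1 := dExtend_dSymm (dilChart_mem_maximalAtlas he ha) (x := x) hx v
  rw [dExtend_dilChart he ha hx] at h1
  rw [← dSymm_dExtend he hx (dSymm (dilChart e a ha) x v), ← map_smul]
  exact congrArg (dSymm e x) (eq_inv_smul_iff₀ ha.ne' |>.2 h1)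

lemma coordVec_dilChart (he : e ∈ IsManifold.maximalAtlas (𝓡∂ 3) ∞ M) {a : ℝ} (ha : 0 < a)
    {x : M} (hx : x ∈ e.source) (i : Fin 3) :
    coordVec (dilChart e a ha) x i = a⁻¹ • coordVec e x i := dSymm_dilChart he ha hx _

lemma coordCovec_dilChart (he : e ∈ IsManifold.maximalAtlas (𝓡∂ 3) ∞ M) {a : ℝ} (ha : 0 < a)
    {x : M} (hx : x ∈ e.source) (j : Fin 3) :
    coordCovec (dilChart e a ha) x j = a • coordCovec e x j := by
  ext v
  rw [coordCovec_apply, dExtend_dilChart he ha hx]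
  rfl

/-- The factor depends only on the ranks, so it is the same for `u` and `P u` and cancels from the
coordinate formula of an operator. -/
lemma comp_dilChart {E : TensorType} (he : e ∈ IsManifold.maximalAtlas (𝓡∂ 3) ∞ M) {a : ℝ}
    (ha : 0 < a) {x : M} (hx : x ∈ e.source) (u : TensorField M E) (K : Idx E.cov E.contra) :
    comp (dilChart e a ha) u x K = (a⁻¹ ^ E.cov * a ^ E.contra) • comp e u x K := by
  unfold comp
  simp only [coordVec_dilChart he ha hx, coordCovec_dilChart he ha hx]
  rw [MultilinearMap.map_smul_univ, MultilinearMap.map_smul_univ, smul_apply, smul_smul]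
  simp [mul_comm]

lemma symm_dilChart {a : ℝ} (ha : 0 < a) {y : E3} (hy : y ∈ (e.extend (𝓡∂ 3)).target) :
    ((dilChart e a ha).extend (𝓡∂ 3)).symm (a • y) = (e.extend (𝓡∂ 3)).symm y := by
  have h1 := extend_left_inv (e := dilChart e a ha) (x := (e.extend (𝓡∂ 3)).symm y)
    (extend_symm_mem hy)
  rwa [extend_dilChart, (e.extend (𝓡∂ 3)).right_inv hy] at h1

lemma eventually_inv_smul_mem {a : ℝ} (ha : 0 < a) {y : E3}
    (hy : y ∈ (e.extend (𝓡∂ 3)).target ∩ Pos) :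
    ∀ᶠ w in 𝓝 (a • y), a⁻¹ • w ∈ (e.extend (𝓡∂ 3)).target ∩ Pos := by
  have h1 : Tendsto (fun w : E3 => a⁻¹ • w) (𝓝 (a • y)) (𝓝 y) := by
    have := (continuous_const_smul (T := E3) a⁻¹).tendsto (a • y)
    rwa [inv_smul_smul₀ ha.ne'] at this
  exact h1.eventually ((relOpen_target e).isOpen_inter_pos.mem_nhds hy)

lemma localComp_dilChart {E : TensorType} (he : e ∈ IsManifold.maximalAtlas (𝓡∂ 3) ∞ M) {a : ℝ}
    (ha : 0 < a) {y : E3} (hy : y ∈ (e.extend (𝓡∂ 3)).target ∩ Pos) (u : TensorField M E)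
    (K : Idx E.cov E.contra) :
    localComp (dilChart e a ha) u K =ᶠ[𝓝 (a • y)]
      fun w => (a⁻¹ ^ E.cov * a ^ E.contra) • localComp e u K (a⁻¹ • w) := by
  filter_upwards [eventually_inv_smul_mem ha hy] with w hw
  have h1 := symm_dilChart (e := e) ha hw.1
  rw [smul_inv_smul₀ ha.ne'] at h1
  unfold localComp
  rw [h1, comp_dilChart he ha (extend_symm_mem hw.1)]

end AsympHyp
end

noncomputable section

set_option linter.unusedSectionVars false

namespace AsympHyp

open Set Filter

variable {M : Type*} [TopologicalSpace M] [ChartedSpace (EuclideanHalfSpace 3) M]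
variable [IsManifold (𝓡∂ 3) ∞ M] {e : OpenPartialHomeomorph M (EuclideanHalfSpace 3)}

/-- The weights of the metric variables under dilation of the coordinates. -/
def MetricVar.weight {k : ℕ} : MetricVar k → ℤ
  | .deriv m _ _ _ _ => -2 - m
  | .invSqrtDet => 3

namespace AHStructure

variable (A : AHStructure M) {E : TensorType}

/-! ### The metric in coordinates -/

lemma localMetric_eq (e : OpenPartialHomeomorph M (EuclideanHalfSpace 3)) (i j : Fin 3) (y : E3) :
    A.localMetric e i j y = (A.rhoLoc e y)⁻¹ ^ 2 * A.gbarComp e i j y := rfl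

lemma gbarMatrix_posDef (he : e ∈ IsManifold.maximalAtlas (𝓡∂ 3) ∞ M) {y : E3}
    (hy : y ∈ (e.extend (𝓡∂ 3)).target) :
    (Matrix.of fun i j => A.gbarComp e i j y).PosDef := by
  set x := (e.extend (𝓡∂ 3)).symm y with hx
  refine Matrix.PosDef.of_dotProduct_mulVec_pos ?_ fun w hw => ?_
  · ext i j
    exact A.gbar.symm x _ _
  · set v : TangentSpace (𝓡∂ 3) x := ∑ i, w i • coordVec e x i with hv
    have h1 : star w ⬝ᵥ ((Matrix.of fun i j => A.gbarComp e i j y).mulVec w) =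
        A.gbar.inner x v v := by
      conv_rhs => rw [hv]
      simp only [dotProduct, Matrix.mulVec, Matrix.of_apply, map_sum, map_smul,
        sum_apply, smul_apply, smul_eq_mul, Finset.mul_sum, star_trivial]
      rw [Finset.sum_comm]
      refine Finset.sum_congr rfl fun j _ => ?_
      refine Finset.sum_congr rfl fun i _ => ?_
      change w i * (A.gbar.inner x (coordVec e x i) (coordVec e x j) * w j) =
        w j * (w i * A.gbar.inner x (coordVec e x i) (coordVec e x j))
      ring
    rw [h1]
    refine A.gbar.pos x v fun h0 => hw ?_
    funext k
    have h2 : coordCovec e x k v = w k := by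
      have h3 : ∀ i, coordCovec e x k (coordVec e x i) = if k = i then 1 else 0 := fun i =>
        coordCovec_coordVec he (extend_symm_mem hy) i k
      rw [hv, map_sum]
      simp [h3]
    rw [← h2, h0, map_zero]
    rfl

lemma gram_det (e : OpenPartialHomeomorph M (EuclideanHalfSpace 3)) (y : E3) :
    (A.gram e y).det = ((A.rhoLoc e y)⁻¹ ^ 3) ^ 2 *
      (Matrix.of fun i j => A.gbarComp e i j y).det := by
  have h1 : A.gram e y = (A.rhoLoc e y)⁻¹ ^ 2 • Matrix.of fun i j => A.gbarComp e i j y := by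
    ext i j
    rfl
  rw [h1, Matrix.det_smul, Fintype.card_fin]
  ring

/-- As `g = ρ⁻² gbar`, the order in `ρ` of every metric variable agrees with its weight under
dilations: `-2 - m` for an `m`-th derivative and `3` for the inverse root of the determinant. This
agreement turns homogeneity into the degeneration of the operator at the boundary. -/
lemma homOn_metricVarValue (he : e ∈ IsManifold.maximalAtlas (𝓡∂ 3) ∞ M) {k : ℕ}
    (v : MetricVar k) :
    HomOn (e.extend (𝓡∂ 3)).target (A.rhoLoc e) v.weight (fun y => A.metricVarValue e y v) := by
  have hβ : ∀ y ∈ (e.extend (𝓡∂ 3)).target ∩ Pos, 0 < A.rhoLoc e y := fun y hy =>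
    A.rhoLoc_pos he hy.1 hy.2
  cases v with
  | deriv m hm α i j =>
    have h1 : HomOn (e.extend (𝓡∂ 3)).target (A.rhoLoc e) (-2) (A.localMetric e i j) :=
      ⟨_, A.contDiffOn_gbarComp he i j, fun y _ => by
        rw [A.localMetric_eq, inv_pow, zpow_neg]; rfl⟩
    exact h1.pderiv (relOpen_target e) (A.contDiffOn_rhoLoc he) hβ α
  | invSqrtDet =>
    refine ⟨fun y => (Real.sqrt (Matrix.of fun i j => A.gbarComp e i j y).det)⁻¹, ?_, fun y hy => ?_⟩
    · have h1 : ContDiffOn ℝ ∞ (fun y => (Matrix.of fun i j => A.gbarComp e i j y).det)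
          (e.extend (𝓡∂ 3)).target := by
        simp only [Matrix.det_fin_three, Matrix.of_apply]
        have h2 := fun i j => A.contDiffOn_gbarComp he i j
        fun_prop
      have h2 : ∀ y ∈ (e.extend (𝓡∂ 3)).target,
          0 < (Matrix.of fun i j => A.gbarComp e i j y).det := fun y hy =>
        (A.gbarMatrix_posDef he hy).det_pos
      exact (h1.sqrt fun y hy => (h2 y hy).ne').inv fun y hy => (Real.sqrt_pos.2 (h2 y hy)).ne'
    · change (Real.sqrt (A.gram e y).det)⁻¹ = _
      have h1 := hβ y hy
      rw [A.gram_det, Real.sqrt_mul (sq_nonneg _), Real.sqrt_sq (by positivity), mul_inv, inv_pow,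
        inv_inv]
      rfl

lemma localMetric_dilChart (he : e ∈ IsManifold.maximalAtlas (𝓡∂ 3) ∞ M) {a : ℝ} (ha : 0 < a)
    (i j : Fin 3) {y : E3} (hy : y ∈ (e.extend (𝓡∂ 3)).target) :
    A.localMetric (dilChart e a ha) i j (a • y) = a⁻¹ ^ 2 * A.localMetric e i j y := by
  unfold localMetric
  rw [symm_dilChart ha hy, coordVec_dilChart he ha (extend_symm_mem hy),
    coordVec_dilChart he ha (extend_symm_mem hy)]
  unfold metric
  simp only [map_smul, smul_apply, smul_eq_mul]
  ring

lemma metricVarValue_dilChart (he : e ∈ IsManifold.maximalAtlas (𝓡∂ 3) ∞ M) {a : ℝ} (ha : 0 < a)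
    {y : E3} (hy : y ∈ (e.extend (𝓡∂ 3)).target ∩ Pos) {k : ℕ} (v : MetricVar k) :
    A.metricVarValue (dilChart e a ha) (a • y) v = a ^ v.weight * A.metricVarValue e y v := by
  cases v with
  | deriv m hm α i j =>
    have h0 : HomOn (e.extend (𝓡∂ 3)).target (A.rhoLoc e) (-2) (A.localMetric e i j) :=
      ⟨_, A.contDiffOn_gbarComp he i j, fun y _ => by
        rw [A.localMetric_eq, inv_pow, zpow_neg]; rfl⟩
    have h1 := h0.contDiffOn (A.contDiffOn_rhoLoc he) fun y hy => A.rhoLoc_pos he hy.1 hy.2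
    have h2 := pderiv_dilation α (g := A.localMetric (dilChart e a ha) i j) (c := a⁻¹ ^ 2) ha
      ((relOpen_target e).contDiffAt h1 hy) (by
        filter_upwards [eventually_inv_smul_mem ha hy] with w hw
        have h3 := A.localMetric_dilChart he ha i j hw.1
        rw [smul_inv_smul₀ ha.ne'] at h3
        exact h3)
    refine h2.trans ?_
    rw [smul_eq_mul]
    congr 1
    change _ = a ^ (-2 - (m : ℤ))
    rw [zpow_sub₀ ha.ne', zpow_natCast, inv_pow, inv_pow, zpow_neg]
    rfl
  | invSqrtDet =>
    change (Real.sqrt (A.gram (dilChart e a ha) (a • y)).det)⁻¹ =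
      a ^ (3 : ℤ) * (Real.sqrt (A.gram e y).det)⁻¹
    have h1 : A.gram (dilChart e a ha) (a • y) = a⁻¹ ^ 2 • A.gram e y := by
      ext i j
      exact A.localMetric_dilChart he ha i j hy.1
    have h2 : (A.gram (dilChart e a ha) (a • y)).det = (a⁻¹ ^ 3) ^ 2 * (A.gram e y).det := by
      rw [h1, Matrix.det_smul, Fintype.card_fin]
      ring
    rw [h2, Real.sqrt_mul (sq_nonneg _), Real.sqrt_sq (by positivity), mul_inv, inv_pow, inv_inv]
    rfl

/-! ### Geometric operators in coordinates -/

/-- Only the parts of the universal polynomials homogeneous of the correct weight contribute to a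
geometric operator. -/
lemma comp_eq_weighted {l : ℕ} {P : TensorField M E → TensorField M E}
    {coeff : UniversalCoeffs l E.cov E.contra} {u : TensorField M E}
    (hu : A.IsSmoothSection E u ((𝓡∂ 3).interior M))
    (hP : ∀ e ∈ IsManifold.maximalAtlas (𝓡∂ 3) ∞ M, ∀ x ∈ e.source ∩ (𝓡∂ 3).interior M, ∀ K,
      comp e (P u) x K =
        ∑ j ∈ Finset.range (l + 1), ∑ α : Fin j → Fin 3, ∑ K' : Idx E.cov E.contra,
          ((MvPolynomial.eval (A.metricVarValue e (e.extend (𝓡∂ 3) x)) (coeff j α K K') : ℝ) : ℂ) *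
            pderiv α (localComp e u K') (e.extend (𝓡∂ 3) x))
    (he : e ∈ IsManifold.maximalAtlas (𝓡∂ 3) ∞ M) {y : E3}
    (hy : y ∈ (e.extend (𝓡∂ 3)).target ∩ Pos) (K : Idx E.cov E.contra) :
    localComp e (P u) K y =
      ∑ j ∈ Finset.range (l + 1), ∑ α : Fin j → Fin 3, ∑ K' : Idx E.cov E.contra,
        ((weightedEval MetricVar.weight j (A.metricVarValue e y) (coeff j α K K') : ℝ) : ℂ) *
          pderiv α (localComp e u K') y := by
  set x := (e.extend (𝓡∂ 3)).symm y with hx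
  have hxs : x ∈ e.source := extend_symm_mem hy.1
  have hxi : x ∈ (𝓡∂ 3).interior M := (symm_mem_interior_iff he hy.1).2 hy.2
  have hxy : e.extend (𝓡∂ 3) x = y := (e.extend (𝓡∂ 3)).right_inv hy.1
  -- This is the formula in the dilated chart. Its right side is a Laurent polynomial in `a`, its
  -- left side does not depend on `a`; so only the constant coefficient remains.
  have key : ∀ a : ℝ, ∀ ha : 0 < a, localComp e (P u) K y =
      ∑ j ∈ Finset.range (l + 1), ∑ α : Fin j → Fin 3, ∑ K' : Idx E.cov E.contra,
        ((MvPolynomial.eval (A.metricVarValue (dilChart e a ha) (a • y)) (coeff j α K K') : ℝ) : ℂ) *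
          (((a⁻¹ ^ j : ℝ) : ℂ) * pderiv α (localComp e u K') y) := by
    intro a ha
    have h1 := hP _ (dilChart_mem_maximalAtlas he ha) x ⟨hxs, hxi⟩ K
    rw [comp_dilChart he ha hxs, extend_dilChart, hxy] at h1
    have hκ : (a⁻¹ ^ E.cov * a ^ E.contra : ℝ) ≠ 0 := by positivity
    have h2 : localComp e (P u) K y = (a⁻¹ ^ E.cov * a ^ E.contra : ℝ)⁻¹ •
        (a⁻¹ ^ E.cov * a ^ E.contra : ℝ) • comp e (P u) x K := (inv_smul_smul₀ hκ _).symm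
    rw [h2, h1, Finset.smul_sum]
    refine Finset.sum_congr rfl fun j _ => ?_
    rw [Finset.smul_sum]
    refine Finset.sum_congr rfl fun α _ => ?_
    rw [Finset.smul_sum]
    refine Finset.sum_congr rfl fun K' _ => ?_
    rw [pderiv_dilation α ha ((relOpen_target e).contDiffAt (hu.contDiffOn_interior he K') hy)
      (localComp_dilChart he ha hy u K')]
    rw [mul_smul, ← mul_smul_comm, smul_comm, mul_smul_comm, mul_smul_comm, smul_inv_smul₀ hκ]
    rw [Complex.real_smul]
  -- A dilated chart needs a proof of `0 < a`. The default value for other `a` plays no role, as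
  -- `IsLaurent` refers to positive `a` only.
  set F : (k : ℕ) → ℝ → MetricVar k → ℝ := fun k a => if ha : 0 < a then
    A.metricVarValue (dilChart e a ha) (a • y) else 0 with hF
  have hFa : ∀ k a, 0 < a → ∀ v : MetricVar k, F k a v = a ^ v.weight * A.metricVarValue e y v := by
    intro k a ha v
    simp only [hF, dif_pos ha]
    exact A.metricVarValue_dilChart he ha hy v
  refine IsLaurent.eq_of_const (IsLaurent.congr (isLaurent_sum _ fun j _ => isLaurent_sum _
    fun α _ => isLaurent_sum _ fun K' _ => isLaurent_eval MetricVar.weight (hFa (l - j))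
      (coeff j α K K') j (pderiv α (localComp e u K') y)) fun a ha => ?_)
  rw [key a ha]
  simp only [hF, dif_pos ha]

variable {A}

/-- In every chart, a geometric operator is a polynomial in the vector fields `ρ ∂ᵢ` with
coefficients smooth up to the boundary. -/
theorem IsGeometric.exists_coeffs {l : ℕ} {P : TensorField M E → TensorField M E}
    (hP : A.IsGeometric E l P) (he : e ∈ IsManifold.maximalAtlas (𝓡∂ 3) ∞ M) :
    ∃ c : (j : ℕ) → (Fin j → Fin 3) → Idx E.cov E.contra → Idx E.cov E.contra → E3 → ℂ,
      (∀ j α K K', ContDiffOn ℝ ∞ (c j α K K') (e.extend (𝓡∂ 3)).target) ∧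
      ∀ u, A.IsSmoothSection E u ((𝓡∂ 3).interior M) → ∀ K,
        ∀ y ∈ (e.extend (𝓡∂ 3)).target ∩ Pos, localComp e (P u) K y =
          ∑ j ∈ Finset.range (l + 1), ∑ α : Fin j → Fin 3, ∑ K' : Idx E.cov E.contra,
            (A.rhoLoc e y : ℂ) ^ j * c j α K K' y * pderiv α (localComp e u K') y := by
  obtain ⟨-, coeff, hc⟩ := hP
  have h1 := fun (j : ℕ) (α : Fin j → Fin 3) (K K' : Idx E.cov E.contra) =>
    homOn_weightedEval MetricVar.weight (fun y (hy : y ∈ (e.extend (𝓡∂ 3)).target ∩ Pos) =>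
      A.rhoLoc_pos he hy.1 hy.2) (fun i => A.homOn_metricVarValue he i) j (coeff j α K K')
  choose h hh h2 using h1
  refine ⟨fun j α K K' y => (h j α K K' y : ℂ), fun j α K K' =>
    Complex.ofRealCLM.contDiff.comp_contDiffOn (hh j α K K'), fun u hu K y hy => ?_⟩
  rw [A.comp_eq_weighted hu (hc u hu) he hy K]
  refine Finset.sum_congr rfl fun j _ => Finset.sum_congr rfl fun α _ =>
    Finset.sum_congr rfl fun K' _ => ?_
  rw [show weightedEval _ _ _ _ = _ from h2 j α K K' y hy]
  push_cast
  rw [zpow_natCast]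

/-! ### Geometric operators acting on powers and logarithms of the defining function. -/

lemma contDiffOn_ofReal_rhoLoc (A : AHStructure M) (he : e ∈ IsManifold.maximalAtlas (𝓡∂ 3) ∞ M) :
    ContDiffOn ℝ ∞ (fun y => (A.rhoLoc e y : ℂ)) (e.extend (𝓡∂ 3)).target :=
  Complex.ofRealCLM.contDiff.comp_contDiffOn (A.contDiffOn_rhoLoc he)

lemma localComp_rhoPowLog (A : AHStructure M) (he : e ∈ IsManifold.maximalAtlas (𝓡∂ 3) ∞ M) (z : ℂ)
    (m : ℕ) (U : TensorField M E) (K : Idx E.cov E.contra) {y : E3}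
    (hy : y ∈ (e.extend (𝓡∂ 3)).target ∩ Pos) :
    localComp e (A.rhoPowLog E z m U) K y = powLog z m (A.rhoLoc e y) * localComp e U K y := by
  rw [powLog_of_pos (A.rhoLoc_pos he hy.1 hy.2)]
  rfl

lemma IsSmoothSection.rhoPowLog {U : TensorField M E} (hU : A.IsSmoothSection E U univ) (z : ℂ)
    (m : ℕ) : A.IsSmoothSection E (A.rhoPowLog E z m U) ((𝓡∂ 3).interior M) := by
  refine (hU.mono (subset_univ _)).fsmul fun e he => ?_
  rw [target_inter_preimage_interior he]
  refine ((contDiffOn_powLog z m).comp ((A.contDiffOn_rhoLoc he).mono inter_subset_left)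
    fun y hy => A.rhoLoc_pos he hy.1 hy.2).congr fun y hy => ?_
  rw [Function.comp_apply, powLog_of_pos (A.rhoLoc_pos he hy.1 hy.2)]
  rfl

/-- The action of a geometric operator on products with powers and logarithms of the defining
function. -/
lemma IsGeometric.exists_localComp_rhoPowLog {l : ℕ} {P : TensorField M E → TensorField M E}
    (hP : A.IsGeometric E l P) (he : e ∈ IsManifold.maximalAtlas (𝓡∂ 3) ∞ M)
    {U : TensorField M E} (hU : A.IsSmoothSection E U univ) (z : ℂ) (K : Idx E.cov E.contra) :
    ∃ W : ℕ → E3 → ℂ, (∀ i, ContDiffOn ℝ ∞ (W i) (e.extend (𝓡∂ 3)).target) ∧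
      ∀ m, ∀ y ∈ (e.extend (𝓡∂ 3)).target ∩ Pos,
        localComp e (P (A.rhoPowLog E z m U)) K y = ∑ i ∈ Finset.range (m + 1),
          (m.descFactorial i : ℂ) * (powLog z (m - i) (A.rhoLoc e y) * W i y) := by
  obtain ⟨c, hc, hc1⟩ := hP.exists_coeffs he
  have h1 := fun (j : ℕ) (α : Fin j → Fin 3) (K' : Idx E.cov E.contra) =>
    (relOpen_target e).exists_pderiv_powLog_mul (A.contDiffOn_rhoLoc he)
      (fun y hy => A.rhoLoc_pos he hy.1 hy.2) z (hU.contDiffOn he K') α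
  choose H hH h2 using h1
  refine ⟨fun i y => ∑ j ∈ Finset.range (l + 1), ∑ α : Fin j → Fin 3, ∑ K' : Idx E.cov E.contra,
    c j α K K' y * H j α K' i y, fun i => ?_, fun m y hy => ?_⟩
  · exact ContDiffOn.sum fun j _ => ContDiffOn.sum fun α _ => ContDiffOn.sum fun K' _ =>
      (hc j α K K').mul (hH j α K' i)
  · rw [hc1 _ (hU.rhoPowLog z m) K y hy]
    simp only [Finset.mul_sum]
    symm
    rw [Finset.sum_comm]
    refine Finset.sum_congr rfl fun j _ => ?_
    rw [Finset.sum_comm]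
    refine Finset.sum_congr rfl fun α _ => ?_
    rw [Finset.sum_comm]
    refine Finset.sum_congr rfl fun K' _ => ?_
    symm
    have h3 : pderiv α (localComp e (A.rhoPowLog E z m U) K') y =
        pderiv α (fun y => powLog z m (A.rhoLoc e y) * localComp e U K' y) y := by
      refine pderiv_congr α ?_
      filter_upwards [(relOpen_target e).isOpen_inter_pos.mem_nhds hy] with w hw
        using A.localComp_rhoPowLog he z m U K' hw
    rw [h3, h2 j α K' m y hy, Finset.mul_sum]
    refine Finset.sum_congr rfl fun i _ => ?_
    have hpos := A.rhoLoc_pos he hy.1 hy.2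
    -- The factor `ρ^j` in front of a `j`-th derivative restores the power lost by differentiation,
    -- so all terms have exponent `z` again.
    have h4 := powLog_add (z := z - j) (w := j) (m := m - i) hpos
    rw [sub_add_cancel, Complex.cpow_natCast] at h4
    rw [h4]
    ring

/-- A geometric operator maps smooth sections to sections smooth up to the boundary. -/
lemma IsGeometric.exists_localComp_eq {l : ℕ} {P : TensorField M E → TensorField M E}
    (hP : A.IsGeometric E l P) (he : e ∈ IsManifold.maximalAtlas (𝓡∂ 3) ∞ M)
    {U : TensorField M E} (hU : A.IsSmoothSection E U univ) (K : Idx E.cov E.contra) :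
    ∃ f : E3 → ℂ, ContDiffOn ℝ ∞ f (e.extend (𝓡∂ 3)).target ∧
      ∀ y ∈ (e.extend (𝓡∂ 3)).target ∩ Pos, localComp e (P U) K y = f y := by
  obtain ⟨c, hc, hc1⟩ := hP.exists_coeffs he
  have h1 := fun (j : ℕ) (α : Fin j → Fin 3) (K' : Idx E.cov E.contra) =>
    (relOpen_target e).exists_pderiv_eq (hU.contDiffOn he K') α
  choose g hg h2 using h1
  refine ⟨fun y => ∑ j ∈ Finset.range (l + 1), ∑ α : Fin j → Fin 3, ∑ K' : Idx E.cov E.contra,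
    (A.rhoLoc e y : ℂ) ^ j * c j α K K' y * g j α K' y, ?_, fun y hy => ?_⟩
  · exact ContDiffOn.sum fun j _ => ContDiffOn.sum fun α _ => ContDiffOn.sum fun K' _ =>
      ((A.contDiffOn_ofReal_rhoLoc he).pow j |>.mul (hc j α K K')).mul (hg j α K')
  · rw [hc1 U (hU.mono (subset_univ _)) K y hy]
    refine Finset.sum_congr rfl fun j _ => Finset.sum_congr rfl fun α _ =>
      Finset.sum_congr rfl fun K' _ => ?_
    rw [h2 j α K' y hy]

end AHStructure

end AsympHyp
end

noncomputable section

set_option linter.unusedSectionVars false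

namespace AsympHyp

open Set Filter

variable {M : Type*} [TopologicalSpace M] [ChartedSpace (EuclideanHalfSpace 3) M]
variable [IsManifold (𝓡∂ 3) ∞ M] {e : OpenPartialHomeomorph M (EuclideanHalfSpace 3)}

namespace AHStructure

variable (A : AHStructure M) {E : TensorType}

/-! ### Finite expansions in powers and logarithms -/

/-- The sum of the terms `ρ^z (log ρ)^m U` of a finite expansion. -/
def logSum (F : (ℂ × ℕ) →₀ TensorField M E) : TensorField M E :=
  fun x => F.sum fun p U => A.rhoPowLog E p.1 p.2 U x

lemma logSum_add (F G : (ℂ × ℕ) →₀ TensorField M E) (x : M) :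
    A.logSum (F + G) x = A.logSum F x + A.logSum G x :=
  Finsupp.sum_add_index' (fun _ => smul_zero _) fun _ _ _ => smul_add _ _ _

lemma logSum_single (p : ℂ × ℕ) (U : TensorField M E) (x : M) :
    A.logSum (Finsupp.single p U) x = A.rhoPowLog E p.1 p.2 U x :=
  Finsupp.sum_single_index (smul_zero _)

lemma logSum_sum {ι : Type*} (s : Finset ι) (F : ι → (ℂ × ℕ) →₀ TensorField M E) (x : M) :
    A.logSum (∑ i ∈ s, F i) x = ∑ i ∈ s, A.logSum (F i) x := by
  classical
  induction s using Finset.induction_on with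
  | empty => simp [logSum]
  | insert j s hj ih => rw [Finset.sum_insert hj, Finset.sum_insert hj, logSum_add, ih]

lemma logSum_erase (F : (ℂ × ℕ) →₀ TensorField M E) (p : ℂ × ℕ) (x : M) :
    A.logSum F x = A.rhoPowLog E p.1 p.2 (F p) x + A.logSum (F.erase p) x := by
  conv_lhs => rw [← Finsupp.single_add_erase p F]
  rw [logSum_add, logSum_single]

lemma isSmoothSection_logSum {F : (ℂ × ℕ) →₀ TensorField M E}
    (hF : ∀ p, A.IsSmoothSection E (F p) univ) :
    A.IsSmoothSection E (A.logSum F) ((𝓡∂ 3).interior M) :=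
  IsSmoothSection.sum fun p _ => (hF p).rhoPowLog p.1 p.2

lemma localComp_logSum (he : e ∈ IsManifold.maximalAtlas (𝓡∂ 3) ∞ M)
    (F : (ℂ × ℕ) →₀ TensorField M E) (K : Idx E.cov E.contra) {y : E3}
    (hy : y ∈ (e.extend (𝓡∂ 3)).target ∩ Pos) :
    localComp e (A.logSum F) K y =
      ∑ p ∈ F.support, powLog p.1 p.2 (A.rhoLoc e y) * localComp e (F p) K y := by
  refine (comp_sum e F.support _ _ K).trans (Finset.sum_congr rfl fun p _ => ?_)
  exact A.localComp_rhoPowLog he p.1 p.2 (F p) K hy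

/-- A coefficient that vanishes on the boundary can be absorbed in a term of higher order. -/
lemma exists_logSum_shift {F : (ℂ × ℕ) →₀ TensorField M E}
    (hF : ∀ p, A.IsSmoothSection E (F p) univ) (p : ℂ × ℕ)
    (h0 : ∀ e ∈ IsManifold.maximalAtlas (𝓡∂ 3) ∞ M, ∀ x ∈ e.source, x ∈ (𝓡∂ 3).boundary M →
      ∀ K, comp e (F p) x K = 0) :
    ∃ F' : (ℂ × ℕ) →₀ TensorField M E, (∀ q, A.IsSmoothSection E (F' q) univ) ∧
      (∀ x ∈ (𝓡∂ 3).interior M, A.logSum F' x = A.logSum F x) ∧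
      ∀ q ∈ F'.support, q = (p.1 + 1, p.2) ∨ (q ∈ F.support ∧ q ≠ p) := by
  classical
  obtain ⟨V, hV, hV1⟩ := A.exists_eq_rho_smul (hF p) h0
  refine ⟨F.erase p + Finsupp.single (p.1 + 1, p.2) V, fun q => ?_, fun x hx => ?_, fun q hq => ?_⟩
  · refine IsSmoothSection.add (u := F.erase p q) (v := Finsupp.single (p.1 + 1, p.2) V q) ?_ ?_
    · rw [Finsupp.erase_apply]
      split_ifs
      · exact isSmoothSection_zero
      · exact hF q
    · rw [Finsupp.single_apply]
      split_ifs
      · exact hV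
      · exact isSmoothSection_zero
  · rw [logSum_add, logSum_single, A.logSum_erase F p, add_comm]
    congr 1
    have hρ : (A.ρ x : ℂ) ≠ 0 := by exact_mod_cast (A.ρ_pos x hx).ne'
    unfold rhoPowLog
    rw [hV1 x hx, smul_smul, Complex.cpow_add _ _ hρ, Complex.cpow_one]
    congr 1
    ring
  · rcases Finset.mem_union.1 (Finsupp.support_add hq) with h | h
    · rw [Finsupp.support_erase, Finset.mem_erase] at h
      exact Or.inr ⟨h.2, h.1⟩
    · exact Or.inl (by simpa using Finsupp.support_single_subset h)

/-- Induction principle for raising the exponents of an expansion above a given bound. -/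
lemma exists_le_re {X : Type*} [Zero X] (B : ℝ) (C : ((ℂ × ℕ) →₀ X) → Prop)
    (step : ∀ F, C F → (∃ p ∈ F.support, p.1.re < B) → ∃ p ∈ F.support, p.1.re < B ∧
      ∃ F', C F' ∧ ∀ q ∈ F'.support, q = (p.1 + 1, p.2) ∨ (q ∈ F.support ∧ q ≠ p))
    (F : (ℂ × ℕ) →₀ X) (hF : C F) : ∃ F', C F' ∧ ∀ p ∈ F'.support, B ≤ p.1.re := by
  classical
  -- The measure counts the unit steps by which the exponents fall short of `B`. It drops also when
  -- the raised term merges with one already present, and exponents beyond `B` contribute zero.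
  induction h : ∑ p ∈ F.support, ⌈B - p.1.re⌉₊ using Nat.strong_induction_on generalizing F with
  | h n ih =>
    by_cases hex : ∃ p ∈ F.support, p.1.re < B
    · obtain ⟨p, hp, hpB, F', hF', hsub⟩ := step F hF hex
      refine ih _ ?_ F' hF' rfl
      have h1 : F'.support ⊆ insert (p.1 + 1, p.2) (F.support.erase p) := fun q hq => by
        rcases hsub q hq with h | h
        · exact h ▸ Finset.mem_insert_self _ _
        · exact Finset.mem_insert_of_mem (Finset.mem_erase.2 ⟨h.2, h.1⟩)
      have h2 : ∑ q ∈ F'.support, ⌈B - q.1.re⌉₊ ≤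
          ⌈B - (p.1 + 1).re⌉₊ + ∑ q ∈ F.support.erase p, ⌈B - q.1.re⌉₊ := by
        refine (Finset.sum_le_sum_of_subset h1).trans ?_
        by_cases hm : (p.1 + 1, p.2) ∈ F.support.erase p
        · rw [Finset.insert_eq_of_mem hm]
          exact Nat.le_add_left _ _
        · rw [Finset.sum_insert hm]
      have h3 := Finset.add_sum_erase F.support (fun q => ⌈B - q.1.re⌉₊) hp
      have h4 : ⌈B - (p.1 + 1).re⌉₊ < ⌈B - p.1.re⌉₊ := by
        rw [Complex.add_re, Complex.one_re, ← sub_sub, Nat.ceil_sub_one]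
        have : 0 < ⌈B - p.1.re⌉₊ := Nat.ceil_pos.2 (by linarith)
        omega
      omega
    · push Not at hex
      exact ⟨F, hF, hex⟩

/-! ### Linearity of geometric operators -/

section Linear

variable {A} {l : ℕ} {P : TensorField M E → TensorField M E}

/-- `P` takes fields with arbitrary values on the boundary; the coordinate formula shows that these
values do not matter in the interior. -/
lemma IsGeometric.localComp_congr (hP : A.IsGeometric E l P)
    (he : e ∈ IsManifold.maximalAtlas (𝓡∂ 3) ∞ M) {u v : TensorField M E}
    (hu : A.IsSmoothSection E u ((𝓡∂ 3).interior M)) (h : ∀ x ∈ (𝓡∂ 3).interior M, v x = u x)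
    (K : Idx E.cov E.contra) {y : E3} (hy : y ∈ (e.extend (𝓡∂ 3)).target ∩ Pos) :
    localComp e (P v) K y = localComp e (P u) K y := by
  obtain ⟨c, -, hc⟩ := hP.exists_coeffs he
  rw [hc u hu K y hy, hc v (hu.congr h) K y hy]
  refine Finset.sum_congr rfl fun j _ => Finset.sum_congr rfl fun α _ =>
    Finset.sum_congr rfl fun K' _ => ?_
  congr 1
  refine pderiv_congr α ?_
  filter_upwards [(relOpen_target e).isOpen_inter_pos.mem_nhds hy] with w hw
  exact comp_congr e (h _ ((symm_mem_interior_iff he hw.1).2 hw.2)) K'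

lemma IsGeometric.localComp_add (hP : A.IsGeometric E l P)
    (he : e ∈ IsManifold.maximalAtlas (𝓡∂ 3) ∞ M) {u v : TensorField M E}
    (hu : A.IsSmoothSection E u ((𝓡∂ 3).interior M))
    (hv : A.IsSmoothSection E v ((𝓡∂ 3).interior M))
    (K : Idx E.cov E.contra) {y : E3} (hy : y ∈ (e.extend (𝓡∂ 3)).target ∩ Pos) :
    localComp e (P fun x => u x + v x) K y = localComp e (P u) K y + localComp e (P v) K y := by
  obtain ⟨c, -, hc⟩ := hP.exists_coeffs he
  rw [hc u hu K y hy, hc v hv K y hy, hc _ (hu.add hv) K y hy]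
  simp only [← Finset.sum_add_distrib]
  refine Finset.sum_congr rfl fun j _ => Finset.sum_congr rfl fun α _ =>
    Finset.sum_congr rfl fun K' _ => ?_
  rw [← mul_add]
  congr 1
  have h1 := (relOpen_target e).contDiffAt (hu.contDiffOn_interior he K') hy
  have h2 := (relOpen_target e).contDiffAt (hv.contDiffOn_interior he K') hy
  have h3 := iteratedFDeriv_add_apply (𝕜 := ℝ) (i := j) (h1.of_le (by exact_mod_cast le_top))
    (h2.of_le (by exact_mod_cast le_top))
  exact congrArg (fun L => L fun a => EuclideanSpace.single (α a) (1 : ℝ)) h3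

lemma IsGeometric.localComp_zero (hP : A.IsGeometric E l P)
    (he : e ∈ IsManifold.maximalAtlas (𝓡∂ 3) ∞ M)
    (K : Idx E.cov E.contra) {y : E3} (hy : y ∈ (e.extend (𝓡∂ 3)).target ∩ Pos) :
    localComp e (P 0) K y = 0 := by
  have h := hP.localComp_add he (isSmoothSection_zero (A := A)) isSmoothSection_zero K hy
  have h1 : (fun x => (0 : TensorField M E) x + (0 : TensorField M E) x) = 0 := by
    funext x
    exact add_zero _
  rw [h1] at h
  exact left_eq_add.1 h

lemma IsGeometric.localComp_sum (hP : A.IsGeometric E l P)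
    (he : e ∈ IsManifold.maximalAtlas (𝓡∂ 3) ∞ M) {ι : Type*} (s : Finset ι)
    {u : ι → TensorField M E} (hu : ∀ i ∈ s, A.IsSmoothSection E (u i) ((𝓡∂ 3).interior M))
    (K : Idx E.cov E.contra) {y : E3} (hy : y ∈ (e.extend (𝓡∂ 3)).target ∩ Pos) :
    localComp e (P fun x => ∑ i ∈ s, u i x) K y = ∑ i ∈ s, localComp e (P (u i)) K y := by
  classical
  induction s using Finset.induction_on with
  | empty => exact hP.localComp_zero he K hy
  | insert j s hj ih =>
    simp only [Finset.sum_insert hj]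
    have hs : ∀ i ∈ s, A.IsSmoothSection E (u i) ((𝓡∂ 3).interior M) := fun i hi =>
      hu i (Finset.mem_insert_of_mem hi)
    rw [hP.localComp_add he (hu j (Finset.mem_insert_self _ _)) (IsSmoothSection.sum hs) K hy,
      ih hs]

/-! ### Remainder terms -/

lemma InC.eventually_norm_le [LocallyCompactSpace M] {k : ℕ} {t : ℝ} {R : TensorField M E}
    (hR : A.InC E k t R) (he : e ∈ IsManifold.maximalAtlas (𝓡∂ 3) ∞ M) {y : E3}
    (hy : y ∈ (e.extend (𝓡∂ 3)).target) :
    ∃ C : ℝ, ∀ᶠ z in 𝓝[(e.extend (𝓡∂ 3)).target ∩ Pos] y, ∀ j ≤ k, ∀ K,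
      ‖iteratedFDeriv ℝ j (localComp e R K) z‖ ≤ C * A.rhoLoc e z ^ (t - E.weight - j) := by
  obtain ⟨Q, hQ, hQe, hQc⟩ := local_compact_nhds (e.open_source.mem_nhds (extend_symm_mem hy))
  obtain ⟨C, hC⟩ := hR.2 e he Q hQc hQe
  refine ⟨C, ?_⟩
  have h1 : Tendsto (e.extend (𝓡∂ 3)).symm (𝓝[(e.extend (𝓡∂ 3)).target ∩ Pos] y)
      (𝓝 ((e.extend (𝓡∂ 3)).symm y)) :=
    ((contMDiffOn_extend_symm_target he).continuousOn y hy).tendsto.mono_left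
      (nhdsWithin_mono _ inter_subset_left)
  filter_upwards [h1.eventually hQ, self_mem_nhdsWithin] with z hz hz1 j hj K
  have h2 := hC _ ⟨hz, (symm_mem_interior_iff he hz1.1).2 hz1.2⟩ j hj K
  rwa [(e.extend (𝓡∂ 3)).right_inv hz1.1] at h2

lemma norm_pderiv_le {F : Type*} [NormedAddCommGroup F] [NormedSpace ℝ F] {j : ℕ}
    (α : Fin j → Fin 3) (f : E3 → F) (y : E3) : ‖pderiv α f y‖ ≤ ‖iteratedFDeriv ℝ j f y‖ := by
  refine (ContinuousMultilinearMap.le_opNorm _ _).trans ?_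
  simp

/-- A geometric operator preserves the rate of decay. -/
lemma IsGeometric.eventually_norm_le [LocallyCompactSpace M] (hP : A.IsGeometric E l P)
    {t : ℝ} {R : TensorField M E} (hRs : A.IsSmoothSection E R ((𝓡∂ 3).interior M))
    (hR : A.InC E l t R) (he : e ∈ IsManifold.maximalAtlas (𝓡∂ 3) ∞ M) {y : E3}
    (hy : y ∈ (e.extend (𝓡∂ 3)).target) (K : Idx E.cov E.contra) :
    ∃ C : ℝ, ∀ᶠ z in 𝓝[(e.extend (𝓡∂ 3)).target ∩ Pos] y,
      ‖localComp e (P R) K z‖ ≤ C * A.rhoLoc e z ^ (t - E.weight) := by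
  obtain ⟨c, hc, hc1⟩ := hP.exists_coeffs he
  obtain ⟨C, hC⟩ := hR.eventually_norm_le he hy
  refine ⟨∑ j ∈ Finset.range (l + 1), ∑ α : Fin j → Fin 3, ∑ K' : Idx E.cov E.contra,
    (‖c j α K K' y‖ + 1) * C, ?_⟩
  have h1 : ∀ᶠ z in 𝓝[(e.extend (𝓡∂ 3)).target ∩ Pos] y, ∀ j ∈ Finset.range (l + 1),
      ∀ α : Fin j → Fin 3, ∀ K' : Idx E.cov E.contra, ‖c j α K K' z‖ ≤ ‖c j α K K' y‖ + 1 := by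
    rw [Finset.eventually_all]
    intro j _
    rw [eventually_all]
    intro α
    rw [eventually_all]
    intro K'
    have h2 : Tendsto (fun z => ‖c j α K K' z‖) (𝓝[(e.extend (𝓡∂ 3)).target ∩ Pos] y)
        (𝓝 ‖c j α K K' y‖) := (((hc j α K K').continuousOn y hy).tendsto.mono_left
      (nhdsWithin_mono _ inter_subset_left)).norm
    exact (h2.eventually (gt_mem_nhds (lt_add_one _))).mono fun z hz => le_of_lt hz
  filter_upwards [hC, h1, self_mem_nhdsWithin] with z hz hz1 hz2
  have hpos := A.rhoLoc_pos he hz2.1 hz2.2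
  rw [hc1 R hRs K z hz2]
  refine (norm_sum_le _ _).trans ?_
  rw [Finset.sum_mul]
  refine Finset.sum_le_sum fun j hj => (norm_sum_le _ _).trans ?_
  rw [Finset.sum_mul]
  refine Finset.sum_le_sum fun α _ => (norm_sum_le _ _).trans ?_
  rw [Finset.sum_mul]
  refine Finset.sum_le_sum fun K' _ => ?_
  have h2 := (norm_pderiv_le α (localComp e R K') z).trans
    (hz j (Nat.lt_succ_iff.1 (Finset.mem_range.1 hj)) K')
  rw [norm_mul, norm_mul, norm_pow, Complex.norm_real, Real.norm_of_nonneg hpos.le]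
  -- The factor `ρ^j` of the coefficient makes up for the loss of `ρ^(-j)` that `InC` allows in a
  -- `j`-th derivative.
  have h3 : A.rhoLoc e z ^ (t - E.weight) =
      A.rhoLoc e z ^ j * A.rhoLoc e z ^ (t - E.weight - j) := by
    rw [← Real.rpow_natCast, ← Real.rpow_add hpos]
    congr 1
    ring
  rw [h3]
  calc _ ≤ A.rhoLoc e z ^ j * (‖c j α K K' y‖ + 1) * (C * A.rhoLoc e z ^ (t - E.weight - j)) := by
        gcongr
        exact hz1 j hj α K'
    _ = _ := by ring

end Linear

end AHStructure

end AsympHyp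
end

noncomputable section

set_option linter.unusedSectionVars false

namespace AsympHyp

open Set Filter

/-! ### Leading terms -/

/-- The terms dominating as `ρ → 0` have the least real part and, among these, the highest power of
the logarithm. Imaginary parts do not affect the size. -/
lemma exists_leading {S : Finset (ℂ × ℕ)} (hS : S.Nonempty) :
    ∃ p ∈ S, (∀ q ∈ S, p.1.re ≤ q.1.re) ∧ ∀ q ∈ S, q.1.re = p.1.re → q.2 ≤ p.2 := by
  obtain ⟨p, hp, h1⟩ := S.exists_min_image (fun p => p.1.re) hS
  obtain ⟨p', hp', h2⟩ := (S.filter fun q => q.1.re = p.1.re).exists_max_image (fun p => p.2)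
    ⟨p, Finset.mem_filter.2 ⟨hp, rfl⟩⟩
  rw [Finset.mem_filter] at hp'
  exact ⟨p', hp'.1, fun q hq => hp'.2 ▸ h1 q hq, fun q hq hq1 =>
    h2 q (Finset.mem_filter.2 ⟨hq, hq1.trans hp'.2⟩)⟩

section Leading

variable {X : Type*} {l : Filter X} {β : X → ℝ}

/-- Only the terms with real part `σ` and logarithmic power `m` survive the normalization; they
oscillate with distinct frequencies, their imaginary parts, and so are independent. A nonzero limit
`L` is harmless if the frequency zero, which is the term `(σ, m)`, does not occur. -/
lemma eq_zero_of_tendsto_leadNorm_mul_sum (hβ : Tendsto β l (𝓝[>] 0)) (hβ' : 𝓝[>] 0 ≤ map β l)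
    {S : Finset (ℂ × ℕ)} {G : ℂ × ℕ → X → ℂ} {c : ℂ × ℕ → ℂ}
    (hG : ∀ p ∈ S, Tendsto (G p) l (𝓝 (c p))) {σ : ℝ} {m : ℕ} (hσ : ∀ p ∈ S, σ ≤ p.1.re)
    (hm : ∀ p ∈ S, p.1.re = σ → p.2 ≤ m) {L : ℂ}
    (h : Tendsto (fun x => leadNorm σ m (β x) * ∑ p ∈ S, powLog p.1 p.2 (β x) * G p x) l (𝓝 L))
    (hL : L = 0 ∨ ((σ : ℂ), m) ∉ S) : ∀ p ∈ S, p.1.re = σ → p.2 = m → c p = 0 := by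
  classical
  set S' := S.filter fun p => p.1.re = σ ∧ p.2 = m with hS'
  have h1 := tendsto_finsetSum S fun p hp => tendsto_leadNorm_mul_powLog_mul hβ (hσ p hp)
    (hm p hp) (hG p hp)
  rw [Finset.sum_const_zero] at h1
  have h2 := h.sub h1
  rw [sub_zero] at h2
  have hinj : Set.InjOn (fun p : ℂ × ℕ => p.1.im) S' := by
    intro p hp q hq hpq
    rw [Finset.mem_coe, hS', Finset.mem_filter] at hp hq
    exact Prod.ext (Complex.ext (hp.2.1.trans hq.2.1.symm) hpq) (hp.2.2.trans hq.2.2.symm)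
  have hback : ∀ p ∈ S', p = ((⟨σ, p.1.im⟩ : ℂ), m) := by
    intro p hp
    rw [hS', Finset.mem_filter] at hp
    exact Prod.ext (Complex.ext hp.2.1 rfl) hp.2.2
  have h3 := eq_zero_of_tendsto_sum_powLog hβ' (S'.image fun p => p.1.im)
    (fun τ => c ((⟨σ, τ⟩ : ℂ), m)) L (h2.congr fun x => by
      rw [Finset.sum_image hinj, Finset.sum_sub_distrib, Finset.mul_sum, sub_sub_cancel,
        hS', Finset.sum_filter]
      refine Finset.sum_congr rfl fun p hp => ?_
      split_ifs with hp1
      · rw [← hback p (Finset.mem_filter.2 ⟨hp, hp1⟩)]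
      · rfl) (hL.imp id fun hn h0 => by
      obtain ⟨p, hp, hp0⟩ := Finset.mem_image.1 h0
      refine hn ?_
      have h4 := hback p hp
      have h5 : ((σ : ℂ), m) = p := by
        rw [h4, hp0]
        rfl
      rw [h5]
      exact (Finset.mem_filter.1 hp).1)
  intro p hp hp1 hp2
  have hpS : p ∈ S' := Finset.mem_filter.2 ⟨hp, hp1, hp2⟩
  rw [hback p hpS]
  exact h3 _ (Finset.mem_image_of_mem _ hpS)

/-- In an expansion with logarithms that arise from differentiation, the terms in which a logarithm
has been differentiated are of lower order. -/
lemma tendsto_leadNorm_mul_sub (hβ : Tendsto β l (𝓝[>] 0)) {S : Finset (ℂ × ℕ)}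
    {W : ℂ × ℕ → ℕ → X → ℂ} {c : ℂ × ℕ → ℕ → ℂ}
    (hW : ∀ p ∈ S, ∀ i, Tendsto (W p i) l (𝓝 (c p i))) {σ : ℝ} {m : ℕ}
    (hσ : ∀ p ∈ S, σ ≤ p.1.re) (hm : ∀ p ∈ S, p.1.re = σ → p.2 ≤ m) :
    Tendsto (fun x => leadNorm σ m (β x) * ((∑ p ∈ S, ∑ i ∈ Finset.range (p.2 + 1),
      (p.2.descFactorial i : ℂ) * (powLog p.1 (p.2 - i) (β x) * W p i x)) -
        ∑ p ∈ S, powLog p.1 p.2 (β x) * W p 0 x)) l (𝓝 0) := by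
  have h1 : ∀ p ∈ S, ∀ i ∈ Finset.range p.2, Tendsto (fun x => (p.2.descFactorial (i + 1) : ℂ) *
      (leadNorm σ m (β x) * (powLog p.1 (p.2 - (i + 1)) (β x) * W p (i + 1) x))) l (𝓝 0) := by
    intro p hp i hi
    rw [Finset.mem_range] at hi
    have h2 := tendsto_leadNorm_mul_powLog_mul hβ (m := p.2 - (i + 1)) (M := m) (hσ p hp)
      (fun h => by have := hm p hp h; omega) (hW p hp (i + 1))
    have h3 : ¬ (p.1.re = σ ∧ p.2 - (i + 1) = m) := fun h => by
      have := hm p hp h.1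
      have := h.2
      omega
    simp only [if_neg h3, sub_zero] at h2
    simpa using h2.const_mul (p.2.descFactorial (i + 1) : ℂ)
  have h4 := tendsto_finsetSum S fun p hp => tendsto_finsetSum (Finset.range p.2) (h1 p hp)
  simp only [Finset.sum_const_zero] at h4
  refine h4.congr fun x => ?_
  rw [← Finset.sum_sub_distrib, Finset.mul_sum]
  refine Finset.sum_congr rfl fun p _ => ?_
  rw [Finset.sum_range_succ', Nat.descFactorial_zero, Nat.sub_zero, Nat.cast_one, one_mul,
    add_sub_cancel_right, Finset.mul_sum]
  refine Finset.sum_congr rfl fun i _ => ?_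
  ring

lemma tendsto_leadNorm_mul_sum_zero (hβ : Tendsto β l (𝓝[>] 0)) {S : Finset (ℂ × ℕ)}
    {G : ℂ × ℕ → X → ℂ} {c : ℂ × ℕ → ℂ} (hG : ∀ p ∈ S, Tendsto (G p) l (𝓝 (c p))) {σ : ℝ} {m : ℕ}
    (hσ : ∀ p ∈ S, σ < p.1.re) :
    Tendsto (fun x => leadNorm σ m (β x) * ∑ p ∈ S, powLog p.1 p.2 (β x) * G p x) l (𝓝 0) := by
  have h1 := tendsto_finsetSum S fun p hp => tendsto_leadNorm_mul_powLog_mul (M := m) (m := p.2) hβ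
    (hσ p hp).le (fun h => absurd h (hσ p hp).ne') (hG p hp)
  rw [Finset.sum_const_zero] at h1
  refine h1.congr fun x => ?_
  rw [Finset.mul_sum]
  refine Finset.sum_congr rfl fun p hp => ?_
  rw [if_neg fun h => (hσ p hp).ne' h.1, sub_zero]

end Leading

variable {M : Type*} [TopologicalSpace M] [ChartedSpace (EuclideanHalfSpace 3) M]
variable [IsManifold (𝓡∂ 3) ∞ M] {e : OpenPartialHomeomorph M (EuclideanHalfSpace 3)}

namespace AHStructure

variable {A : AHStructure M} {E : TensorType}

lemma InC.tendsto_leadNorm [LocallyCompactSpace M] {σ t : ℝ} {m : ℕ} {R : TensorField M E}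
    (hR : A.InC E 0 (t + E.weight) R) (ht : σ < t) (he : e ∈ IsManifold.maximalAtlas (𝓡∂ 3) ∞ M)
    {y : E3} (hy : y ∈ (e.extend (𝓡∂ 3)).target) (h0 : y 0 = 0) (K : Idx E.cov E.contra) :
    Tendsto (fun z => leadNorm σ m (A.rhoLoc e z) * localComp e R K z)
      (𝓝[(e.extend (𝓡∂ 3)).target ∩ Pos] y) (𝓝 0) := by
  obtain ⟨C, hC⟩ := hR.eventually_norm_le he hy
  refine tendsto_leadNorm_mul_of_norm_le (C := C) (A.tendsto_rhoLoc he hy h0) ht m ?_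
  filter_upwards [hC] with z hz
  have := hz 0 le_rfl K
  rwa [norm_iteratedFDeriv_zero, add_sub_cancel_right, Nat.cast_zero, sub_zero] at this

lemma tendsto_of_contDiffOn {f : E3 → ℂ} (hf : ContDiffOn ℝ ∞ f (e.extend (𝓡∂ 3)).target) {y : E3}
    (hy : y ∈ (e.extend (𝓡∂ 3)).target) :
    Tendsto f (𝓝[(e.extend (𝓡∂ 3)).target ∩ Pos] y) (𝓝 (f y)) :=
  (hf.continuousOn y hy).tendsto.mono_left (nhdsWithin_mono _ inter_subset_left)

/-- The leading coefficients of the expansion of a rapidly decaying field vanish. -/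
lemma comp_eq_zero_of_decay [LocallyCompactSpace M] {δ B : ℝ} {b R : TensorField M E}
    {F : (ℂ × ℕ) →₀ TensorField M E} (hF : ∀ p, A.IsSmoothSection E (F p) univ)
    (hb : ∀ t < δ, A.InC E 0 (t + E.weight) b) (hR : A.InC E 0 (B + E.weight) R)
    (hbF : ∀ x ∈ (𝓡∂ 3).interior M, b x = A.logSum F x + R x) {p : ℂ × ℕ} (hp : p ∈ F.support)
    (hδ : p.1.re < δ) (hB : p.1.re < B) (hmin : ∀ q ∈ F.support, p.1.re ≤ q.1.re)
    (hmax : ∀ q ∈ F.support, q.1.re = p.1.re → q.2 ≤ p.2)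
    (he : e ∈ IsManifold.maximalAtlas (𝓡∂ 3) ∞ M) {x : M} (hx : x ∈ e.source)
    (hxb : x ∈ (𝓡∂ 3).boundary M) (K : Idx E.cov E.contra) : comp e (F p) x K = 0 := by
  have hy := extend_mem hx
  have h0 := extend_zero_of_boundary he hx hxb
  set y := e.extend (𝓡∂ 3) x with hyx
  -- Decay of `b` is known at every rate below `δ`, not at `δ` itself.
  obtain ⟨t, ht, ht'⟩ := exists_between hδ
  have h1 := (hb t ht').tendsto_leadNorm (m := p.2) ht he hy h0 K
  have h2 := hR.tendsto_leadNorm (m := p.2) hB he hy h0 K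
  have h3 := h1.sub h2
  rw [sub_zero] at h3
  have h4 : Tendsto (fun z => leadNorm p.1.re p.2 (A.rhoLoc e z) *
      ∑ q ∈ F.support, powLog q.1 q.2 (A.rhoLoc e z) * localComp e (F q) K z)
      (𝓝[(e.extend (𝓡∂ 3)).target ∩ Pos] y) (𝓝 0) := by
    refine h3.congr' ?_
    filter_upwards [self_mem_nhdsWithin] with z hz
    rw [← A.localComp_logSum he F K hz, ← mul_sub]
    congr 1
    have h5 : localComp e b K z = localComp e (A.logSum F) K z + localComp e R K z :=
      comp_congr e (v := fun x => A.logSum F x + R x)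
        (hbF _ ((symm_mem_interior_iff he hz.1).2 hz.2)) K
    rw [h5, add_sub_cancel_right]
  have h6 := eq_zero_of_tendsto_leadNorm_mul_sum (A.tendsto_rhoLoc he hy h0)
    (A.nhdsGT_le_map_rhoLoc he hy h0)
    (fun q _ => tendsto_of_contDiffOn ((hF q).contDiffOn he K) hy) hmin hmax h4 (Or.inl rfl)
    p hp rfl rfl
  unfold localComp at h6
  rwa [extend_left_inv hx] at h6

end AHStructure

end AsympHyp
end

noncomputable section

set_option linter.unusedSectionVars false

namespace AsympHyp

open Set Filter

variable {M : Type*} [TopologicalSpace M] [ChartedSpace (EuclideanHalfSpace 3) M]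
variable [IsManifold (𝓡∂ 3) ∞ M] {e : OpenPartialHomeomorph M (EuclideanHalfSpace 3)}

namespace AHStructure

variable {A : AHStructure M} {E : TensorType}

/-! ### Vanishing of the indicial map on leading coefficients -/

/-- A function smooth up to the boundary that decays faster than `ρ^i` for all natural `i < σ` is
divisible by `ρ^k` for `k` the least natural number not below `σ`. -/
lemma exists_eq_rhoLoc_pow_mul (A : AHStructure M) (he : e ∈ IsManifold.maximalAtlas (𝓡∂ 3) ∞ M)
    {σ : ℝ} {g : E3 → ℂ} (hg : ContDiffOn ℝ ∞ g (e.extend (𝓡∂ 3)).target)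
    (h : ∀ y ∈ (e.extend (𝓡∂ 3)).target, y 0 = 0 → ∀ i : ℕ, (i : ℝ) < σ →
      Tendsto (fun z => leadNorm i 0 (A.rhoLoc e z) * g z)
        (𝓝[(e.extend (𝓡∂ 3)).target ∩ Pos] y) (𝓝 0)) (k : ℕ) (hk : ∀ i < k, (i : ℝ) < σ) :
    ∃ f : E3 → ℂ, ContDiffOn ℝ ∞ f (e.extend (𝓡∂ 3)).target ∧
      ∀ y ∈ (e.extend (𝓡∂ 3)).target, g y = (A.rhoLoc e y : ℂ) ^ k * f y := by
  induction k with
  | zero => exact ⟨g, hg, fun y _ => by simp⟩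
  | succ k ih =>
    obtain ⟨f, hf, hgf⟩ := ih fun i hi => hk i (hi.trans (Nat.lt_succ_self k))
    obtain ⟨f', hf', hff'⟩ := A.exists_eq_rhoLoc_mul he hf fun y hy h0 => by
      have hnb := (relOpen_target e).neBot hy
      refine tendsto_nhds_unique (tendsto_of_contDiffOn hf hy) ?_
      refine (h y hy h0 k (hk k (Nat.lt_succ_self k))).congr' ?_
      filter_upwards [self_mem_nhdsWithin] with z hz
      have hpos : (A.rhoLoc e z : ℂ) ≠ 0 := by exact_mod_cast (A.rhoLoc_pos he hz.1 hz.2).ne'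
      rw [hgf z hz.1]
      unfold leadNorm
      rw [pow_zero, inv_one, mul_one, Complex.ofReal_natCast, Complex.cpow_neg,
        Complex.cpow_natCast, inv_mul_cancel_left₀ (pow_ne_zero _ hpos)]
    refine ⟨f', hf', fun y hy => ?_⟩
    rw [hgf y hy, hff' y hy]
    ring

section Expansion

variable {P : TensorField M E → TensorField M E} (hP : A.IsGeometric E 2 P)
  {a u v R : TensorField M E} {F : (ℂ × ℕ) →₀ TensorField M E}
  (ha : A.IsSmoothSection E a univ) (hF : ∀ p, A.IsSmoothSection E (F p) univ)
  (hRs : A.IsSmoothSection E R ((𝓡∂ 3).interior M))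
  (huF : ∀ x ∈ (𝓡∂ 3).interior M, u x = a x + A.logSum F x + R x)
  (hv : A.IsSmoothSection E v univ) (hvu : ∀ x ∈ (𝓡∂ 3).interior M, v x = P u x)

include hP ha hF hRs huF hv hvu

/-- `P u` and `P a` are both smooth up to the boundary, so their difference is. Smoothness of `P u`
enters the argument only here. -/
lemma exists_localComp_logSum_add (he : e ∈ IsManifold.maximalAtlas (𝓡∂ 3) ∞ M)
    (K : Idx E.cov E.contra) :
    ∃ g : E3 → ℂ, ContDiffOn ℝ ∞ g (e.extend (𝓡∂ 3)).target ∧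
      ∀ y ∈ (e.extend (𝓡∂ 3)).target ∩ Pos,
        g y = localComp e (P (A.logSum F)) K y + localComp e (P R) K y := by
  obtain ⟨f, hf, hPf⟩ := hP.exists_localComp_eq he ha K
  refine ⟨fun y => localComp e v K y - f y, (hv.contDiffOn he K).sub hf, fun y hy => ?_⟩
  have has := ha.mono (subset_univ ((𝓡∂ 3).interior M))
  have hFs := A.isSmoothSection_logSum hF
  have h1 : localComp e v K y = localComp e (P u) K y :=
    comp_congr e (hvu _ ((symm_mem_interior_iff he hy.1).2 hy.2)) K
  change localComp e v K y - f y = _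
  rw [h1, hP.localComp_congr he ((has.add hFs).add hRs) huF K hy,
    hP.localComp_add he (has.add hFs) hRs K hy, hP.localComp_add he has hFs K hy, ← hPf y hy]
  ring

/-- The indicial map annihilates the leading coefficients of the singular part of the expansion of
a section `u` for which `P u` is smooth up to the boundary. -/
lemma hasIndicialValue_zero [LocallyCompactSpace M] {B : ℝ} (hR : A.InC E 2 (B + E.weight) R)
    {p : ℂ × ℕ} (hp : p ∈ F.support) (hB : p.1.re < B) (hmin : ∀ q ∈ F.support, p.1.re ≤ q.1.re)
    (hmax : ∀ q ∈ F.support, q.1.re = p.1.re → q.2 ≤ p.2)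
    (hno : ∀ n : ℕ, (n : ℝ) = p.1.re → ((n : ℂ), 0) ∉ F.support) {x₀ : M}
    (hx₀ : x₀ ∈ (𝓡∂ 3).boundary M) : A.HasIndicialValue E P p.1 x₀ (F p) 0 := by
  intro e he hx K
  change Tendsto _ _ (𝓝 0)
  have hy := extend_mem hx
  have h0 := extend_zero_of_boundary he hx hx₀
  set y := e.extend (𝓡∂ 3) x₀ with hyx
  set σ := p.1.re with hσ
  obtain ⟨g, hg, hg1⟩ := exists_localComp_logSum_add hP ha hF hRs huF hv hvu he K
  choose W hW hW1 using fun q : ℂ × ℕ => hP.exists_localComp_rhoPowLog he (hF q) q.1 K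
  have hWt : ∀ y ∈ (e.extend (𝓡∂ 3)).target, ∀ q ∈ F.support, ∀ i,
      Tendsto (W q i) (𝓝[(e.extend (𝓡∂ 3)).target ∩ Pos] y) (𝓝 (W q i y)) :=
    fun y hy q _ i => tendsto_of_contDiffOn (hW q i) hy
  have hPF : ∀ z ∈ (e.extend (𝓡∂ 3)).target ∩ Pos, localComp e (P (A.logSum F)) K z =
      ∑ q ∈ F.support, ∑ i ∈ Finset.range (q.2 + 1), (q.2.descFactorial i : ℂ) *
        (powLog q.1 (q.2 - i) (A.rhoLoc e z) * W q i z) := by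
    intro z hz
    refine (hP.localComp_sum he F.support (fun q _ => (hF q).rhoPowLog q.1 q.2) K hz).trans ?_
    exact Finset.sum_congr rfl fun q _ => hW1 q q.2 z hz
  have hPR : ∀ y ∈ (e.extend (𝓡∂ 3)).target, y 0 = 0 → ∀ (τ : ℝ) (m : ℕ), τ ≤ σ →
      Tendsto (fun z => leadNorm τ m (A.rhoLoc e z) * localComp e (P R) K z)
        (𝓝[(e.extend (𝓡∂ 3)).target ∩ Pos] y) (𝓝 0) := by
    intro y hy h0 τ m hτ
    obtain ⟨C, hC⟩ := hP.eventually_norm_le hRs hR he hy K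
    rw [add_sub_cancel_right] at hC
    exact tendsto_leadNorm_mul_of_norm_le (A.tendsto_rhoLoc he hy h0) (hτ.trans_lt hB) m hC
  -- Relative to `ρ^τ (log ρ)^m`, the terms with a differentiated logarithm and the remainder `P R`
  -- are negligible.
  have hlead : ∀ y ∈ (e.extend (𝓡∂ 3)).target, y 0 = 0 → ∀ (τ : ℝ) (m : ℕ), τ ≤ σ →
      (∀ q ∈ F.support, q.1.re = τ → q.2 ≤ m) →
      Tendsto (fun z => leadNorm τ m (A.rhoLoc e z) * g z - leadNorm τ m (A.rhoLoc e z) *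
        ∑ q ∈ F.support, powLog q.1 q.2 (A.rhoLoc e z) * W q 0 z)
        (𝓝[(e.extend (𝓡∂ 3)).target ∩ Pos] y) (𝓝 0) := by
    intro y hy h0 τ m hτ hm
    have h1 := tendsto_leadNorm_mul_sub (A.tendsto_rhoLoc he hy h0) (hWt y hy)
      (fun q hq => hτ.trans (hmin q hq)) hm
    have h2 := h1.add (hPR y hy h0 τ m hτ)
    rw [add_zero] at h2
    refine h2.congr' ?_
    filter_upwards [self_mem_nhdsWithin] with z hz
    rw [hg1 z hz, hPF z hz]
    ring
  have hσk := Nat.le_ceil σ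
  set k := ⌈σ⌉₊ with hk
  -- For natural `i < σ` every term of `g` is small against `ρ^i`; being smooth, `g` is therefore
  -- divisible by `ρ^k`. For `σ ≤ 0` this is empty, with `k = 0`.
  obtain ⟨f, hf, hgf⟩ := A.exists_eq_rhoLoc_pow_mul he hg (σ := σ) (fun y hy h0 i hi => by
    have h1 := hlead y hy h0 i 0 hi.le fun q hq hqi =>
      absurd (hmin q hq) (by rw [hqi]; exact not_le.2 hi)
    have h2 := tendsto_leadNorm_mul_sum_zero (σ := i) (m := 0) (A.tendsto_rhoLoc he hy h0)
      (fun q hq => hWt y hy q hq 0) fun q hq => hi.trans_le (hmin q hq)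
    have h3 := h1.add h2
    rw [add_zero] at h3
    exact h3.congr fun z => by ring) k fun i hi => Nat.lt_ceil.1 hi
  -- Hence the normalized `g` tends to zero, except if `σ` is a natural number and no logarithm is
  -- leading; the limit is then the Taylor coefficient `f y`.
  have hlim : Tendsto (fun z => leadNorm σ p.2 (A.rhoLoc e z) * g z)
      (𝓝[(e.extend (𝓡∂ 3)).target ∩ Pos] y) (𝓝 (if (k : ℝ) = σ ∧ 0 = p.2 then f y else 0)) := by
    have h1 := tendsto_leadNorm_mul_powLog_mul (A.tendsto_rhoLoc he hy h0) (z := (k : ℂ)) (m := 0)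
      (M := p.2) (σ := σ) (by simpa using hσk) (fun _ => Nat.zero_le _)
      (tendsto_of_contDiffOn hf hy)
    have h2 := h1.add_const (if (k : ℝ) = σ ∧ 0 = p.2 then f y else 0)
    rw [zero_add] at h2
    refine h2.congr' ?_
    filter_upwards [self_mem_nhdsWithin] with z hz
    have hpos := A.rhoLoc_pos he hz.1 hz.2
    have h3 : powLog (Complex.I * (k : ℂ).im) 0 (A.rhoLoc e z) = 1 := by
      rw [powLog_of_pos hpos]
      simp
    rw [h3, hgf z hz.1, powLog_of_pos hpos, pow_zero, mul_one, mul_one, Complex.cpow_natCast,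
      Complex.natCast_re, sub_add_cancel]
  have hlim' := hlim.sub (hlead y hy h0 σ p.2 le_rfl hmax)
  simp only [sub_zero, sub_sub_cancel] at hlim'
  have hzero : W p 0 y = 0 := by
    refine eq_zero_of_tendsto_leadNorm_mul_sum (A.tendsto_rhoLoc he hy h0)
      (A.nhdsGT_le_map_rhoLoc he hy h0) (c := fun q => W q 0 y) (fun q hq => hWt y hy q hq 0) hmin
      hmax hlim' ?_ p hp rfl rfl
    -- A Taylor term can be matched only by `ρ^σ` with the real exponent `σ` and no logarithm; `hno`
    -- rules this out.
    split_ifs with hL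
    · right
      rw [← hL.1, ← hL.2, Complex.ofReal_natCast]
      exact hno k hL.1
    · exact Or.inl rfl
  have h5 := (hWt y hy p hp 0).comp (map_extend_nhdsWithin_interior he hx)
  rw [hzero] at h5
  refine h5.congr' ?_
  filter_upwards [self_mem_nhdsWithin,
    mem_nhdsWithin_of_mem_nhds (e.open_source.mem_nhds hx)] with z hz hze
  have hzO : e.extend (𝓡∂ 3) z ∈ (e.extend (𝓡∂ 3)).target ∩ Pos :=
    ⟨extend_mem hze, (mem_interior_iff he hze).1 hz⟩
  -- With no logarithm the formula reads `P (ρ^z U) = ρ^z W₀`. So the boundary value of `W p 0` is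
  -- the indicial value even if `p.2` is positive.
  have h6 := hW1 p 0 _ hzO
  have h7 : A.rhoPowLog E p.1 0 (F p) = A.rhoPow E p.1 (F p) := by
    funext x
    simp [rhoPowLog, rhoPow]
  have h8 : A.rhoLoc e (e.extend (𝓡∂ 3) z) = A.ρ z := by
    unfold rhoLoc
    rw [extend_left_inv hze]
  have hpos := A.ρ_pos z hz
  have hpos' : (A.ρ z : ℂ) ≠ 0 := by exact_mod_cast hpos.ne'
  rw [h7, h8] at h6
  simp only [zero_add, Finset.sum_range_one, Nat.sub_zero, powLog_of_pos hpos, Nat.descFactorial_zero, Nat.cast_one, one_mul,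
    pow_zero, mul_one] at h6
  unfold localComp at h6
  rw [extend_left_inv hze] at h6
  change _ = (A.ρ z : ℂ) ^ (-p.1) * comp e (P (A.rhoPow E p.1 (F p))) z K
  rw [h6, Complex.cpow_neg, inv_mul_cancel_left₀ (by simp [Complex.cpow_eq_zero_iff, hpos']),
    Function.comp_apply]

end Expansion

/-! ### Regularity from expansions of arbitrarily high order. -/

lemma IsSmoothSection.rhoPowLog_nat {U : TensorField M E} (hU : A.IsSmoothSection E U univ)
    (n : ℕ) : A.IsSmoothSection E (A.rhoPowLog E n 0 U) univ := by
  have h : A.IsSmoothSection E (fun x => (A.ρ x : ℂ) ^ n • U x) univ :=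
    hU.fsmul fun e he => by
      rw [preimage_univ, inter_univ]
      exact (A.contDiffOn_ofReal_rhoLoc he).pow n
  refine h.congr fun x _ => ?_
  simp [AHStructure.rhoPowLog]

/-- Zero extension of a rapidly decaying remainder. -/
lemma exists_contDiffOn_remainder [LocallyCompactSpace M] {B : ℝ} {n : ℕ} (hnB : (n : ℝ) < B)
    {R : TensorField M E} (hRs : A.IsSmoothSection E R ((𝓡∂ 3).interior M))
    (hR : A.InC E n (B + E.weight) R) (he : e ∈ IsManifold.maximalAtlas (𝓡∂ 3) ∞ M)
    (K : Idx E.cov E.contra) :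
    ∃ f : E3 → ℂ, ContDiffOn ℝ n f (e.extend (𝓡∂ 3)).target ∧
      ∀ y ∈ (e.extend (𝓡∂ 3)).target, 0 < y 0 → f y = localComp e R K y := by
  refine ⟨_, (relOpen_target e).contDiffOn_extend_zero n
    ((hRs.contDiffOn_interior he K).of_le (by exact_mod_cast le_top)) fun y hy h0 j hj => ?_,
    fun y _ hy0 => if_pos hy0⟩
  obtain ⟨C, hC⟩ := hR.eventually_norm_le he hy
  -- The `j`-th coordinate derivatives are `O(ρ^(B-j))`, and `j ≤ n < B` makes them tend to zero at
  -- the boundary.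
  have hjB : 0 < B - j := by
    have : (j : ℝ) ≤ n := by exact_mod_cast hj
    linarith
  have h1 : Tendsto (fun z => C * A.rhoLoc e z ^ (B - j))
      (𝓝[(e.extend (𝓡∂ 3)).target ∩ Pos] y) (𝓝 0) := by
    have h2 := ((tendsto_rpow_mul_abs_log_pow hjB 0).comp (A.tendsto_rhoLoc he hy h0)).const_mul C
    simpa using h2
  refine squeeze_zero' (Eventually.of_forall fun z => norm_nonneg _) ?_ h1
  filter_upwards [hC] with z hz
  have := hz j hj K
  rwa [add_sub_cancel_right] at this

/-- A section over the interior with expansions into a smooth section and terms of arbitrarily high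
order extends smoothly. -/
theorem extendsSmoothly_of_expansions [LocallyCompactSpace M] {u : TensorField M E}
    (hu : A.IsSmoothSection E u ((𝓡∂ 3).interior M))
    (h : ∀ n : ℕ, ∃ B : ℝ, (n : ℝ) < B ∧ ∃ (a R : TensorField M E)
      (F : (ℂ × ℕ) →₀ TensorField M E), A.IsSmoothSection E a univ ∧
      (∀ p, A.IsSmoothSection E (F p) univ) ∧ A.IsSmoothSection E R ((𝓡∂ 3).interior M) ∧
      A.InC E n (B + E.weight) R ∧ (∀ p ∈ F.support, (n : ℝ) < p.1.re) ∧
      ∀ x ∈ (𝓡∂ 3).interior M, u x = a x + A.logSum F x + R x) : A.ExtendsSmoothly E u := by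
  refine A.extendsSmoothly_of_localComp hu.mem fun e he K n => ?_
  obtain ⟨B, hB, a, R, F, ha, hF, hRs, hR, hre, huF⟩ := h n
  obtain ⟨f, hf, hfR⟩ := exists_contDiffOn_remainder hB hRs hR he K
  refine ⟨fun y => localComp e a K y +
    (∑ p ∈ F.support, powLog p.1 p.2 (A.rhoLoc e y) * localComp e (F p) K y) + f y, ?_,
    fun y hy h0 => ?_⟩
  · refine ContDiffOn.add (ContDiffOn.add ((ha.contDiffOn he K).of_le (by exact_mod_cast le_top))
      (ContDiffOn.sum fun p hp => ?_)) hf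
    exact ((contDiff_powLog n (hre p hp) p.2).comp_contDiffOn
      ((A.contDiffOn_rhoLoc he).of_le (by exact_mod_cast le_top))).mul
        (((hF p).contDiffOn he K).of_le (by exact_mod_cast le_top))
  · change localComp e a K y + (∑ p ∈ F.support, _) + f y = _
    rw [← A.localComp_logSum he F K ⟨hy, h0⟩, hfR y hy h0]
    exact (comp_congr e (v := fun x => a x + A.logSum F x + R x)
      (huF _ ((symm_mem_interior_iff he hy).2 h0)) K).symm

/-- Polyhomogeneous sections have expansions with remainders of arbitrarily high order. -/
lemma IsPolyhomogeneous.exists_logSum {b : TensorField M E} (hb : A.IsPolyhomogeneous E b) (k : ℕ) :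
    ∃ (F : (ℂ × ℕ) →₀ TensorField M E) (R : TensorField M E),
      (∀ p, A.IsSmoothSection E (F p) univ) ∧ A.IsSmoothSection E R ((𝓡∂ 3).interior M) ∧
      A.InB E k R ∧ ∀ x, b x = A.logSum F x + R x := by
  classical
  obtain ⟨hbs, s, d, U, -, -, hU, hN⟩ := hb
  obtain ⟨N, hN⟩ := hN k
  -- Different indices `i` may carry the same exponent; addition of finitely supported functions
  -- merges their coefficients.
  set F : (ℂ × ℕ) →₀ TensorField M E := ∑ i ∈ Finset.range (N + 1),
    ∑ m ∈ Finset.range (d i + 1), Finsupp.single (s i - (E.weight : ℂ), m) (U i m) with hF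
  have h1 : ∀ x, A.logSum F x = ∑ i ∈ Finset.range (N + 1), ∑ m ∈ Finset.range (d i + 1),
      A.rhoPowLog E (s i - (E.weight : ℂ)) m (U i m) x := by
    intro x
    rw [hF, logSum_sum]
    refine Finset.sum_congr rfl fun i _ => ?_
    rw [logSum_sum]
    exact Finset.sum_congr rfl fun m _ => A.logSum_single _ _ x
  have hFs : ∀ p, A.IsSmoothSection E (F p) univ := by
    intro p
    have h2 : A.IsSmoothSection E (fun x => ∑ i ∈ Finset.range (N + 1),
        ∑ m ∈ Finset.range (d i + 1),
          (Finsupp.single (s i - (E.weight : ℂ), m) (U i m) : (ℂ × ℕ) →₀ TensorField M E) p x)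
        univ := by
      refine IsSmoothSection.sum fun i _ => IsSmoothSection.sum fun m hm => ?_
      rw [Finsupp.single_apply]
      split_ifs
      · exact hU i m (Nat.lt_succ_iff.1 (Finset.mem_range.1 hm))
      · exact isSmoothSection_zero
    refine h2.congr fun x _ => ?_
    simp only [hF, Finsupp.finsetSum_apply, Finset.sum_apply]
  refine ⟨F, fun x => b x - A.logSum F x, hFs, hbs.sub (A.isSmoothSection_logSum hFs), ?_,
    fun x => (add_sub_cancel _ _).symm⟩
  simp only [h1]
  exact hN

end AHStructure

end AsympHyp

end
-- The main theorem: raising the exponents of the expansion.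
theorem mainTheorem2 {M : Type*} [TopologicalSpace M] [T2Space M] [CompactSpace M]
    [ChartedSpace (EuclideanHalfSpace 3) M] [IsManifold (𝓡∂ 3) ∞ M]
    (A : AsympHyp.AHStructure M) (E : AsympHyp.TensorType)
    (P : AsympHyp.TensorField M E → AsympHyp.TensorField M E) (hP : A.IsAdmissible E P)
    (μ : ℝ) (hμ : IsGreatest (Complex.re '' A.characteristicExponents E P) μ)
    (u : AsympHyp.TensorField M E) (hu : A.IsPolyhomogeneous E u)
    (hPu : A.ExtendsSmoothly E (P u))
    (hdec : ∃ δ : ℝ, μ < δ ∧ ∃ a b : AsympHyp.TensorField M E,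
      A.IsSmoothSection E a Set.univ ∧
      A.IsPolyhomogeneous E b ∧ A.InB E (δ + E.weight) b ∧
      ∀ x ∈ (𝓡∂ 3).interior M, u x = a x + b x) :
    A.ExtendsSmoothly E u := by
  obtain ⟨δ, hδ, a, b, ha, hb, hbδ, hab⟩ := hdec
  obtain ⟨v, hv, hvu⟩ := hPu
  refine AsympHyp.AHStructure.extendsSmoothly_of_expansions hu.1 fun n => ?_
  -- The remainder must be smaller than all terms treated below, whose exponents are under `δ` in
  -- the first stage and under `n + 1` in the second. Adding the weight converts exponents of
  -- components to decay measured in `g`.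
  obtain ⟨k, hk⟩ := exists_nat_gt (max δ (n + 1) + E.weight)
  obtain ⟨F₀, R, hF₀, hRs, hRB, hbF₀⟩ := hb.exists_logSum k
  have hR : ∀ j, A.InC E j (max δ (n + 1) + E.weight) R := fun j => hRB j _ hk
  -- The first stage uses only the decay of `b`.
  obtain ⟨F₁, ⟨hF₁, hbF₁⟩, hre₁⟩ := AsympHyp.AHStructure.exists_le_re δ
    (fun F : (ℂ × ℕ) →₀ AsympHyp.TensorField M E => (∀ p, A.IsSmoothSection E (F p) Set.univ) ∧
      ∀ x ∈ (𝓡∂ 3).interior M, b x = A.logSum F x + R x)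
    (fun F hF hex => by
      obtain ⟨q, hq, hqδ⟩ := hex
      obtain ⟨p, hp, hmin, hmax⟩ := AsympHyp.exists_leading ⟨q, hq⟩
      have hpδ : p.1.re < δ := (hmin q hq).trans_lt hqδ
      obtain ⟨F', hF', hFF', hsub⟩ := A.exists_logSum_shift hF.1 p fun e he x hx hxb K =>
        AsympHyp.AHStructure.comp_eq_zero_of_decay hF.1 (fun t ht => hbδ 0 _ (by linarith)) (hR 0) hF.2 hp hpδ
          (hpδ.trans_le (le_max_left _ _)) hmin hmax he hx hxb K
      exact ⟨p, hp, hpδ, F', ⟨hF', fun x hx => by rw [hF.2 x hx, hFF' x hx]⟩, hsub⟩)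
    F₀ ⟨hF₀, fun x _ => hbF₀ x⟩
  -- In the second stage the bound by `δ` is an invariant, while the smooth part may absorb further
  -- terms.
  obtain ⟨F₂, ⟨hF₂, -, a₂, ha₂, huF₂⟩, hre₂⟩ := AsympHyp.AHStructure.exists_le_re (n + 1)
    (fun F : (ℂ × ℕ) →₀ AsympHyp.TensorField M E => (∀ p, A.IsSmoothSection E (F p) Set.univ) ∧
      (∀ p ∈ F.support, δ ≤ p.1.re) ∧ ∃ a, A.IsSmoothSection E a Set.univ ∧
      ∀ x ∈ (𝓡∂ 3).interior M, u x = a x + A.logSum F x + R x)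
    (fun F hF hex => by
      classical
      obtain ⟨hFs, hFδ, a, ha, hua⟩ := hF
      obtain ⟨q, hq, hqn⟩ := hex
      obtain ⟨p, hp, hmin, hmax⟩ := AsympHyp.exists_leading ⟨q, hq⟩
      have hpn : p.1.re < n + 1 := (hmin q hq).trans_lt hqn
      -- A term `ρ^m` with natural exponent and no logarithm is smooth and goes into `a`. It needs
      -- only the real part of the leading term `p`, and it has to go before the indicial argument
      -- applies to `p`.
      by_cases hex : ∃ m : ℕ, (m : ℝ) = p.1.re ∧ ((m : ℂ), 0) ∈ F.support
      · obtain ⟨m, hm, hmF⟩ := hex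
        refine ⟨((m : ℂ), 0), hmF, by simpa [hm] using hpn, F.erase ((m : ℂ), 0),
          ⟨fun r => ?_, fun r hr => ?_, _, ha.add ((hFs ((m : ℂ), 0)).rhoPowLog_nat m),
            fun x hx => ?_⟩, fun r hr => ?_⟩
        · rw [Finsupp.erase_apply]
          split_ifs
          · exact AsympHyp.AHStructure.isSmoothSection_zero
          · exact hFs r
        · exact hFδ r (Finset.mem_of_mem_erase (by rwa [Finsupp.support_erase] at hr))
        · rw [hua x hx, A.logSum_erase F ((m : ℂ), 0), ← add_assoc]
        · rw [Finsupp.support_erase, Finset.mem_erase] at hr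
          exact Or.inr ⟨hr.2, hr.1⟩
      · push Not at hex
        obtain ⟨F', hF', hFF', hsub⟩ := A.exists_logSum_shift hFs p fun e he x hx hxb K => by
          have h1 := AsympHyp.AHStructure.hasIndicialValue_zero hP.geometric ha hFs hRs hua hv hvu (hR 2) hp
            (hpn.trans_le (le_max_right _ _)) hmin hmax hex hxb
          -- Otherwise `p.1` would be a characteristic exponent with `δ ≤ Re p.1`, whereas `μ < δ`.
          have h2 : F p x = 0 := by
            by_contra h2
            have h3 : p.1.re ≤ μ := hμ.2 ⟨p.1, ⟨x, hxb, F p, hFs p, h2, h1⟩, rfl⟩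
            have h4 := hFδ p hp
            linarith
          exact AsympHyp.comp_congr e (v := 0) h2 K
        refine ⟨p, hp, hpn, F', ⟨hF', fun r hr => ?_, a, ha, fun x hx => by
          rw [hua x hx, hFF' x hx]⟩, hsub⟩
        rcases hsub r hr with h | h
        · have h4 := hFδ p hp
          rw [h, Complex.add_re, Complex.one_re]
          linarith
        · exact hFδ r h.1)
    F₁ ⟨hF₁, hre₁, a, ha, fun x hx => by rw [hab x hx, hbF₁ x hx, add_assoc]⟩
  refine ⟨max δ (n + 1), (lt_add_one _).trans_le (le_max_right _ _), a₂, R, F₂, ha₂, hF₂, hRs,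
    hR n, fun p hp => (lt_add_one _).trans_le (hre₂ p hp), huF₂⟩
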